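/- **Setting.** Let $\mathfrak g$ be a finite-dimensional simple complex Lie algebra with Killing form $k$, let $\mathfrak h\subset\mathfrak b\subset\mathfrak g$ be a Cartan subalgebra and a Borel subalgebra. Let $\widehat{\mathfrak g}=\mathfrak g\otimes\mathbb C[t,t^{-1}]\oplus\mathbb CK\oplus\mathbb CD$ be the affine Kac–Moody algebra, with $K$ central, $[D,x\otimes t^n]=n\,x\otimes t^n$ and $[x\otimes t^n,y\otimes t^m]=[x,y]\otimes t^{n+m}+n\delta_{m,-n}k(x,y)K$. Put $\widehat{\mathfrak h}=\mathfrak h\oplus\mathbb CK\oplus\mathbb CD$ and $\widehat{\mathfrak b}=\mathfrak g\otimes t\mathbb C[t]\oplus\mathfrak b\oplus\mathbb CK\oplus\mathbb CD$. Let $\delta\in\widehat{\mathfrak h}^\star$ be given by $\delta(\mathfrak h\oplus\mathbb CK)=0$, $\delta(D)=1$. Let $R$ and $R^+$ be the sets of roots of $\mathfrak g$ and of $\mathfrak b$ with respect to $\mathfrak h$, and $\widehat R^+=R^+\cup\{\alpha+n\delta\mid\alpha\in R,\,n>0\}\cup\{n\delta\mid n>0\}$. For $\lambda,\mu\in\widehat{\mathfrak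 h}^\star$ write $\mu\le\lambda$ if $\lambda-\mu\in\mathbb Z_{\ge0}\widehat R^+$. A set $\mathcal J\subset\widehat{\mathfrak h}^\star$ is *open* if $\mu\le\lambda\in\mathcal J$ implies $\mu\in\mathcal J$, and *locally bounded* if $\{\gamma\in\mathcal J\mid\gamma\ge\mu\}$ is finite for every $\mu\in\widehat{\mathfrak h}^\star$. Let $A$ be a local deformation algebra, i.e. a local Noetherian commutative unital algebra over the symmetric algebra $S(\mathfrak h)$, and let $\tau\colon\widehat{\mathfrak h}\to\mathfrak h\to A$ be the induced map (so $\tau(K)=\tau(D)=0$). A $\widehat{\mathfrak g}_A$-module is an $A$-module with an $A$-linear action of $\widehat{\mathfrak g}$. Its weight spaces are $M_\lambda=\{m\mid h.m=(\lambda(h)+\tau(h))m \ \forall h\in\widehat{\mathfrak h}\}$, $\lambda\in\widehat{\mathfrak h}^\star$. The category $\widehat{\mathcal O}_A$ consists of the $\widehat{\mathfrak g}_A$-modules $M$ with $M=\bigoplus_\lambda M_\lambda$ in which every element lies in a $\widehat{\mathfrak b}$-stable $A$-submodule that is finitely generated over $A$. Its full subcategory $\widehat{\mathcal O}_A^{\mathcal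 J}$ consists of the objects $M$ such that $M_\lambda\ne0$ implies $\lambda\in\mathcal J$. The simple object $L_A(\lambda)$ is the unique simple quotient of the Verma module of highest weight $\lambda$ over the residue field $A/\mathfrak m$ (induced from the character $\lambda+\tau$), regarded as a $\widehat{\mathfrak g}_A$-module. Let $T=\,\cdot\otimes_{\mathbb C}L(\delta)$, where $L(\delta)$ is the one-dimensional $\widehat{\mathfrak g}$-module on which $D$ acts by $1$ and $\mathfrak g\otimes\mathbb C[t,t^{-1}]\oplus\mathbb CK$ acts by $0$. For $n\in\mathbb Z$ let $(\mathcal A_A)_n$ be the space of natural transformations $\sigma\colon\mathrm{id}\to T^n$ of functors on $\widehat{\mathcal O}_A$ such that $T^m(\sigma^M)=\sigma^{T^mM}$ for all $M\in\widehat{\mathcal O}_A$ and $m\in\mathbb Z$ (under $T^mT^n=T^nT^m$). An object $M$ of $\widehat{\mathcal O}_A$ is *restricted* if $\sigma^M=0$ for all $\sigma\in(\mathcal A_A)_n$ and all $n\neq0$. Let $\overline{\mathcal O}_A\subset\widehat{\mathcal O}_A$ be the full subcategory of restricted objects, and $\overline{\mathcal O}_A^{\mathcal J}=\overline{\mathcal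 O}_A\cap\widehat{\mathcal O}_A^{\mathcal J}$. For $M\in\widehat{\mathcal O}_A$ the *restriction* $\overline M$ is the quotient of $M$ by the submodule generated by the images of all $T^{-n}\sigma^M\colon T^{-n}M\to M$ with $n\ne0$, $\sigma\in(\mathcal A_A)_n$. A *projective cover* of $L$ in one of these categories is a surjective morphism $c\colon P\to L$ in it such that $P$ is projective in the category and every morphism $g\colon M\to P$ in the category with $c\circ g$ surjective is surjective. **Theorem (restricted projective covers).** Let $A$ be a local deformation algebra, let $\mathcal J\subset\widehat{\mathfrak h}^\star$ be open and locally bounded, and let $\lambda\in\mathcal J$. Then: 1. $L_A(\lambda)$ is an object of $\overline{\mathcal O}_A^{\mathcal J}$ and has a projective cover in $\overline{\mathcal O}_A^{\mathcal J}$. 2. $L_A(\lambda)$ has a projective cover $P_A^{\mathcal J}(\lambda)\to L_A(\lambda)$ in $\widehat{\mathcal O}_A^{\mathcal J}$. 3. For every projective cover $c\colon P\to L_A(\lambda)$ in $\widehat{\mathcal O}_A^{\mathcal J}$, the restriction $\overline P$ is the largest restricted quotient of $P$ (it is restricted, and every morphism from $P$ to a restricted object of $\widehat{\mathcal O}_A$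 factors uniquely through $P\to\overline P$), and $c$ factors as $P\to\overline P\xrightarrow{\ \bar c\ }L_A(\lambda)$, where $\bar c$ is a projective cover of $L_A(\lambda)$ in $\overline{\mathcal O}_A^{\mathcal J}$. -/

import Mathlib

open CategoryTheory TensorProduct

universe u

noncomputable section

namespace AffineO

/-! ## The affine Kac-Moody algebra -/

section Affine

/-- The vector space `𝔤 ⊗ ℂ[t, t⁻¹] ⊕ ℂ K ⊕ ℂ D` underlying the affine Kac-Moody algebra.
An element `∑ xₙ ⊗ tⁿ` of the loop algebra is given by its coefficients, a finitely supported
function `n ↦ xₙ`; so `x ⊗ tⁿ` is `Finsupp.single n x`. -/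
@[ext] structure Affine (𝔤 : Type u) [LieRing 𝔤] where
  /-- the component in the loop algebra -/
  loop : ℤ →₀ 𝔤
  /-- the coefficient of the central element `K` -/
  cK : ℂ
  /-- the coefficient of the derivation `D = t d/dt` -/
  cD : ℂ

namespace Affine

variable {𝔤 : Type u} [LieRing 𝔤]

/-- The underlying vector space as a product. -/
def toProd : Affine 𝔤 ≃ (ℤ →₀ 𝔤) × ℂ × ℂ where
  toFun x := (x.loop, x.cK, x.cD)
  invFun x := ⟨x.1, x.2.1, x.2.2⟩
  left_inv _ := rfl
  right_inv _ := rfl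

instance : AddCommGroup (Affine 𝔤) := toProd.addCommGroup
instance [LieAlgebra ℂ 𝔤] : Module ℂ (Affine 𝔤) := toProd.module ℂ

@[simp] theorem zero_loop : (0 : Affine 𝔤).loop = 0 := rfl
@[simp] theorem zero_cK : (0 : Affine 𝔤).cK = 0 := rfl
@[simp] theorem zero_cD : (0 : Affine 𝔤).cD = 0 := rfl
@[simp] theorem add_loop (x y : Affine 𝔤) : (x + y).loop = x.loop + y.loop := rfl
@[simp] theorem add_cK (x y : Affine 𝔤) : (x + y).cK = x.cK + y.cK := rfl
@[simp] theorem add_cD (x y : Affine 𝔤) : (x + y).cD = x.cD + y.cD := rfl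
@[simp] theorem smul_loop [LieAlgebra ℂ 𝔤] (c : ℂ) (x : Affine 𝔤) : (c • x).loop = c • x.loop := rfl
@[simp] theorem smul_cK [LieAlgebra ℂ 𝔤] (c : ℂ) (x : Affine 𝔤) : (c • x).cK = c * x.cK := rfl
@[simp] theorem smul_cD [LieAlgebra ℂ 𝔤] (c : ℂ) (x : Affine 𝔤) : (c • x).cD = c * x.cD := rfl

end Affine

variable (𝔤 : Type u) [LieRing 𝔤] [LieAlgebra ℂ 𝔤]

/-- The bracket of the loop algebra, `[x ⊗ tⁿ, y ⊗ tᵐ] = [x, y] ⊗ tⁿ⁺ᵐ`. -/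
def loopBracket : (ℤ →₀ 𝔤) →ₗ[ℂ] (ℤ →₀ 𝔤) →ₗ[ℂ] (ℤ →₀ 𝔤) :=
  Finsupp.lsum ℂ fun n => LinearMap.flip <| Finsupp.lsum ℂ fun m =>
    ((LieModule.toEnd ℂ 𝔤 𝔤 : 𝔤 →ₗ[ℂ] Module.End ℂ 𝔤).compr₂ (Finsupp.lsingle (n + m))).flip

/-- The derivation `t d/dt` of the loop algebra, `x ⊗ tⁿ ↦ n x ⊗ tⁿ`. -/
def loopD : (ℤ →₀ 𝔤) →ₗ[ℂ] (ℤ →₀ 𝔤) :=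
  Finsupp.lsum ℂ fun n => (n : ℂ) • Finsupp.lsingle n

/-- The cocycle `(x ⊗ tⁿ, y ⊗ tᵐ) ↦ n δ_{m,-n} k(x, y)`, where `k` is the Killing form. -/
def loopCocycle : (ℤ →₀ 𝔤) →ₗ[ℂ] (ℤ →₀ 𝔤) →ₗ[ℂ] ℂ :=
  Finsupp.lsum ℂ fun n => LinearMap.flip <| Finsupp.lsum ℂ fun m =>
    (if m = -n then (n : ℂ) else 0) • (killingForm ℂ 𝔤).flip

variable {𝔤}

@[simp] theorem loopBracket_single (n m : ℤ) (x y : 𝔤) :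
    loopBracket 𝔤 (Finsupp.single n x) (Finsupp.single m y) = Finsupp.single (n + m) ⁅x, y⁆ := by
  simp [loopBracket]

@[simp] theorem loopD_single (n : ℤ) (x : 𝔤) :
    loopD 𝔤 (Finsupp.single n x) = (n : ℂ) • Finsupp.single n x := by
  simp [loopD]

theorem loopCocycle_single (n m : ℤ) (x y : 𝔤) :
    loopCocycle 𝔤 (Finsupp.single n x) (Finsupp.single m y) =
      if m = -n then (n : ℂ) * killingForm ℂ 𝔤 x y else 0 := by
  by_cases h : m = -n
  · simp [loopCocycle, h]
  · simp [loopCocycle, h]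

theorem loopBracket_self (f : ℤ →₀ 𝔤) : loopBracket 𝔤 f f = 0 := by
  have skew : ∀ f g, loopBracket 𝔤 f g = - loopBracket 𝔤 g f := by
    intro f g
    induction f using Finsupp.induction_linear with
    | zero => simp
    | add f₁ f₂ h₁ h₂ => simp only [map_add, LinearMap.add_apply, h₁, h₂]; abel
    | single n x =>
      induction g using Finsupp.induction_linear with
      | zero => simp
      | add f₁ f₂ h₁ h₂ => simp only [map_add, LinearMap.add_apply, h₁, h₂]; abel
      | single m y =>
        rw [loopBracket_single, loopBracket_single, add_comm, ← lie_skew, Finsupp.single_neg]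
  have h2 : (2 : ℂ) • loopBracket 𝔤 f f = 0 := by
    rw [two_smul]; nth_rewrite 1 [skew f f]; exact neg_add_cancel _
  exact (smul_eq_zero.mp h2).resolve_left two_ne_zero

theorem loopBracket_leibniz (f g h : ℤ →₀ 𝔤) :
    loopBracket 𝔤 f (loopBracket 𝔤 g h) =
      loopBracket 𝔤 (loopBracket 𝔤 f g) h + loopBracket 𝔤 g (loopBracket 𝔤 f h) := by
  induction f using Finsupp.induction_linear with
  | zero => simp
  | add f₁ f₂ h₁ h₂ => simp only [map_add, LinearMap.add_apply, h₁, h₂]; abel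
  | single n x =>
    induction g using Finsupp.induction_linear with
    | zero => simp
    | add f₁ f₂ h₁ h₂ => simp only [map_add, LinearMap.add_apply, h₁, h₂]; abel
    | single m y =>
      induction h using Finsupp.induction_linear with
      | zero => simp
      | add f₁ f₂ h₁ h₂ => simp only [map_add, h₁, h₂]; abel
      | single l z =>
        simp only [loopBracket_single, leibniz_lie x y z, Finsupp.single_add, add_assoc,
          add_left_comm m n l]

theorem loopD_loopBracket (f g : ℤ →₀ 𝔤) :
    loopD 𝔤 (loopBracket 𝔤 f g) =
      loopBracket 𝔤 (loopD 𝔤 f) g + loopBracket 𝔤 f (loopD 𝔤 g) := by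
  induction f using Finsupp.induction_linear with
  | zero => simp
  | add f₁ f₂ h₁ h₂ => simp only [map_add, LinearMap.add_apply, h₁, h₂]; abel
  | single n x =>
    induction g using Finsupp.induction_linear with
    | zero => simp
    | add f₁ f₂ h₁ h₂ => simp only [map_add, h₁, h₂]; abel
    | single m y =>
      rw [loopBracket_single, loopD_single, loopD_single, loopD_single, map_smul, map_smul,
        LinearMap.smul_apply, loopBracket_single, ← add_smul]
      push_cast; rfl

theorem loopCocycle_skew (f g : ℤ →₀ 𝔤) : loopCocycle 𝔤 f g = - loopCocycle 𝔤 g f := by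
  induction f using Finsupp.induction_linear with
  | zero => simp
  | add f₁ f₂ h₁ h₂ => simp only [map_add, LinearMap.add_apply, h₁, h₂]; ring
  | single n x =>
    induction g using Finsupp.induction_linear with
    | zero => simp
    | add f₁ f₂ h₁ h₂ => simp only [map_add, LinearMap.add_apply, h₁, h₂]; ring
    | single m y =>
      have hs : killingForm ℂ 𝔤 y x = killingForm ℂ 𝔤 x y := LieModule.traceForm_comm ℂ 𝔤 𝔤 y x
      rw [loopCocycle_single, loopCocycle_single, hs]
      by_cases h : m = -n
      · subst h; simp
      · rw [if_neg h, if_neg (by omega)]; simp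

theorem loopCocycle_loopD (f g : ℤ →₀ 𝔤) :
    loopCocycle 𝔤 (loopD 𝔤 f) g = - loopCocycle 𝔤 f (loopD 𝔤 g) := by
  induction f using Finsupp.induction_linear with
  | zero => simp
  | add f₁ f₂ h₁ h₂ => simp only [map_add, LinearMap.add_apply, h₁, h₂]; ring
  | single n x =>
    induction g using Finsupp.induction_linear with
    | zero => simp
    | add f₁ f₂ h₁ h₂ => simp only [map_add, h₁, h₂]; ring
    | single m y =>
      rw [loopD_single, loopD_single, map_smul, map_smul, LinearMap.smul_apply,
        loopCocycle_single]
      by_cases h : m = -n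
      · subst h; simp
      · rw [if_neg h]; simp

theorem loopCocycle_loopBracket (f g h : ℤ →₀ 𝔤) :
    loopCocycle 𝔤 f (loopBracket 𝔤 g h) =
      loopCocycle 𝔤 (loopBracket 𝔤 f g) h + loopCocycle 𝔤 g (loopBracket 𝔤 f h) := by
  induction f using Finsupp.induction_linear with
  | zero => simp
  | add f₁ f₂ h₁ h₂ => simp only [map_add, LinearMap.add_apply, h₁, h₂]; ring
  | single n x =>
    induction g using Finsupp.induction_linear with
    | zero => simp
    | add f₁ f₂ h₁ h₂ => simp only [map_add, LinearMap.add_apply, h₁, h₂]; ring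
    | single m y =>
      induction h using Finsupp.induction_linear with
      | zero => simp
      | add f₁ f₂ h₁ h₂ => simp only [map_add, h₁, h₂]; ring
      | single l z =>
        have hinv : ∀ a b c : 𝔤, killingForm ℂ 𝔤 ⁅a, b⁆ c = - killingForm ℂ 𝔤 b ⁅a, c⁆ :=
          fun a b c => LieModule.traceForm_lieInvariant ℂ 𝔤 𝔤 a b c
        have e1 : killingForm ℂ 𝔤 x ⁅y, z⁆ = killingForm ℂ 𝔤 ⁅x, y⁆ z := by
          rw [← lie_skew x y, map_neg, LinearMap.neg_apply, hinv, neg_neg]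
        have e2 : killingForm ℂ 𝔤 y ⁅x, z⁆ = - killingForm ℂ 𝔤 ⁅x, y⁆ z := by
          rw [hinv, neg_neg]
        rw [loopBracket_single, loopBracket_single, loopBracket_single, loopCocycle_single,
          loopCocycle_single, loopCocycle_single, e1, e2]
        by_cases h : n + m + l = 0
        · rw [if_pos (by omega), if_pos (by omega), if_pos (by omega)]
          push_cast; ring
        · rw [if_neg (by omega), if_neg (by omega), if_neg (by omega)]; simp

namespace Affine

/-- The bracket of the affine Kac-Moody algebra: `K` is central, `D` acts as `t d/dt`, and
`[x ⊗ tⁿ, y ⊗ tᵐ] = [x, y] ⊗ tⁿ⁺ᵐ + n δ_{m,-n} k(x, y) K`. -/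
instance : Bracket (Affine 𝔤) (Affine 𝔤) where
  bracket x y :=
    { loop := loopBracket 𝔤 x.loop y.loop + x.cD • loopD 𝔤 y.loop - y.cD • loopD 𝔤 x.loop
      cK := loopCocycle 𝔤 x.loop y.loop
      cD := 0 }

@[simp] theorem lie_loop (x y : Affine 𝔤) : ⁅x, y⁆.loop =
    loopBracket 𝔤 x.loop y.loop + x.cD • loopD 𝔤 y.loop - y.cD • loopD 𝔤 x.loop := rfl
@[simp] theorem lie_cK (x y : Affine 𝔤) : ⁅x, y⁆.cK = loopCocycle 𝔤 x.loop y.loop := rfl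
@[simp] theorem lie_cD (x y : Affine 𝔤) : ⁅x, y⁆.cD = 0 := rfl

instance : LieRing (Affine 𝔤) where
  add_lie x y z := by
    ext1
    · simp only [lie_loop, add_loop, add_cD, add_smul, map_add, LinearMap.add_apply, smul_add]
      abel
    · simp
    · simp
  lie_add x y z := by
    ext1
    · simp only [lie_loop, add_loop, add_cD, add_smul, map_add, smul_add]; abel
    · simp
    · simp
  lie_self x := by
    ext1
    · simp [loopBracket_self]
    · have h := loopCocycle_skew x.loop x.loop
      simp only [lie_cK, zero_cK]
      linear_combination h / 2
    · simp
  leibniz_lie x y z := by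
    ext1
    · have skew : loopBracket 𝔤 y.loop (loopD 𝔤 x.loop) =
          - loopBracket 𝔤 (loopD 𝔤 x.loop) y.loop := by
        have h := loopBracket_self (y.loop + loopD 𝔤 x.loop)
        simp only [map_add, LinearMap.add_apply, loopBracket_self, zero_add, add_zero] at h
        exact eq_neg_of_add_eq_zero_right h
      simp only [lie_loop, add_loop, lie_cD, map_add, map_sub, LinearMap.add_apply,
        LinearMap.sub_apply, map_smul, LinearMap.smul_apply, loopD_loopBracket, smul_add, smul_sub,
        zero_smul, loopBracket_leibniz x.loop y.loop z.loop, skew]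
      module
    · have h1 := loopCocycle_loopBracket x.loop y.loop z.loop
      have h2 := loopCocycle_loopD x.loop z.loop
      have h3 := loopCocycle_loopD y.loop z.loop
      have h4 := loopCocycle_loopD x.loop y.loop
      have h5 := loopCocycle_skew y.loop (loopD 𝔤 x.loop)
      simp only [lie_cK, lie_loop, add_cK, map_add, map_sub, map_smul, LinearMap.add_apply,
        LinearMap.sub_apply, LinearMap.smul_apply, smul_eq_mul]
      linear_combination h1 + y.cD * h2 - x.cD * h3 + z.cD * h5 - z.cD * h4
    · simp

instance : LieAlgebra ℂ (Affine 𝔤) where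
  lie_smul c x y := by
    ext1
    · simp only [lie_loop, smul_loop, smul_cD, map_smul]
      module
    · simp
    · simp

end Affine

end Affine

theorem loopBracket_apply {𝔤 : Type u} [LieRing 𝔤] [LieAlgebra ℂ 𝔤] (f g : ℤ →₀ 𝔤) (k : ℤ) :
    loopBracket 𝔤 f g k = f.sum fun n x => g.sum fun m y => if n + m = k then ⁅x, y⁆ else 0 := by
  classical
  simp [loopBracket, Finsupp.sum, Finsupp.finsetSum_apply, Finsupp.single_apply]

theorem loopD_apply {𝔤 : Type u} [LieRing 𝔤] [LieAlgebra ℂ 𝔤] (f : ℤ →₀ 𝔤) (k : ℤ) :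
    loopD 𝔤 f k = (k : ℂ) • f k := by
  induction f using Finsupp.induction_linear with
  | zero => simp
  | add f g hf hg => simp [hf, hg]
  | single n x =>
    rw [loopD_single, Finsupp.smul_apply]
    by_cases h : n = k
    · rw [h]
    · simp [Finsupp.single_eq_of_ne (Ne.symm h)]

/-! ## Cartan subalgebra, Borel subalgebra, roots and the order on weights -/

section Roots

variable {𝔤 : Type u} [LieRing 𝔤] [LieAlgebra ℂ 𝔤]

/-- A Borel subalgebra is a maximal solvable subalgebra. -/
def IsBorel (𝔟 : LieSubalgebra ℂ 𝔤) : Prop :=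
  Maximal (fun 𝔰 : LieSubalgebra ℂ 𝔤 => LieAlgebra.IsSolvable 𝔰) 𝔟

variable (H 𝔟 : LieSubalgebra ℂ 𝔤)

/-- The affine Cartan subalgebra `𝔥 ⊕ ℂ K ⊕ ℂ D`, as a vector space. -/
abbrev AffineCartan := H × ℂ × ℂ

/-- The linear forms on the affine Cartan subalgebra. -/
abbrev Weight := Module.Dual ℂ (AffineCartan H)

/-- The inclusion of `𝔥 ⊕ ℂ K ⊕ ℂ D` into the affine Kac-Moody algebra. -/
def cartanIncl : AffineCartan H →ₗ[ℂ] Affine 𝔤 where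
  toFun h := ⟨Finsupp.single 0 (h.1 : 𝔤), h.2.1, h.2.2⟩
  map_add' _ _ := by ext1 <;> simp
  map_smul' _ _ := by ext1 <;> simp

/-- The affine Borel subalgebra `𝔤 ⊗ t ℂ[t] ⊕ 𝔟 ⊕ ℂ K ⊕ ℂ D`. -/
def affineBorel : LieSubalgebra ℂ (Affine 𝔤) where
  carrier := {x | (∀ n < 0, x.loop n = 0) ∧ x.loop 0 ∈ 𝔟}
  add_mem' := by
    rintro x y ⟨hx, hx'⟩ ⟨hy, hy'⟩
    exact ⟨fun n hn => by simp [hx n hn, hy n hn], by simpa using add_mem hx' hy'⟩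
  zero_mem' := ⟨fun _ _ => rfl, zero_mem 𝔟⟩
  smul_mem' := by
    rintro c x ⟨hx, hx'⟩
    exact ⟨fun n hn => by simp [hx n hn], by simpa using 𝔟.smul_mem c hx'⟩
  lie_mem' := by
    rintro x y ⟨hx, hx'⟩ ⟨hy, hy'⟩
    refine ⟨fun n hn => ?_, ?_⟩
    · have h : loopBracket 𝔤 x.loop y.loop n = 0 := by
        rw [loopBracket_apply]
        refine Finset.sum_eq_zero fun i _ => Finset.sum_eq_zero fun j _ => ?_
        by_cases hij : i + j = n
        · rcases (by omega : i < 0 ∨ j < 0) with h | h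
          · simp [hx i h]
          · simp [hy j h]
        · simp [hij]
      simp [loopD_apply, h, hx n hn, hy n hn]
    · have h : loopBracket 𝔤 x.loop y.loop 0 ∈ 𝔟 := by
        rw [loopBracket_apply]
        refine sum_mem fun i _ => sum_mem fun j _ => ?_
        by_cases hij : i + j = 0
        · rcases (by omega : i < 0 ∨ j < 0 ∨ (i = 0 ∧ j = 0)) with h | h | ⟨rfl, rfl⟩
          · simp [hx i h]
          · simp [hy j h]
          · simpa using 𝔟.lie_mem hx' hy'
        · simp [hij]
      simpa [loopD_apply] using h

/-- The element `δ`: it vanishes on `𝔥 ⊕ ℂ K`, and `δ(D) = 1`. -/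
def delta : Weight H := LinearMap.snd ℂ ℂ ℂ ∘ₗ LinearMap.snd ℂ H (ℂ × ℂ)

/-- A linear form on `𝔥`, extended by zero to `ℂ K ⊕ ℂ D`. -/
def extendForm (α : Module.Dual ℂ H) : Weight H := α ∘ₗ LinearMap.fst ℂ H (ℂ × ℂ)

/-- The roots of a subalgebra `𝔰` of `𝔤` with respect to `𝔥`. -/
def roots (𝔰 : LieSubalgebra ℂ 𝔤) : Set (Module.Dual ℂ H) :=
  {α | α ≠ 0 ∧ ∃ x ∈ 𝔰, x ≠ 0 ∧ ∀ h : H, ⁅(h : 𝔤), x⁆ = α h • x}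

/-- The positive affine roots, i.e. `R⁺ ∪ {α + n δ | α ∈ R, n > 0} ∪ {n δ | n > 0}`, where `R`
is the set of roots of `𝔤` and `R⁺` the set of roots of `𝔟`. -/
def posRoots : Set (Weight H) :=
  {β | ∃ α ∈ roots H 𝔟, β = extendForm H α} ∪
  {β | ∃ α ∈ roots H (⊤ : LieSubalgebra ℂ 𝔤), ∃ n : ℕ, 0 < n ∧
    β = extendForm H α + (n : ℂ) • delta H} ∪
  {β | ∃ n : ℕ, 0 < n ∧ β = (n : ℂ) • delta H}

/-- The order on weights: `μ ≤ lam` if `lam - μ` is a sum of positive affine roots. -/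
def WeightLE (μ lam : Weight H) : Prop := lam - μ ∈ AddSubmonoid.closure (posRoots H 𝔟)

/-- A set of weights is open if it is closed under passing to smaller weights. -/
def IsOpenWeights (J : Set (Weight H)) : Prop :=
  ∀ lam ∈ J, ∀ μ, WeightLE H 𝔟 μ lam → μ ∈ J

/-- A set `J` of weights is locally bounded if every `{γ ∈ J | γ ≥ μ}` is finite. -/
def IsLocallyBounded (J : Set (Weight H)) : Prop :=
  ∀ μ, {γ | γ ∈ J ∧ WeightLE H 𝔟 μ γ}.Finite

end Roots

/-! ## Modules over the affine Kac-Moody algebra with coefficients in `A` -/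

section Modules

variable (𝔤 : Type u) [LieRing 𝔤] [LieAlgebra ℂ 𝔤] (A : Type u) [CommRing A] [Algebra ℂ A]

/-- An `A`-module with an `A`-linear action of the affine Kac-Moody algebra. -/
structure AffineMod where
  /-- the underlying type -/
  carrier : Type u
  [addCommGroup : AddCommGroup carrier]
  [module : Module A carrier]
  /-- the action -/
  ρ : Affine 𝔤 →ₛₗ[algebraMap ℂ A] Module.End A carrier
  ρ_lie : ∀ x y, ρ ⁅x, y⁆ = ρ x * ρ y - ρ y * ρ x

attribute [instance] AffineMod.addCommGroup AffineMod.module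

namespace AffineMod

variable {𝔤 A}

/-- Homomorphisms: `A`-linear maps that commute with the action. -/
@[ext] structure Hom (M N : AffineMod 𝔤 A) where
  /-- the underlying linear map -/
  toLin : M.carrier →ₗ[A] N.carrier
  comm : ∀ x m, toLin (M.ρ x m) = N.ρ x (toLin m)

instance : Category (AffineMod 𝔤 A) where
  Hom := Hom
  id M := ⟨LinearMap.id, fun _ _ => rfl⟩
  comp f g := ⟨g.toLin ∘ₗ f.toLin, fun x m => by simp [f.comm, g.comm]⟩

/-- A subspace is stable if it is a submodule for the affine Kac-Moody algebra. -/
def IsStable (M : AffineMod 𝔤 A) (N : Submodule A M.carrier) : Prop :=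
  ∀ x, N ≤ N.comap (M.ρ x)

/-- The quotient by a submodule. -/
def quot (M : AffineMod 𝔤 A) (N : Submodule A M.carrier) (hN : M.IsStable N) :
    AffineMod 𝔤 A where
  carrier := M.carrier ⧸ N
  ρ :=
    { toFun := fun x => N.mapQ N (M.ρ x) (hN x)
      map_add' := fun x y => by ext; simp
      map_smul' := fun c x => by ext; simp }
  ρ_lie x y := by ext; simp [M.ρ_lie]

/-- The projection to a quotient. -/
def quotMk (M : AffineMod 𝔤 A) (N : Submodule A M.carrier) (hN : M.IsStable N) :
    M ⟶ M.quot N hN where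
  toLin := N.mkQ
  comm _ _ := rfl

theorem isStable_range {M N : AffineMod 𝔤 A} (f : M ⟶ N) :
    N.IsStable (LinearMap.range f.toLin) := by
  rintro x _ ⟨m, rfl⟩
  exact ⟨M.ρ x m, f.comm x m⟩

theorem isStable_iSup {ι : Sort*} (M : AffineMod 𝔤 A) (N : ι → Submodule A M.carrier)
    (hN : ∀ i, M.IsStable (N i)) : M.IsStable (⨆ i, N i) :=
  fun x => iSup_le fun i => (hN i x).trans (Submodule.comap_mono (le_iSup N i))

/-- The module `M ⊗ L(n δ) = Tⁿ M`. As `L(n δ)` is the line on which `D` acts by `n` and the loop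
algebra and `K` act by zero, this is the `A`-module `M` on which an element `x` with `D`-component
`d` acts by `m ↦ x.m + n d m`. -/
def twist (n : ℤ) (M : AffineMod 𝔤 A) : AffineMod 𝔤 A where
  carrier := M.carrier
  ρ :=
    { toFun := fun x => M.ρ x + algebraMap ℂ A (n * x.cD) • (1 : Module.End A M.carrier)
      map_add' := fun x y => by
        simp only [map_add, Affine.add_cD, mul_add, add_smul]; abel
      map_smul' := fun c x => by
        simp only [map_smulₛₗ, Affine.smul_cD, map_mul, smul_add, smul_smul]; congr 2; ring }
  ρ_lie x y := by
    simp only [LinearMap.coe_mk, AddHom.coe_mk, M.ρ_lie, Affine.lie_cD, mul_zero, map_zero,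
      zero_smul, add_zero, mul_add, add_mul, smul_mul_assoc, mul_smul_comm, one_mul, mul_one]
    module

/-- The functor `Tⁿ`. -/
def T (n : ℤ) : AffineMod 𝔤 A ⥤ AffineMod 𝔤 A where
  obj := twist n
  map {M N} f := ⟨f.toLin, fun x (m : M.carrier) => by
    change f.toLin (M.ρ x m + algebraMap ℂ A (n * x.cD) • m) =
      N.ρ x (f.toLin m) + algebraMap ℂ A (n * x.cD) • f.toLin m
    rw [map_add, map_smul, f.comm]⟩

/-- The canonical identification `Tᵐ Tⁿ M = Tⁿ Tᵐ M`. -/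
def twistComm (m n : ℤ) (M : AffineMod 𝔤 A) :
    (T m).obj ((T n).obj M) ⟶ (T n).obj ((T m).obj M) where
  toLin := LinearMap.id (M := M.carrier)
  comm x (v : M.carrier) := by
    change (M.ρ x v + algebraMap ℂ A (n * x.cD) • v) + algebraMap ℂ A (m * x.cD) • v =
      (M.ρ x v + algebraMap ℂ A (m * x.cD) • v) + algebraMap ℂ A (n * x.cD) • v
    abel

/-- The canonical identification `T⁻ⁿ Tⁿ M = M`. -/
def twistCancel (n : ℤ) (M : AffineMod 𝔤 A) : (T (-n)).obj ((T n).obj M) ⟶ M where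
  toLin := LinearMap.id (M := M.carrier)
  comm x (v : M.carrier) := by
    change (M.ρ x v + algebraMap ℂ A (n * x.cD) • v) + algebraMap ℂ A ((-n : ℤ) * x.cD) • v =
      M.ρ x v
    rw [add_assoc, ← add_smul, ← map_add]
    push_cast
    simp

/-- Comparison of `twist` with the tensor product: under the canonical isomorphism
`M ⊗ ℂ = M`, `m ⊗ z ↦ z m`, the tensor product action of the affine Kac-Moody algebra on
`M ⊗ L(n δ)` becomes the action on `twist n M`. -/
theorem twist_eq_tensor (n : ℤ) (M : AffineMod 𝔤 A) (x : Affine 𝔤) (m : M.carrier) (z : ℂ) :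
    letI : Module ℂ M.carrier := Module.compHom M.carrier (algebraMap ℂ A)
    TensorProduct.rid ℂ M.carrier (M.ρ x m ⊗ₜ[ℂ] z + m ⊗ₜ[ℂ] ((n * x.cD) * z)) =
      (twist n M).ρ x (TensorProduct.rid ℂ M.carrier (m ⊗ₜ[ℂ] z)) := by
  let i : Module ℂ M.carrier := Module.compHom M.carrier (algebraMap ℂ A)
  have hs : ∀ (c : ℂ) (v : M.carrier), c • v = algebraMap ℂ A c • v := fun _ _ => rfl
  rw [map_add, TensorProduct.rid_tmul, TensorProduct.rid_tmul, TensorProduct.rid_tmul, hs, hs, hs,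
    map_mul, mul_smul]
  change _ = M.ρ x (algebraMap ℂ A z • m) + algebraMap ℂ A (n * x.cD) • (algebraMap ℂ A z • m)
  rw [map_smul]

end AffineMod

end Modules

/-! ## The deformed category `O` -/

section CategoryO

variable {𝔤 : Type u} [LieRing 𝔤] [LieAlgebra ℂ 𝔤] (H 𝔟 : LieSubalgebra ℂ 𝔤)
  (A : Type u) [CommRing A] [Algebra ℂ A] [Algebra (SymmetricAlgebra ℂ H) A]

/-- The map `τ` from the affine Cartan subalgebra to `A`, `(h, c, d) ↦ h · 1`. -/
def tau (h : AffineCartan H) : A :=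
  algebraMap (SymmetricAlgebra ℂ H) A (SymmetricAlgebra.ι ℂ H h.1)

variable {A}

/-- The weight space `{m | h.m = (lam(h) + τ(h)) m for all h}`. -/
def weightSpace (M : AffineMod 𝔤 A) (lam : Weight H) : Submodule A M.carrier :=
  ⨅ h : AffineCartan H,
    LinearMap.ker (M.ρ (cartanIncl H h) - (algebraMap ℂ A (lam h) + tau H A h) • LinearMap.id)

theorem mem_weightSpace {M : AffineMod 𝔤 A} {lam : Weight H} {m : M.carrier} :
    m ∈ weightSpace H M lam ↔
      ∀ h, M.ρ (cartanIncl H h) m = (algebraMap ℂ A (lam h) + tau H A h) • m := by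
  simp [weightSpace, sub_eq_zero]

/-- Weight modules: the module is the internal direct sum of its weight spaces. -/
def IsWeightModule (M : AffineMod 𝔤 A) : Prop :=
  iSupIndep (weightSpace H M) ∧ ⨆ lam, weightSpace H M lam = ⊤

/-- Every element lies in a submodule for the affine Borel subalgebra that is finitely generated
over `A`. -/
def IsLocallyFinite (M : AffineMod 𝔤 A) : Prop :=
  ∀ m : M.carrier, ∃ N : Submodule A M.carrier, m ∈ N ∧ N.FG ∧
    ∀ x ∈ affineBorel 𝔟, N ≤ N.comap (M.ρ x)

variable (A)

/-- The category `O_A`. -/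
def catO : ObjectProperty (AffineMod 𝔤 A) :=
  fun M => IsWeightModule H M ∧ IsLocallyFinite 𝔟 M

/-- The truncated category `O_A^J`. -/
def truncO (J : Set (Weight H)) : ObjectProperty (AffineMod 𝔤 A) :=
  fun M => catO H 𝔟 A M ∧ ∀ lam, weightSpace H M lam ≠ ⊥ → lam ∈ J

variable {A} in
theorem weightSpace_twist (n : ℤ) (M : AffineMod 𝔤 A) (lam : Weight H) :
    weightSpace H (M.twist n) lam = weightSpace H M (lam - (n : ℂ) • delta H) := by
  ext (m : M.carrier)
  refine (mem_weightSpace H (M := M.twist n)).trans ((forall_congr' fun h => ?_).trans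
    (mem_weightSpace H (M := M)).symm)
  change M.ρ (cartanIncl H h) m + algebraMap ℂ A (n * h.2.2) • m =
    (algebraMap ℂ A (lam h) + tau H A h) • m ↔ M.ρ (cartanIncl H h) m =
    (algebraMap ℂ A (lam h - (n : ℂ) * h.2.2) + tau H A h) • m
  rw [← eq_sub_iff_add_eq, ← sub_smul, map_sub, add_sub_right_comm]

variable {A} in
theorem catO_twist (n : ℤ) (M : AffineMod 𝔤 A) (hM : catO H 𝔟 A M) :
    catO H 𝔟 A (M.twist n) := by
  obtain ⟨⟨h1, h2⟩, h3⟩ := hM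
  have e : weightSpace H (M.twist n) =
      fun lam => weightSpace H M (Equiv.subRight ((n : ℂ) • delta H) lam) :=
    funext fun lam => weightSpace_twist H n M lam
  refine ⟨⟨?_, ?_⟩, fun m => ?_⟩
  · rw [e]
    exact h1.comp (Equiv.injective _)
  · rw [e]
    exact ((Equiv.subRight ((n : ℂ) • delta H)).iSup_comp (g := weightSpace H M)).trans h2
  · obtain ⟨N, hm, hN, hs⟩ := h3 m
    exact ⟨N, hm, hN, fun x hx v hv => N.add_mem (hs x hx hv) (N.smul_mem _ hv)⟩

/-- The functor `Tⁿ` on `O_A`. -/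
def TO (n : ℤ) : (catO H 𝔟 A).FullSubcategory ⥤ (catO H 𝔟 A).FullSubcategory :=
  (catO H 𝔟 A).lift ((catO H 𝔟 A).ι ⋙ AffineMod.T n) fun M => catO_twist H 𝔟 n M.obj M.property

/-- The degree `n` part of the graded center of `(O_A, T)`: the natural transformations
`σ : id → Tⁿ` such that `Tᵐ(σ^M) : Tᵐ M → Tᵐ Tⁿ M = Tⁿ Tᵐ M` equals `σ^(Tᵐ M)` for all `M`, `m`. -/
def gradedCenter (n : ℤ) : Set (𝟭 (catO H 𝔟 A).FullSubcategory ⟶ TO H 𝔟 A n) :=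
  {σ | ∀ (M : (catO H 𝔟 A).FullSubcategory) (m : ℤ),
    (AffineMod.T m).map (σ.app M).hom ≫ AffineMod.twistComm m n M.obj =
      (σ.app ((TO H 𝔟 A m).obj M)).hom}

/-- The restricted category: the objects of `O_A` on which all elements of the graded center of
nonzero degree vanish. -/
def restrictedO : ObjectProperty (AffineMod 𝔤 A) :=
  fun M => ∃ h : catO H 𝔟 A M, ∀ n : ℤ, n ≠ 0 → ∀ σ ∈ gradedCenter H 𝔟 A n,
    (σ.app ⟨M, h⟩).hom.toLin = 0

/-- The restricted truncated category, the intersection of the restricted category with `O_A^J`. -/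
def restrictedTruncO (J : Set (Weight H)) : ObjectProperty (AffineMod 𝔤 A) :=
  restrictedO H 𝔟 A ⊓ truncO H 𝔟 A J

variable {A}

/-- The submodule `M'` generated by the images of all `T⁻ⁿ σ^M : T⁻ⁿ M → M`, `σ` an element of the
graded center of degree `n ≠ 0`. -/
def restrictionKer (M : AffineMod 𝔤 A) (hM : catO H 𝔟 A M) : Submodule A M.carrier :=
  ⨆ (n : {n : ℤ // n ≠ 0}) (σ : gradedCenter H 𝔟 A n),
    LinearMap.range ((AffineMod.T (-(n : ℤ))).map (σ.1.app ⟨M, hM⟩).hom ≫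
      AffineMod.twistCancel (n : ℤ) M).toLin

theorem isStable_restrictionKer (M : AffineMod 𝔤 A) (hM : catO H 𝔟 A M) :
    M.IsStable (restrictionKer H 𝔟 M hM) :=
  M.isStable_iSup _ fun _ => M.isStable_iSup _ fun _ => AffineMod.isStable_range _

/-- The restriction `M / M'` of an object `M` of `O_A`. -/
def restriction (M : AffineMod 𝔤 A) (hM : catO H 𝔟 A M) : AffineMod 𝔤 A :=
  M.quot (restrictionKer H 𝔟 M hM) (isStable_restrictionKer H 𝔟 M hM)

/-- The quotient map from `M` to its restriction. -/
def restrictionMk (M : AffineMod 𝔤 A) (hM : catO H 𝔟 A M) : M ⟶ restriction H 𝔟 M hM :=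
  M.quotMk (restrictionKer H 𝔟 M hM) (isStable_restrictionKer H 𝔟 M hM)

end CategoryO

/-! ## Verma modules and simple objects -/

section Simple

/-- The module `A ⊗ U(𝔤^)`, on which the affine algebra acts by left multiplication. -/
def regularMod (𝔤 : Type u) [LieRing 𝔤] [LieAlgebra ℂ 𝔤] (A : Type u) [CommRing A]
    [Algebra ℂ A] : AffineMod 𝔤 A where
  carrier := A ⊗[ℂ] UniversalEnvelopingAlgebra ℂ (Affine 𝔤)
  ρ :=
    { toFun := fun x => LinearMap.mulLeft A (1 ⊗ₜ[ℂ] UniversalEnvelopingAlgebra.ι ℂ x)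
      map_add' := fun x y => by ext; simp [TensorProduct.tmul_add, add_mul]
      map_smul' := fun c x => by
        ext v
        simp [TensorProduct.tmul_smul] }
  ρ_lie x y := by
    refine LinearMap.ext fun v => ?_
    change (1 ⊗ₜ[ℂ] UniversalEnvelopingAlgebra.ι ℂ ⁅x, y⁆ :
        A ⊗[ℂ] UniversalEnvelopingAlgebra ℂ (Affine 𝔤)) * v =
      1 ⊗ₜ[ℂ] UniversalEnvelopingAlgebra.ι ℂ x * (1 ⊗ₜ[ℂ] UniversalEnvelopingAlgebra.ι ℂ y * v) -
      1 ⊗ₜ[ℂ] UniversalEnvelopingAlgebra.ι ℂ y * (1 ⊗ₜ[ℂ] UniversalEnvelopingAlgebra.ι ℂ x * v)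
    let := LieRing.ofAssociativeRing (A := UniversalEnvelopingAlgebra ℂ (Affine 𝔤))
    rw [LieHom.map_lie, LieRing.of_associative_ring_bracket, TensorProduct.tmul_sub, sub_mul,
      ← mul_assoc, ← mul_assoc, Algebra.TensorProduct.tmul_mul_tmul,
      Algebra.TensorProduct.tmul_mul_tmul, one_mul]

variable {𝔤 : Type u} [LieRing 𝔤] [LieAlgebra ℂ 𝔤] (H 𝔟 : LieSubalgebra ℂ 𝔤)
  (A : Type u) [CommRing A] [Algebra ℂ A] [Algebra (SymmetricAlgebra ℂ H) A]

/-- The left ideal of `A ⊗ U(𝔤^)` generated by `[𝔟^, 𝔟^]` and by all `h - (lam(h) + τ(h))`, with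
`h` in the affine Cartan subalgebra. -/
def vermaIdeal (lam : Weight H) :
    Submodule (A ⊗[ℂ] UniversalEnvelopingAlgebra ℂ (Affine 𝔤))
      (A ⊗[ℂ] UniversalEnvelopingAlgebra ℂ (Affine 𝔤)) :=
  Submodule.span _
    ({v | ∃ x ∈ affineBorel 𝔟, ∃ y ∈ affineBorel 𝔟,
        v = 1 ⊗ₜ[ℂ] UniversalEnvelopingAlgebra.ι ℂ ⁅x, y⁆} ∪
      {v | ∃ h : AffineCartan H,
        v = 1 ⊗ₜ[ℂ] UniversalEnvelopingAlgebra.ι ℂ (cartanIncl H h) -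
          (algebraMap ℂ A (lam h) + tau H A h) ⊗ₜ[ℂ] 1})

/-- The deformed Verma module `U(𝔤^) ⊗_{U(𝔟^)} A_lam`: since `A_lam` is the quotient of
`A ⊗ U(𝔟^)` by the left ideal generated by `[𝔟^, 𝔟^]` and all `h - (lam(h) + τ(h))`, this is the
quotient of `A ⊗ U(𝔤^)` by the left ideal with the same generators. -/
def verma (lam : Weight H) : AffineMod 𝔤 A :=
  (regularMod 𝔤 A).quot ((vermaIdeal H 𝔟 A lam).restrictScalars A)
    fun _ _ hv => (vermaIdeal H 𝔟 A lam).smul_mem _ hv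

/-- The sum of all proper submodules. -/
def properSum {A : Type u} [CommRing A] [Algebra ℂ A] (M : AffineMod 𝔤 A) :
    Submodule A M.carrier :=
  ⨆ N : {N : Submodule A M.carrier // N ≠ ⊤ ∧ M.IsStable N}, N.1

/-- The unique simple quotient of the Verma module, i.e. the quotient by the sum of all proper
submodules, which is the largest proper submodule if `A` is a field. -/
def vermaTop (lam : Weight H) : AffineMod 𝔤 A :=
  (verma H 𝔟 A lam).quot (properSum (verma H 𝔟 A lam))
    ((verma H 𝔟 A lam).isStable_iSup _ fun N => N.2.2)

/-- Restriction of scalars along `A → A / 𝔪`. -/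
def resScalars {A : Type u} [CommRing A] [Algebra ℂ A] [IsLocalRing A]
    (M : AffineMod 𝔤 (IsLocalRing.ResidueField A)) : AffineMod 𝔤 A where
  carrier := M.carrier
  module := Module.compHom M.carrier (IsLocalRing.residue A)
  ρ :=
    letI : Module A M.carrier := Module.compHom M.carrier (IsLocalRing.residue A)
    { toFun := fun x =>
        { toFun := M.ρ x
          map_add' := map_add _
          map_smul' := fun a m => map_smul (M.ρ x) (IsLocalRing.residue A a) m }
      map_add' := fun x y => by
        refine LinearMap.ext fun m => ?_
        change M.ρ (x + y) m = M.ρ x m + M.ρ y m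
        rw [map_add]; rfl
      map_smul' := fun c x => by
        refine LinearMap.ext fun m => ?_
        change M.ρ (c • x) m = IsLocalRing.residue A (algebraMap ℂ A c) • M.ρ x m
        rw [map_smulₛₗ]
        rfl }
  ρ_lie x y := by
    let : Module A M.carrier := Module.compHom M.carrier (IsLocalRing.residue A)
    refine LinearMap.ext fun (m : M.carrier) => ?_
    change M.ρ ⁅x, y⁆ m = M.ρ x (M.ρ y m) - M.ρ y (M.ρ x m)
    rw [M.ρ_lie]
    rfl

/-- The simple object `L_A(lam)`: the simple quotient of the Verma module of highest weight `lam`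
over the residue field `A / 𝔪`, considered as a module over `A`. -/
def simpleObj [IsLocalRing A] (lam : Weight H) : AffineMod 𝔤 A :=
  resScalars (vermaTop H 𝔟 (IsLocalRing.ResidueField A) lam)

end Simple

/-! ## Projective covers -/

/-- `c : P ⟶ L` is a projective cover in the full subcategory `C`: both objects lie in `C`, `P` is
projective in `C`, `c` is surjective, and every `g : M ⟶ P` in `C` is surjective as soon as
`c ∘ g` is surjective. -/
structure IsProjectiveCover {𝔤 : Type u} [LieRing 𝔤] [LieAlgebra ℂ 𝔤] {A : Type u} [CommRing A]
    [Algebra ℂ A] (C : ObjectProperty (AffineMod 𝔤 A)) {P L : AffineMod 𝔤 A} (c : P ⟶ L) :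
    Prop where
  mem : C P
  mem_target : C L
  projective : Projective (⟨P, mem⟩ : C.FullSubcategory)
  surjective : Function.Surjective c.toLin
  essential : ∀ (M : AffineMod 𝔤 A), C M → ∀ g : M ⟶ P,
    Function.Surjective (g ≫ c).toLin → Function.Surjective g.toLin

end AffineO
end

/-! The restricted statements follow formally once projective covers exist in the truncated
category. Morphisms commute with every natural transformation `id → Tⁿ`, so each map from an object
to a restricted one factors uniquely through its restriction (`existsUnique_restriction_desc`).
Hence restriction carries a projective cover of a restricted object to a projective cover
(`isProjectiveCover_restriction`). That the simple object is itself restricted is a weight argument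
(`restrictedO_of_highestWeight`).

The substance is the existence of covers before restriction. For locally bounded `J`, an object of
the truncated category is just a module that is the sum of its weight spaces for weights in `J`
(`truncO_iff`). The functor of vectors of weight `lam` is represented by an object `Q`: induce
`A_lam` from the affine Cartan to the affine Borel subalgebra, discard the weights outside `J`, then
induce to the whole algebra (`exists_representing`). Weight vectors lift along surjections, so `Q`
is projective. It maps onto the simple object, and a suitable minimal projective has to be
extracted.

As `A` is local and Noetherian but not complete, idempotents do not lift along arbitrary quotients.
`exists_projectiveCover` therefore inducts on the number of weights of `J` above `lam`. If `lam` is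
maximal in `J`, then `Q_lam` is cyclic over `A` and locality of `A` makes `Q` a cover. Otherwise a
maximal weight `ν` of `J` above `lam` is removed. The smaller truncation has a cover `P'`, and `P'`
is a direct summand of the quotient of `Q` by the submodule generated by `Q_ν`.

The corresponding idempotent can be lifted to `Q` for the following reason. Maximality of `ν` makes
`Q_ν` a finite projective `A`-module all of whose `A`-linear endomorphisms extend to the submodule
it generates (`hasExtension_of_isMaxWeight`). Over a local ring every endomorphism of a finite free
module is a unit minus an idempotent (`exists_idempotent_isUnit`), and the inverse of that unit
corrects an arbitrary lift to an idempotent in a single step (`exists_idempotent_lift`). Splitting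
it gives an extension of `P'`. An extension `P → P'` for which the rank of `P_ν` is minimal is
essential, and its composite with `P' → L` is the cover.

All this rests on the triangular decomposition. Borel subalgebras are defined as maximal solvable
ones, so it has to be shown that the positive cone contains no nontrivial pair `a, -a`
(`salient_posCone`) and that every nonzero affine root is positive or negative
(`mem_posRoots_or_neg_mem`). Induced modules are realised directly on `X ⊗ U(𝔫)`, with no appeal to
the PBW theorem (`indAct_lie`). -/

noncomputable section
namespace AffineO

/-! ## Simultaneous eigenspaces -/

section EigenSpaces

variable {A M M' T W : Type*} [CommRing A] [AddCommGroup M] [Module A M] [AddCommGroup M']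
  [Module A M']

/-- The simultaneous eigenspace of a family of operators. -/
def eigSpace (a : T → Module.End A M) (χ : T → A) : Submodule A M :=
  ⨅ t, LinearMap.ker (a t - χ t • LinearMap.id)

theorem mem_eigSpace {a : T → Module.End A M} {χ : T → A} {m : M} :
    m ∈ eigSpace a χ ↔ ∀ t, a t m = χ t • m := by
  simp [eigSpace, sub_eq_zero]

/-- Any two characters of the family differ by a unit somewhere. -/
def Separated (χ : W → T → A) : Prop := ∀ w w', w ≠ w' → ∃ t, IsUnit (χ w t - χ w' t)

variable {a : T → Module.End A M} {a' : T → Module.End A M'} {χ : W → T → A}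

/-- The operator `a t - χ w₀ t` kills the `w₀`-component and multiplies every other component by a
difference of characters. If `t` makes that difference a unit for a given `w`, induction on the
number of components recovers the `w`-component itself. -/
theorem Separated.mem_of_sum_mem (hχ : Separated χ) (N : Submodule A M)
    (hN : ∀ t, ∀ n ∈ N, a t n ∈ N) (s : Finset W) (m : W → M)
    (hm : ∀ w ∈ s, m w ∈ eigSpace a (χ w)) (hs : ∑ w ∈ s, m w ∈ N) : ∀ w ∈ s, m w ∈ N := by
  classical
  induction s using Finset.induction_on generalizing m with
  | empty => simp
  | insert w₀ s hw₀ ih =>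
    have key : ∀ w ∈ s, m w ∈ N := by
      intro w hw
      obtain ⟨t, ht⟩ := hχ w w₀ (by rintro rfl; exact hw₀ hw)
      have h1 := ih (fun w => (χ w t - χ w₀ t) • m w)
        (fun w hw => Submodule.smul_mem _ _ (hm w (Finset.mem_insert_of_mem hw))) (by
          have h2 := N.sub_mem (hN t _ hs) (N.smul_mem (χ w₀ t) hs)
          rw [map_sum, Finset.smul_sum, ← Finset.sum_sub_distrib, Finset.sum_insert hw₀,
            mem_eigSpace.1 (hm w₀ (Finset.mem_insert_self _ _)) t, sub_self, zero_add] at h2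
          convert h2 using 1
          refine Finset.sum_congr rfl fun v hv => ?_
          rw [mem_eigSpace.1 (hm v (Finset.mem_insert_of_mem hv)) t, sub_smul]) w hw
      obtain ⟨v, hv⟩ := ht
      simpa [← hv, smul_smul] using N.smul_mem (↑v⁻¹ : A) h1
    intro w hw
    rcases Finset.mem_insert.1 hw with rfl | hw
    · rw [Finset.sum_insert hw₀] at hs
      exact (N.add_mem_iff_left (N.sum_mem key)).1 hs
    · exact key w hw

theorem Separated.eq_zero_of_sum_eq_zero (hχ : Separated χ) (s : Finset W) (m : W → M)
    (hm : ∀ w ∈ s, m w ∈ eigSpace a (χ w)) (hs : ∑ w ∈ s, m w = 0) : ∀ w ∈ s, m w = 0 := by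
  simpa using hχ.mem_of_sum_mem (a := a) ⊥ (by simp) s m hm (by simpa using hs)

theorem Separated.iSupIndep (hχ : Separated χ) : iSupIndep fun w => eigSpace a (χ w) := by
  classical
  exact (iSupIndep_iff_finsetSum_eq_zero_imp_eq_zero _).2 fun s v hv h i hi =>
    hχ.eq_zero_of_sum_eq_zero s v hv h i hi

theorem exists_sum_of_mem_iSup {S : Set W} {p : W → Submodule A M} {m : M}
    (hm : m ∈ ⨆ w ∈ S, p w) : ∃ (s : Finset W) (f : W → M), (∀ w ∈ s, w ∈ S) ∧
      (∀ w, f w ∈ p w) ∧ (∀ w ∉ s, f w = 0) ∧ ∑ w ∈ s, f w = m := by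
  classical
  induction hm using Submodule.iSup_induction' with
  | mem w x hx =>
    by_cases hw : w ∈ S
    · refine ⟨{w}, Pi.single w x, by simpa using hw, fun v => ?_, fun v hv => ?_, by simp⟩
      · by_cases h : v = w
        · subst h; simpa [hw] using hx
        · simp [h]
      · simp at hv; simp [hv]
    · simp [hw] at hx; exact ⟨∅, 0, by simp, by simp, by simp, by simp [hx]⟩
  | zero => exact ⟨∅, 0, by simp, by simp, by simp, by simp⟩
  | add x y _ _ hx hy =>
    obtain ⟨s, f, h1, h2, h3, h4⟩ := hx
    obtain ⟨t, g, k1, k2, k3, k4⟩ := hy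
    refine ⟨s ∪ t, f + g, fun w hw => ?_, fun w => add_mem (h2 w) (k2 w), fun w hw => ?_, ?_⟩
    · rcases Finset.mem_union.1 hw with h | h
      exacts [h1 w h, k1 w h]
    · simp only [Finset.mem_union, not_or] at hw
      simp [h3 w hw.1, k3 w hw.2]
    · simp only [Pi.add_apply, Finset.sum_add_distrib]
      rw [← h4, ← k4]
      congr 1
      · exact (Finset.sum_subset Finset.subset_union_left fun v _ hv => h3 v hv).symm
      · exact (Finset.sum_subset Finset.subset_union_right fun v _ hv => k3 v hv).symm

/-- A stable submodule contains the components of its elements. -/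
theorem Separated.exists_sum_of_mem (hχ : Separated χ) {S : Set W} (N : Submodule A M)
    (hN : ∀ t, ∀ n ∈ N, a t n ∈ N) {m : M} (hm : m ∈ N) (hS : m ∈ ⨆ w ∈ S, eigSpace a (χ w)) :
    m ∈ ⨆ w ∈ S, N ⊓ eigSpace a (χ w) := by
  obtain ⟨s, f, h1, h2, -, rfl⟩ := exists_sum_of_mem_iSup hS
  refine sum_mem fun w hw => ?_
  exact Submodule.mem_iSup_of_mem w (Submodule.mem_iSup_of_mem (h1 w hw)
    ⟨hχ.mem_of_sum_mem N hN s f (fun w _ => h2 w) hm w hw, h2 w⟩)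

theorem Separated.eq_zero_of_mem (hχ : Separated χ) {S : Set W} {w : W} (hw : w ∉ S) {m : M}
    (hm : m ∈ eigSpace a (χ w)) (hS : m ∈ ⨆ w ∈ S, eigSpace a (χ w)) : m = 0 :=
  Submodule.disjoint_def.1 (hχ.iSupIndep.disjoint_biSup hw) m hm hS

theorem Separated.disjoint (hχ : Separated χ) {S S' : Set W} (h : Disjoint S S') :
    Disjoint (⨆ w ∈ S, eigSpace a (χ w)) (⨆ w ∈ S', eigSpace a (χ w)) :=
  hχ.iSupIndep.disjoint_biSup_biSup h

theorem map_mem_eigSpace {f : M →ₗ[A] M'} {χ : T → A} (hf : ∀ t m, f (a t m) = a' t (f m)) {m : M}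
    (hm : m ∈ eigSpace a χ) : f m ∈ eigSpace a' χ :=
  mem_eigSpace.2 fun t => by rw [← hf, mem_eigSpace.1 hm, map_smul]

theorem iSup_eigSpace_eq_top_of_surjective {f : M →ₗ[A] M'} (hf : ∀ t m, f (a t m) = a' t (f m))
    (hsurj : Function.Surjective f) {S : Set W} (hS : ⨆ w ∈ S, eigSpace a (χ w) = ⊤) :
    ⨆ w ∈ S, eigSpace a' (χ w) = ⊤ := by
  rw [eq_top_iff, ← LinearMap.range_eq_top.2 hsurj, LinearMap.range_eq_map, ← hS]
  simp only [Submodule.map_iSup]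
  refine iSup₂_mono fun w _ => ?_
  rintro _ ⟨m, hm, rfl⟩
  exact map_mem_eigSpace hf hm

/-- The `w`-component of `m` is the required lift: since `f m` is an eigenvector for `w`, the images
of the other components vanish. -/
theorem Separated.exists_mem_of_map_mem (hχ : Separated χ) {f : M →ₗ[A] M'}
    (hf : ∀ t m, f (a t m) = a' t (f m)) {m : M} {S : Set W}
    (hm : m ∈ ⨆ w ∈ S, eigSpace a (χ w)) {w : W} (hw : f m ∈ eigSpace a' (χ w)) :
    ∃ n ∈ eigSpace a (χ w), f n = f m := by
  classical
  obtain ⟨s, g, h1, h2, h3, rfl⟩ := exists_sum_of_mem_iSup hm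
  have h0 : ∑ v ∈ insert w s, g v = ∑ v ∈ s, g v :=
    (Finset.sum_subset (Finset.subset_insert w s) fun v _ hv => h3 v hv).symm
  refine ⟨g w, h2 w, ?_⟩
  -- Subtracting `f m` from the term at `w` gives eigenvectors with sum zero. The index set is
  -- enlarged by `w` because `w` need not occur among the components.
  have := hχ.eq_zero_of_sum_eq_zero (a := a') (insert w s)
    (fun v => f (g v) - if v = w then f (∑ v ∈ s, g v) else 0) (fun v _ => ?_) ?_ w
    (Finset.mem_insert_self _ _)
  · simpa [sub_eq_zero] using this
  · refine sub_mem (map_mem_eigSpace hf (h2 v)) ?_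
    split_ifs with h
    · subst h; exact hw
    · exact zero_mem _
  · rw [Finset.sum_sub_distrib, ← map_sum, h0, Finset.sum_ite_eq' (insert w s) w]
    simp

theorem iSup_mem_eq_top_of_eigSpace {S : Set W}
    (h : ⨆ w, eigSpace a (χ w) = ⊤) (hS : ∀ w, eigSpace a (χ w) ≠ ⊥ → w ∈ S) :
    ⨆ w ∈ S, eigSpace a (χ w) = ⊤ := by
  rw [eq_top_iff, ← h]
  refine iSup_le fun w => ?_
  by_cases hw : eigSpace a (χ w) = ⊥
  · simp [hw]
  · exact le_iSup₂_of_le w (hS w hw) le_rfl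

end EigenSpaces

/-! ## Endomorphisms of free modules over local rings -/

section Clean

open IsLocalRing

/-- Fitting decomposition: `p` is the range and `q` the kernel of a high power of `Y`. So `Y` is
injective on `p`, and nilpotent on `q`, where consequently `Y + 1` is injective. -/
theorem exists_idempotent_isUnit_of_field {K V : Type*} [Field K] [AddCommGroup V] [Module K V]
    [FiniteDimensional K V] (Y : Module.End K V) :
    ∃ (p q : Submodule K V) (_ : Module.Basis (Fin (Module.finrank K p)) K p)
      (_ : Module.Basis (Fin (Module.finrank K q)) K q), IsCompl p q ∧ (∀ v ∈ p, Y v = 0 → v = 0) ∧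
      (∀ v ∈ q, Y v + v = 0 → v = 0) ∧ (∀ v ∈ p, Y v ∈ p) ∧ (∀ v ∈ q, Y v ∈ q) := by
  obtain ⟨n, h⟩ := Filter.eventually_atTop.1 (LinearMap.eventually_isCompl_ker_pow_range_pow Y)
  -- The exponent is taken positive, so that `Y v = 0` forces the power of `Y` to kill `v`.
  have hc := h (n + 1) (by omega)
  have hcomm : ∀ (k : ℕ) v, (Y ^ k) (Y v) = Y ((Y ^ k) v) := fun k v => by
    rw [← Module.End.mul_apply, ← Module.End.mul_apply, pow_mul_comm']
  refine ⟨_, _, Module.finBasis K _, Module.finBasis K _, hc.symm, ?_, ?_, ?_, ?_⟩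
  · intro v hv h0
    refine Submodule.disjoint_def.1 hc.disjoint v ?_ hv
    rw [LinearMap.mem_ker, pow_succ, Module.End.mul_apply, h0, map_zero]
  · intro v hv h0
    have h1 : Y v = -v := eq_neg_of_add_eq_zero_left h0
    have h2 : ∀ k : ℕ, (Y ^ k) v = (-1 : K) ^ k • v := by
      intro k
      induction k with
      | zero => simp
      | succ k ih => rw [pow_succ', Module.End.mul_apply, ih, map_smul, h1, pow_succ]; simp
    rw [LinearMap.mem_ker, h2] at hv
    exact (smul_eq_zero.1 hv).resolve_left (by simp)
  · rintro _ ⟨v, rfl⟩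
    exact ⟨Y v, hcomm _ _⟩
  · intro v hv
    rw [LinearMap.mem_ker] at hv ⊢
    rw [hcomm, hv, map_zero]

/-- Over the residue field, adding to `Y` the projection onto the nilpotent Fitting summand produces
an isomorphism. A basis adapted to the Fitting decomposition lifts to `W`, and being a unit can be
tested modulo the maximal ideal. -/
theorem exists_idempotent_isUnit {A W : Type*} [CommRing A] [IsLocalRing A] [AddCommGroup W]
    [Module A W] [Module.Finite A W] [Module.Free A W] (Y : Module.End A W) :
    ∃ π : Module.End A W, π * π = π ∧ IsUnit (Y + π) := by
  obtain ⟨p, q, bp, bq, hpq, hp, hq, hp', hq'⟩ := exists_idempotent_isUnit_of_field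
    (K := ResidueField A) (V := ResidueField A ⊗[A] W) (Y.baseChange (ResidueField A))
  let b : Module.Basis _ (ResidueField A) (ResidueField A ⊗[A] W) := (bp.prod bq).map (Submodule.prodEquivOfIsCompl p q hpq)
  have hsurj : Function.Surjective (TensorProduct.mk A (ResidueField A) W 1) :=
    TensorProduct.mk_surjective A W (ResidueField A) residue_surjective
  choose v hv using fun i => hsurj (b i)
  have hcomp : TensorProduct.mk A (ResidueField A) W 1 ∘ v = b := funext hv
  have : Module.FinitePresentation A W := Module.finitePresentation_of_projective A W
  obtain ⟨c, hc⟩ := Module.exists_basis_of_basis_baseChange v (by rw [hcomp]; exact b.linearIndependent)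
    (by rw [hcomp]; exact b.span_eq)
    (Module.Flat.rTensor_preserves_injective_linearMap _ Subtype.val_injective)
  -- Diagonal with entries `0` and `1` in the lifted basis, hence idempotent over `A` itself. The
  -- decomposition of the residue space is not claimed to lift to a `Y`-stable one.
  let π : Module.End A W := c.constr A fun i => Sum.elim (fun _ => 0) (fun _ => v i) i
  have hπl : ∀ i, π (v (Sum.inl i)) = 0 := fun i => by
    rw [← hc, c.constr_basis]; rfl
  have hπr : ∀ i, π (v (Sum.inr i)) = v (Sum.inr i) := fun i => by
    nth_rewrite 1 [← hc]; rw [c.constr_basis]; rfl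
  have hbl : ∀ i, b (Sum.inl i) = bp i := fun i => by simp [b]
  have hbr : ∀ i, b (Sum.inr i) = bq i := fun i => by simp [b]
  have hπ0 : ∀ x ∈ p, π.baseChange (ResidueField A) x = 0 := by
    intro x hx
    have : ∀ y : p, π.baseChange (ResidueField A) (y : ResidueField A ⊗[A] W) = 0 := fun y => by
      have : (π.baseChange (ResidueField A)) ∘ₗ p.subtype = 0 := bp.ext fun i => by
        rw [LinearMap.comp_apply, Submodule.subtype_apply, ← hbl, ← hv]
        simp [hπl]
      exact LinearMap.congr_fun this y
    exact this ⟨x, hx⟩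
  have hπ1 : ∀ x ∈ q, π.baseChange (ResidueField A) x = x := by
    intro x hx
    have : (π.baseChange (ResidueField A)) ∘ₗ q.subtype = q.subtype := bq.ext fun i => by
      rw [LinearMap.comp_apply, Submodule.subtype_apply, ← hbr, ← hv]
      simp [hπr]
    exact LinearMap.congr_fun this ⟨x, hx⟩
  refine ⟨π, ?_, ?_⟩
  · refine c.ext fun i => ?_
    rw [hc]
    rcases i with i | i
    · simp [hπl]
    · simp [hπr]
  · have hinj : Function.Injective ((Y + π).baseChange (ResidueField A)) := by
      rw [← LinearMap.ker_eq_bot, LinearMap.ker_eq_bot']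
      intro x hx
      obtain ⟨⟨y, z⟩, rfl⟩ := (Submodule.prodEquivOfIsCompl p q hpq).surjective x
      simp only [Submodule.coe_prodEquivOfIsCompl', LinearMap.baseChange_add,
        LinearMap.add_apply, map_add, hπ0 _ y.2, hπ1 _ z.2] at hx ⊢
      have h1 : Y.baseChange (ResidueField A) (y : ResidueField A ⊗[A] W) = -(Y.baseChange (ResidueField A) (z : ResidueField A ⊗[A] W) + z) := by
        rw [eq_neg_iff_add_eq_zero, ← hx]; abel
      have h2 := Submodule.disjoint_def.1 hpq.disjoint _ (hp' _ y.2)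
        (h1 ▸ q.neg_mem (q.add_mem (hq' _ z.2) z.2))
      rw [h2, zero_eq_neg] at h1
      rw [hp _ y.2 h2, hq _ z.2 h1, add_zero]
    -- Nakayama's lemma. Injectivity then follows, as a surjective endomorphism of a finite module
    -- is injective.
    have hsurj' : Function.Surjective (Y + π) := by
      rw [← LinearMap.range_eq_top, ← map_tensorProduct_mk_eq_top, eq_top_iff]
      rintro x -
      obtain ⟨y, rfl⟩ := (LinearMap.injective_iff_surjective.1 hinj) x
      obtain ⟨w, rfl⟩ := hsurj y
      exact ⟨(Y + π) w, ⟨w, rfl⟩, by simp [TensorProduct.tmul_add]⟩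
    exact (Module.End.isUnit_iff _).2
      ⟨OrzechProperty.injective_of_surjective_endomorphism _ hsurj', hsurj'⟩

end Clean
end AffineO
end

noncomputable section
namespace AffineO

/-! ## Induction of Lie algebra representations -/

section Enveloping

variable {𝔫 E : Type*} [LieRing 𝔫] [LieAlgebra ℂ 𝔫] [Ring E] [Algebra ℂ E]

/-- The extension of a Lie algebra representation to the universal enveloping algebra. -/
def envLift (f : 𝔫 →ₗ[ℂ] E) (hf : ∀ x y, f ⁅x, y⁆ = f x * f y - f y * f x) :
    UniversalEnvelopingAlgebra ℂ 𝔫 →ₐ[ℂ] E :=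
  letI := LieRing.ofAssociativeRing (A := E)
  UniversalEnvelopingAlgebra.lift ℂ { f with map_lie' := fun {x y} => hf x y }

/-- The canonical map to the universal enveloping algebra as a linear map. -/
def envι : 𝔫 →ₗ[ℂ] UniversalEnvelopingAlgebra ℂ 𝔫 :=
  letI := LieRing.ofAssociativeRing (A := UniversalEnvelopingAlgebra ℂ 𝔫)
  (UniversalEnvelopingAlgebra.ι ℂ : 𝔫 →ₗ⁅ℂ⁆ UniversalEnvelopingAlgebra ℂ 𝔫)

theorem envι_lie (x y : 𝔫) : envι ⁅x, y⁆ = envι x * envι y - envι y * envι x :=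
  letI := LieRing.ofAssociativeRing (A := UniversalEnvelopingAlgebra ℂ 𝔫)
  LieHom.map_lie (UniversalEnvelopingAlgebra.ι ℂ : 𝔫 →ₗ⁅ℂ⁆ UniversalEnvelopingAlgebra ℂ 𝔫) x y

@[simp] theorem envLift_ι (f : 𝔫 →ₗ[ℂ] E) (hf : ∀ x y, f ⁅x, y⁆ = f x * f y - f y * f x) (x : 𝔫) :
    envLift f hf (envι x) = f x :=
  letI := LieRing.ofAssociativeRing (A := E)
  UniversalEnvelopingAlgebra.lift_ι_apply ℂ
    ({ f with map_lie' := fun {x y} => hf x y } : 𝔫 →ₗ⁅ℂ⁆ E) x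

/-- The induction principle for `U(𝔫)`; through `ind_eq_top` it proves all identities on induced
modules from generators, so no basis of `U(𝔫)` is needed. -/
theorem env_eq_top (S : Submodule ℂ (UniversalEnvelopingAlgebra ℂ 𝔫)) (h1 : 1 ∈ S)
    (hS : ∀ x, ∀ u ∈ S, envι x * u ∈ S) : S = ⊤ := by
  rw [eq_top_iff]
  rintro u -
  suffices h : ∀ (t : TensorAlgebra ℂ 𝔫), ∀ s ∈ S, UniversalEnvelopingAlgebra.mkAlgHom ℂ 𝔫 t * s ∈ S by
    obtain ⟨t, rfl⟩ := RingCon.mkₐ_surjective (α := ℂ) _ u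
    have := h t 1 h1
    rwa [mul_one] at this
  intro t
  induction t using TensorAlgebra.induction with
  | algebraMap r => intro s hs; rw [AlgHom.commutes, ← Algebra.smul_def]; exact S.smul_mem r hs
  | ι x => exact fun s hs => hS x s hs
  | mul a b ha hb => intro s hs; rw [map_mul, mul_assoc]; exact ha _ (hb _ hs)
  | add a b ha hb => intro s hs; rw [map_add, add_mul]; exact S.add_mem (ha _ hs) (hb _ hs)

end Enveloping

/-! ### Induced modules realised on `X ⊗ U(𝔫)` -/

section Induction

variable {L 𝔫 A X : Type*} [LieRing L] [LieAlgebra ℂ L] [LieRing 𝔫] [LieAlgebra ℂ 𝔫]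
  [CommRing A] [Algebra ℂ A] [AddCommGroup X] [Module A X] [Module ℂ X] [IsScalarTower ℂ A X]

/-- Left multiplication on `X ⊗ U(𝔫)`. -/
def envMul : UniversalEnvelopingAlgebra ℂ 𝔫 →ₗ[ℂ]
    Module.End A (X ⊗[ℂ] UniversalEnvelopingAlgebra ℂ 𝔫) :=
  AlgebraTensorModule.lTensor A X ∘ₗ LinearMap.mul ℂ _

@[simp] theorem envMul_tmul (u v : UniversalEnvelopingAlgebra ℂ 𝔫) (ξ : X) :
    envMul (A := A) u (ξ ⊗ₜ v) = ξ ⊗ₜ (u * v) := rfl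

theorem envMul_mul (u v : UniversalEnvelopingAlgebra ℂ 𝔫) (z) :
    envMul (A := A) (X := X) (u * v) z = envMul (A := A) u (envMul (A := A) v z) := by
  induction z with
  | zero => simp
  | add a b ha hb => simp only [map_add, ha, hb]
  | tmul ξ w => simp [mul_assoc]

variable (ι : 𝔫 →ₗ⁅ℂ⁆ L)

variable (A X) in
/-- The natural action of `𝔫` on `Hom(L, X ⊗ U(𝔫))`. -/
def homAct : 𝔫 →ₗ[ℂ] Module.End A (L →ₗ[ℂ] X ⊗[ℂ] UniversalEnvelopingAlgebra ℂ 𝔫) where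
  toFun x :=
    { toFun := fun f => ((envMul (A := A) (envι x)).restrictScalars ℂ) ∘ₗ f -
        f ∘ₗ (LieAlgebra.ad ℂ L (ι x))
      map_add' := fun f g => by ext y; simp; abel
      map_smul' := fun c f => by ext y; simp [smul_sub] }
  map_add' x x' := by ext f y; simp; abel
  map_smul' c x := by ext f y; simp [smul_sub]

@[simp] theorem homAct_apply (x : 𝔫) (f : L →ₗ[ℂ] X ⊗[ℂ] UniversalEnvelopingAlgebra ℂ 𝔫) (y : L) :
    homAct A X ι x f y = envMul (A := A) (envι x) (f y) - f ⁅ι x, y⁆ := rfl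

theorem homAct_lie (x x' : 𝔫) : homAct A X ι ⁅x, x'⁆ =
    homAct A X ι x * homAct A X ι x' - homAct A X ι x' * homAct A X ι x := by
  ext f y
  simp only [homAct_apply, envι_lie, map_sub, LinearMap.sub_apply, Module.End.mul_apply,
    envMul_mul, LieHom.map_lie, lie_lie]
  abel

variable (A X) in
/-- The action of the enveloping algebra of `𝔫` on `Hom(L, X ⊗ U(𝔫))`. -/
def homActEnv : UniversalEnvelopingAlgebra ℂ 𝔫 →ₐ[ℂ]
    Module.End A (L →ₗ[ℂ] X ⊗[ℂ] UniversalEnvelopingAlgebra ℂ 𝔫) :=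
  envLift (E := Module.End A (L →ₗ[ℂ] X ⊗[ℂ] UniversalEnvelopingAlgebra ℂ 𝔫)) (homAct A X ι)
    (homAct_lie ι)

@[simp] theorem homActEnv_ι (x : 𝔫) : homActEnv A X ι (envι x) = homAct A X ι x :=
  envLift_ι _ _ x

variable (p : L →ₗ[ℂ] 𝔫) (σ : L →ₗ[ℂ] Module.End A X)

/-- The action of `L` on the generators `X` of the induced module. -/
def indBase : X →ₗ[A] (L →ₗ[ℂ] X ⊗[ℂ] UniversalEnvelopingAlgebra ℂ 𝔫) where
  toFun ξ :=
    { toFun := fun y => ξ ⊗ₜ envι (p y) + σ y ξ ⊗ₜ 1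
      map_add' := fun y y' => by
        simp only [map_add, TensorProduct.tmul_add, TensorProduct.add_tmul, LinearMap.add_apply]
        abel
      map_smul' := fun c y => by
        simp [TensorProduct.tmul_smul, TensorProduct.smul_tmul'] }
  map_add' ξ ξ' := by
    ext y
    simp only [map_add, TensorProduct.add_tmul, LinearMap.add_apply, LinearMap.coe_mk,
      AddHom.coe_mk]
    abel
  map_smul' c ξ := by ext y; simp [TensorProduct.smul_tmul']

/-- The action map of the induced module. -/
def indAct : X ⊗[ℂ] UniversalEnvelopingAlgebra ℂ 𝔫 →ₗ[A]
    (L →ₗ[ℂ] X ⊗[ℂ] UniversalEnvelopingAlgebra ℂ 𝔫) :=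
  AlgebraTensorModule.lift
    { toFun := fun ξ =>
        { toFun := fun u => homActEnv A X ι u (indBase p σ ξ)
          map_add' := fun u v => by simp
          map_smul' := fun c u => by simp }
      map_add' := fun ξ ξ' => by ext; simp
      map_smul' := fun c ξ => by ext; simp }

theorem indAct_one (ξ : X) (y : L) :
    indAct ι p σ (ξ ⊗ₜ 1) y = ξ ⊗ₜ envι (p y) + σ y ξ ⊗ₜ 1 := by
  simp [indAct, indBase]

/-- The recursion `y(xz) = x(yz) - [x, y]z` that any action extending left multiplication must
satisfy. It holds by construction: `z ↦ (y ↦ yz)` is the `𝔫`-equivariant map into `Hom(L, X ⊗ U(𝔫))`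
with the prescribed values on the generators. -/
theorem indAct_mul (x : 𝔫) (z : X ⊗[ℂ] UniversalEnvelopingAlgebra ℂ 𝔫) (y : L) :
    indAct ι p σ (envMul (A := A) (envι x) z) y =
      envMul (A := A) (envι x) (indAct ι p σ z y) - indAct ι p σ z ⁅ι x, y⁆ := by
  induction z with
  | zero => simp
  | add a b ha hb => simp only [map_add, LinearMap.add_apply, ha, hb]; abel
  | tmul ξ w => simp [indAct]

theorem ind_eq_top (S : Submodule A (X ⊗[ℂ] UniversalEnvelopingAlgebra ℂ 𝔫))
    (h1 : ∀ ξ : X, ξ ⊗ₜ 1 ∈ S) (hS : ∀ x, ∀ z ∈ S, envMul (A := A) (envι x) z ∈ S) : S = ⊤ := by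
  rw [eq_top_iff]
  rintro z -
  induction z with
  | zero => exact zero_mem _
  | add a b ha hb => exact add_mem ha hb
  | tmul ξ w =>
    have := env_eq_top (𝔫 := 𝔫)
      { carrier := {u | ξ ⊗ₜ u ∈ S}
        add_mem' := fun {a b} ha hb => by
          change ξ ⊗ₜ (a + b) ∈ S
          rw [TensorProduct.tmul_add]; exact add_mem ha hb
        zero_mem' := by
          change ξ ⊗ₜ[ℂ] (0 : UniversalEnvelopingAlgebra ℂ 𝔫) ∈ S
          simp
        smul_mem' := fun c a ha => by
          change ξ ⊗ₜ (c • a) ∈ S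
          rw [TensorProduct.tmul_smul]
          simpa using S.smul_mem (algebraMap ℂ A c) ha } (h1 ξ) (fun x u hu => hS x _ hu)
    exact this.ge (Submodule.mem_top (x := w))

/-- Both sides agree on generators, where `hσ` removes the second term of the action, and both obey
the same recursion under left multiplication by `𝔫`. -/
theorem indAct_ι (hp : ∀ x, p (ι x) = x) (hσ : ∀ x, σ (ι x) = 0) (x : 𝔫)
    (z : X ⊗[ℂ] UniversalEnvelopingAlgebra ℂ 𝔫) :
    indAct ι p σ z (ι x) = envMul (A := A) (envι x) z := by
  have := ind_eq_top (A := A) (X := X) (𝔫 := 𝔫)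
    { carrier := {z | ∀ x, indAct ι p σ z (ι x) = envMul (A := A) (envι x) z}
      add_mem' := fun {a b} ha hb x => by
        simp only [map_add, LinearMap.add_apply, ha x, hb x]
      zero_mem' := fun x => by simp
      smul_mem' := fun c a ha x => by simp [ha x] } (fun ξ x => by simp [indAct_one, hp, hσ])
      (fun x z hz x' => by
        rw [indAct_mul, hz, ← LieHom.map_lie, hz, envι_lie, map_sub, LinearMap.sub_apply,
          envMul_mul, envMul_mul, sub_sub_cancel])
  exact this.ge (Submodule.mem_top (x := z)) x

/-- If one argument lies in `𝔫`, the relation is the recursion `indAct_mul` rewritten. If both lie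
in the complementary subalgebra `ker p`, it holds on generators because `σ` represents that
subalgebra. Splitting `L` as `𝔫 ⊕ ker p` settles the generators, and the Jacobi identity propagates
the relation from `z` to `xz`. -/
theorem indAct_lie (hp : ∀ x, p (ι x) = x) (hσ : ∀ x, σ (ι x) = 0)
    (hpp : ∀ y y', p y = 0 → p y' = 0 → p ⁅y, y'⁆ = 0)
    (hσσ : ∀ y y', p y = 0 → p y' = 0 → σ ⁅y, y'⁆ = σ y * σ y' - σ y' * σ y) (y y' : L)
    (z : X ⊗[ℂ] UniversalEnvelopingAlgebra ℂ 𝔫) :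
    indAct ι p σ z ⁅y, y'⁆ =
      indAct ι p σ (indAct ι p σ z y') y - indAct ι p σ (indAct ι p σ z y) y' := by
  have hx : ∀ (x : 𝔫) (y : L) z, indAct ι p σ z ⁅ι x, y⁆ =
      indAct ι p σ (indAct ι p σ z y) (ι x) - indAct ι p σ (indAct ι p σ z (ι x)) y := by
    intro x y z
    rw [indAct_ι ι p σ hp hσ, indAct_ι ι p σ hp hσ, indAct_mul, sub_sub_cancel]
  have hmul := fun (x : 𝔫) (z : X ⊗[ℂ] UniversalEnvelopingAlgebra ℂ 𝔫) =>
    (indAct_ι ι p σ hp hσ x z).symm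
  have := ind_eq_top (A := A) (X := X) (𝔫 := 𝔫)
    { carrier := {z | ∀ y y', indAct ι p σ z ⁅y, y'⁆ =
        indAct ι p σ (indAct ι p σ z y') y - indAct ι p σ (indAct ι p σ z y) y'}
      add_mem' := fun {a b} ha hb y y' => by
        simp only [map_add, LinearMap.add_apply, ha y y', hb y y']; abel
      zero_mem' := fun x => by simp
      smul_mem' := fun c a ha y y' => by
        simp only [map_smul, LinearMap.smul_apply, ha y y', smul_sub] } ?_ ?_
  · exact this.ge (Submodule.mem_top (x := z)) y y'
  · intro ξ
    have hB : ∀ y y', p y = 0 → p y' = 0 → indAct ι p σ (ξ ⊗ₜ 1) ⁅y, y'⁆ =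
        indAct ι p σ (indAct ι p σ (ξ ⊗ₜ 1) y') y - indAct ι p σ (indAct ι p σ (ξ ⊗ₜ 1) y) y' := by
      intro y y' h h'
      simp only [indAct_one, h, h', hpp y y' h h', hσσ y y' h h', map_zero,
        TensorProduct.tmul_zero, zero_add, LinearMap.sub_apply, Module.End.mul_apply,
        TensorProduct.sub_tmul]
    intro y y'
    have hy : ∀ y, ∃ x b, p b = 0 ∧ y = ι x + b := fun y =>
      ⟨p y, y - ι (p y), by rw [map_sub, hp, sub_self], by abel⟩
    obtain ⟨x, b, hb, rfl⟩ := hy y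
    obtain ⟨x', b', hb', rfl⟩ := hy y'
    have h1 := hx x (ι x' + b') (ξ ⊗ₜ 1)
    have h2 := hx x' b (ξ ⊗ₜ 1)
    have h3 := hB b b' hb hb'
    have h4 : ⁅b, ι x'⁆ = -⁅ι x', b⁆ := (lie_skew _ _).symm
    rw [add_lie, map_add, h1, lie_add b, h4]
    simp only [map_add, map_neg, LinearMap.add_apply, h3, h2]
    abel
  · intro x z hz y y'
    have c : ∀ y z, indAct ι p σ (indAct ι p σ z (ι x)) y =
        indAct ι p σ (indAct ι p σ z y) (ι x) - indAct ι p σ z ⁅ι x, y⁆ := by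
      intro y z; rw [hx]; abel
    rw [hmul, c, c y' z, c y z, hz y y', leibniz_lie, map_add, hz ⁅ι x, y⁆, hz y, map_sub, map_sub,
      map_sub, LinearMap.sub_apply, LinearMap.sub_apply, LinearMap.sub_apply, c, c, hx x y,
      hx x y']
    abel

variable {M : Type*} [AddCommGroup M] [Module A M] [Module ℂ M] [IsScalarTower ℂ A M]

/-- The map from an induced module given by a map on generators. -/
def indLift (ρ : 𝔫 →ₗ[ℂ] Module.End A M) (hρ : ∀ x y, ρ ⁅x, y⁆ = ρ x * ρ y - ρ y * ρ x)
    (f : X →ₗ[A] M) : X ⊗[ℂ] UniversalEnvelopingAlgebra ℂ 𝔫 →ₗ[A] M :=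
  AlgebraTensorModule.lift
    { toFun := fun ξ =>
        { toFun := fun u => envLift ρ hρ u (f ξ)
          map_add' := fun u v => by simp
          map_smul' := fun c u => by simp }
      map_add' := fun ξ ξ' => by ext; simp
      map_smul' := fun c ξ => by ext; simp }

@[simp] theorem indLift_one (ρ : 𝔫 →ₗ[ℂ] Module.End A M) (hρ) (f : X →ₗ[A] M) (ξ : X) :
    indLift ρ hρ f (ξ ⊗ₜ 1) = f ξ := by simp [indLift]

theorem indLift_mul (ρ : 𝔫 →ₗ[ℂ] Module.End A M) (hρ) (f : X →ₗ[A] M) (x : 𝔫) (z) :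
    indLift ρ hρ f (envMul (A := A) (envι x) z) = ρ x (indLift ρ hρ f z) := by
  induction z with
  | zero => simp
  | add a b ha hb => simp only [map_add, ha, hb]
  | tmul ξ w => simp [indLift]

/-- Frobenius reciprocity: a map on the generators that respects `ker p` extends to one that
respects all of `L`. The extension is `𝔫`-linear by definition, and the rest follows from the
recursion for the action. -/
theorem indLift_indAct (hp : ∀ x, p (ι x) = x) (hσ : ∀ x, σ (ι x) = 0)
    (ρ : L →ₗ[ℂ] Module.End A M) (hρ : ∀ x y, ρ ⁅x, y⁆ = ρ x * ρ y - ρ y * ρ x)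
    (hρ' : ∀ x y, (ρ ∘ₗ (ι : 𝔫 →ₗ[ℂ] L)) ⁅x, y⁆ = (ρ ∘ₗ (ι : 𝔫 →ₗ[ℂ] L)) x *
      (ρ ∘ₗ (ι : 𝔫 →ₗ[ℂ] L)) y - (ρ ∘ₗ (ι : 𝔫 →ₗ[ℂ] L)) y * (ρ ∘ₗ (ι : 𝔫 →ₗ[ℂ] L)) x)
    (f : X →ₗ[A] M) (hf : ∀ y, p y = 0 → ∀ ξ, f (σ y ξ) = ρ y (f ξ)) (y : L) (z) :
    indLift (ρ ∘ₗ (ι : 𝔫 →ₗ[ℂ] L)) hρ' f (indAct ι p σ z y) =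
      ρ y (indLift (ρ ∘ₗ (ι : 𝔫 →ₗ[ℂ] L)) hρ' f z) := by
  set F := indLift (ρ ∘ₗ (ι : 𝔫 →ₗ[ℂ] L)) hρ' f with hF
  have := ind_eq_top (A := A) (X := X) (𝔫 := 𝔫)
    { carrier := {z | ∀ y, F (indAct ι p σ z y) = ρ y (F z)}
      add_mem' := fun {a b} ha hb y => by
        simp only [map_add, LinearMap.add_apply, ha y, hb y]
      zero_mem' := fun y => by simp
      smul_mem' := fun c a ha y => by
        simp only [map_smul, LinearMap.smul_apply, ha y] } ?_ ?_
  · exact this.ge (Submodule.mem_top (x := z)) y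
  · intro ξ y
    have h1 : y = ι (p y) + (y - ι (p y)) := by abel
    have h2 : p (y - ι (p y)) = 0 := by rw [map_sub, hp, sub_self]
    have h3 : σ y = σ (y - ι (p y)) := by rw [map_sub, hσ, sub_zero]
    have h4 : ξ ⊗ₜ envι (p y) = envMul (A := A) (envι (p y)) (ξ ⊗ₜ[ℂ] 1) := by simp
    rw [indAct_one, map_add, h4, hF, indLift_mul, indLift_one, indLift_one, h3, hf _ h2,
      LinearMap.comp_apply, ← LinearMap.add_apply, ← map_add]
    exact congrArg (fun y => ρ y (f ξ)) h1.symm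
  · intro x z hz y
    have h5 : ∀ w, F (envMul (A := A) (envι x) w) = ρ (ι x) (F w) := fun w =>
      indLift_mul (ρ ∘ₗ (ι : 𝔫 →ₗ[ℂ] L)) hρ' f x w
    rw [indAct_mul, map_sub, h5, h5, hz, hz, hρ]
    simp

end Induction
end AffineO
end

noncomputable section
namespace AffineO

/-! ## Borel subalgebras and their roots -/

section RootSpaces

variable {𝔤 : Type u} [LieRing 𝔤] [LieAlgebra ℂ 𝔤] (H : LieSubalgebra ℂ 𝔤)

/-- The simultaneous eigenspaces of `𝔥` on `𝔤`. -/
def rootSpace (α : Module.Dual ℂ H) : Submodule ℂ 𝔤 :=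
  eigSpace (fun h : H => (LieAlgebra.ad ℂ 𝔤 (h : 𝔤))) (fun h => α h)

variable {H} in
theorem mem_rootSpace {α : Module.Dual ℂ H} {x : 𝔤} :
    x ∈ rootSpace H α ↔ ∀ h : H, ⁅(h : 𝔤), x⁆ = α h • x := mem_eigSpace

theorem separated_dual {V : Type*} [AddCommGroup V] [Module ℂ V] :
    Separated (fun (α : Module.Dual ℂ V) (h : V) => α h) := by
  intro α β h
  by_contra! hc
  exact h (LinearMap.ext fun t => by simpa [sub_eq_zero] using hc t)

variable {H} in
theorem lie_mem_rootSpace {α β : Module.Dual ℂ H} {x y : 𝔤} (hx : x ∈ rootSpace H α)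
    (hy : y ∈ rootSpace H β) : ⁅x, y⁆ ∈ rootSpace H (α + β) := by
  rw [mem_rootSpace] at *
  intro h
  rw [leibniz_lie, hx, hy, smul_lie, lie_smul, LinearMap.add_apply, add_smul]

theorem mem_roots_iff {𝔰 : LieSubalgebra ℂ 𝔤} {α : Module.Dual ℂ H} :
    α ∈ roots H 𝔰 ↔ α ≠ 0 ∧ ∃ x ∈ 𝔰, x ≠ 0 ∧ x ∈ rootSpace H α := by
  simp only [roots, Set.mem_ofPred_eq, mem_rootSpace]

variable [FiniteDimensional ℂ 𝔤] [LieAlgebra.IsSimple ℂ 𝔤] [H.IsCartanSubalgebra]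

variable {H} in
theorem mem_rootSpace_iff {α : Module.Dual ℂ H} {x : 𝔤} :
    x ∈ rootSpace H α ↔ x ∈ LieAlgebra.rootSpace H (α : H → ℂ) := by
  constructor
  · intro h
    refine LieModule.weightSpace_le_genWeightSpace 𝔤 _ ?_
    rw [LieModule.mem_weightSpace]
    exact mem_rootSpace.1 h
  · intro h
    rw [mem_rootSpace]
    exact LieAlgebra.IsKilling.lie_eq_smul_of_mem_rootSpace h

theorem iSup_rootSpace : ⨆ α, rootSpace H α = ⊤ := by
  have h := LieModule.iSup_genWeightSpace_eq_top' ℂ H 𝔤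
  rw [← LieSubmodule.toSubmodule_inj, LieSubmodule.iSup_toSubmodule] at h
  rw [eq_top_iff, ← LieSubmodule.top_toSubmodule (R := ℂ) (L := H) (M := 𝔤), ← h]
  refine iSup_le fun χ => ?_
  refine le_trans ?_ (le_iSup _ χ.toLinear)
  intro x hx
  exact mem_rootSpace_iff.2 hx

theorem mem_rootSpace_zero {x : 𝔤} : x ∈ rootSpace H 0 ↔ x ∈ H := by
  rw [mem_rootSpace_iff]
  change x ∈ LieAlgebra.rootSpace H (0 : H → ℂ) ↔ _
  rw [LieAlgebra.rootSpace_zero_eq]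
  rfl

theorem exists_sl2 {α : Module.Dual ℂ H} (hα : α ≠ 0) (hα' : rootSpace H α ≠ ⊥) :
    ∃ (h : H) (e f : 𝔤), IsSl2Triple (h : 𝔤) e f ∧ e ∈ rootSpace H α ∧ f ∈ rootSpace H (-α) ∧
      (∀ x ∈ rootSpace H α, ∃ c : ℂ, c • e = x) ∧ (∀ x ∈ rootSpace H (-α), ∃ c : ℂ, c • f = x) ∧
      α h = 2 ∧ ∀ β : Module.Dual ℂ H, rootSpace H β ≠ ⊥ → ∃ n : ℤ, β h = n := by
  have mk : ∀ β : Module.Dual ℂ H, rootSpace H β ≠ ⊥ →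
      ∃ χ : LieModule.Weight ℂ H 𝔤, (χ : H → ℂ) = β := by
    intro β hβ
    refine ⟨⟨β, fun h => hβ ?_⟩, rfl⟩
    rw [eq_bot_iff]
    intro x hx
    rw [mem_rootSpace_iff, LieAlgebra.rootSpace, h] at hx
    exact hx
  obtain ⟨χ, hχ⟩ := mk α hα'
  have hχ0 : χ.IsNonZero := fun h => hα (LinearMap.ext fun t => by
    have : (χ : H → ℂ) = 0 := h
    rw [← hχ, this]; rfl)
  obtain ⟨h, e, f, ht, he, hf⟩ := LieAlgebra.IsKilling.exists_isSl2Triple_of_weight_isNonZero hχ0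
  have hh := ht.h_eq_coroot hχ0 he hf
  have he' : e ∈ rootSpace H α := mem_rootSpace_iff.2 (hχ ▸ he)
  have hf' : f ∈ rootSpace H (-α) := mem_rootSpace_iff.2 (by
    have : ((-α : Module.Dual ℂ H) : H → ℂ) = -(α : H → ℂ) := rfl
    rw [this, ← hχ]; exact hf)
  have one : ∀ (ψ : LieModule.Weight ℂ H 𝔤), ψ.IsNonZero → ∀ y ∈ LieAlgebra.rootSpace H ψ, y ≠ 0 →
      ∀ x ∈ LieAlgebra.rootSpace H ψ, ∃ c : ℂ, c • y = x := by
    intro ψ hψ y hy hy0 x hx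
    have h1 := LieAlgebra.IsKilling.finrank_rootSpace_eq_one ψ hψ
    obtain ⟨c, hc⟩ := (finrank_eq_one_iff_of_nonzero' (⟨y, hy⟩ : LieAlgebra.rootSpace H ψ)
      (fun h => hy0 (congrArg Subtype.val h))).1 h1 ⟨x, hx⟩
    exact ⟨c, congrArg Subtype.val hc⟩
  subst hh
  refine ⟨LieAlgebra.IsKilling.coroot χ, e, f, ht, he', hf', ?_, ?_, ?_, ?_⟩
  · intro x hx
    exact one χ hχ0 e he ht.e_ne_zero x (hχ ▸ mem_rootSpace_iff.1 hx)
  · intro x hx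
    refine one (-χ) hχ0.neg f hf ht.f_ne_zero x ?_
    have : ((-χ : LieModule.Weight ℂ H 𝔤) : H → ℂ) = ((-α : Module.Dual ℂ H) : H → ℂ) := by
      rw [LieModule.Weight.coe_neg, hχ]; rfl
    rw [this]
    exact mem_rootSpace_iff.1 hx
  · rw [← LieAlgebra.IsKilling.root_apply_coroot hχ0, hχ]
  · intro β hβ
    obtain ⟨ψ, hψ⟩ := mk β hβ
    exact ⟨_, by rw [← hψ]; exact LieAlgebra.IsKilling.apply_coroot_eq_cast χ ψ⟩

theorem finite_rootSpace_ne_bot : {α : Module.Dual ℂ H | rootSpace H α ≠ ⊥}.Finite :=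
  WellFoundedGT.finite_ne_bot_of_iSupIndep (separated_dual.iSupIndep)

theorem neg_mem_roots_top {α : Module.Dual ℂ H} (hα : α ∈ roots H (⊤ : LieSubalgebra ℂ 𝔤)) :
    -α ∈ roots H (⊤ : LieSubalgebra ℂ 𝔤) := by
  rw [mem_roots_iff] at hα ⊢
  obtain ⟨h0, x, -, hx, hxα⟩ := hα
  obtain ⟨h, e, f, ht, -, hf, -⟩ := exists_sl2 H h0 (fun h => hx (by simpa [h] using hxα))
  exact ⟨neg_ne_zero.2 h0, f, trivial, ht.f_ne_zero, hf⟩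

variable {𝔟 : LieSubalgebra ℂ 𝔤}

theorem rootSpace_le_of_mem_roots {α : Module.Dual ℂ H} (hα : α ∈ roots H 𝔟) :
    rootSpace H α ≤ 𝔟.toSubmodule := by
  rw [mem_roots_iff] at hα
  obtain ⟨h0, x, hxb, hx, hxα⟩ := hα
  obtain ⟨h, e, f, ht, he, hf, he', -⟩ := exists_sl2 H h0 (fun h => hx (by simpa [h] using hxα))
  intro y hy
  obtain ⟨c, rfl⟩ := he' x hxα
  obtain ⟨d, rfl⟩ := he' y hy
  have hc : c ≠ 0 := by rintro rfl; simp at hx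
  have := 𝔟.smul_mem (d * c⁻¹) hxb
  rwa [smul_smul, mul_assoc, inv_mul_cancel₀ hc, mul_one] at this

theorem rootSpace_ne_bot_of_mem_roots {α : Module.Dual ℂ H} (hα : α ∈ roots H 𝔟) :
    rootSpace H α ≠ ⊥ := by
  rw [mem_roots_iff] at hα
  obtain ⟨h0, x, hxb, hx, hxα⟩ := hα
  exact fun h => hx (by simpa [h] using hxα)

/-- Otherwise `𝔟` contains an `sl₂`-triple. Its members are, up to nonzero scalars, brackets of one
another, so they survive in every derived subalgebra, against solvability. -/
theorem neg_notMem_roots (h𝔟 : LieAlgebra.IsSolvable 𝔟) (hH : H ≤ 𝔟) {α : Module.Dual ℂ H}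
    (hα : α ∈ roots H 𝔟) : -α ∉ roots H 𝔟 := by
  intro hα'
  obtain ⟨h, e, f, ht, he, hf, -⟩ := exists_sl2 H (mem_roots_iff H |>.1 hα).1
    (rootSpace_ne_bot_of_mem_roots H hα)
  have heb := rootSpace_le_of_mem_roots H hα he
  have hfb := rootSpace_le_of_mem_roots H hα' hf
  have key : ∀ k, (⟨h, hH h.2⟩ : 𝔟) ∈ LieAlgebra.derivedSeries ℂ 𝔟 k ∧
      (⟨e, heb⟩ : 𝔟) ∈ LieAlgebra.derivedSeries ℂ 𝔟 k ∧
      (⟨f, hfb⟩ : 𝔟) ∈ LieAlgebra.derivedSeries ℂ 𝔟 k := by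
    intro k
    induction k with
    | zero => exact ⟨trivial, trivial, trivial⟩
    | succ k ih =>
      obtain ⟨i1, i2, i3⟩ := ih
      rw [LieAlgebra.derivedSeries_def] at i1 i2 i3 ⊢
      rw [LieAlgebra.derivedSeriesOfIdeal_succ]
      refine ⟨?_, ?_, ?_⟩
      · convert LieSubmodule.lie_mem_lie i2 i3 using 1
        exact Subtype.ext ht.lie_e_f.symm
      · have := SMulMemClass.smul_mem (2⁻¹ : ℂ) (LieSubmodule.lie_mem_lie i1 i2)
        convert this using 1
        refine Subtype.ext ?_
        change e = (2⁻¹ : ℂ) • ⁅(h : 𝔤), e⁆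
        rw [ht.lie_h_e_smul ℂ, smul_smul]; norm_num
      · have := SMulMemClass.smul_mem (-2⁻¹ : ℂ) (LieSubmodule.lie_mem_lie i1 i3)
        convert this using 1
        refine Subtype.ext ?_
        change f = (-2⁻¹ : ℂ) • ⁅(h : 𝔤), f⁆
        rw [ht.lie_lie_smul_f ℂ, smul_neg, smul_smul]; norm_num
  obtain ⟨k, hk⟩ := LieAlgebra.IsSolvable.solvable ℂ 𝔟
  have := (key k).2.1
  rw [hk, LieSubmodule.mem_bot] at this
  exact ht.e_ne_zero (congrArg Subtype.val this)

/-- An additive submonoid without nontrivial relations `a + b = 0`. -/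
def Salient {V : Type*} [AddCommGroup V] (C : AddSubmonoid V) : Prop :=
  ∀ a ∈ C, ∀ b ∈ C, a + b = 0 → a = 0

/-- A vanishing sum of roots of `𝔟` is shortened until nothing is left: for a member `α`, some other
member `β` is negative on the coroot of `α`, and then `α + β` is again a root of `𝔟` and can replace
the pair. -/
theorem salient_roots (h𝔟 : LieAlgebra.IsSolvable 𝔟) (hH : H ≤ 𝔟) :
    Salient (AddSubmonoid.closure (roots H 𝔟)) := by
  have main : ∀ (n : ℕ) (s : Multiset (Module.Dual ℂ H)), s.card = n → (∀ α ∈ s, α ∈ roots H 𝔟) →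
      s.sum = 0 → s = 0 := by
    intro n
    induction n using Nat.strong_induction_on with
    | _ n ih =>
      intro s hn hs hsum
      by_contra hne
      obtain ⟨α, hα⟩ := Multiset.exists_mem_of_ne_zero hne
      obtain ⟨t, rfl⟩ := Multiset.exists_cons_of_mem hα
      have hαr := hs α hα
      have hα0 := ((mem_roots_iff H).1 hαr).1
      obtain ⟨h, e, f, ht, he, hf, he', -, hh, hint⟩ := exists_sl2 H hα0
        (rootSpace_ne_bot_of_mem_roots H hαr)
      choose! c hc using fun β hβ => hint β (rootSpace_ne_bot_of_mem_roots H (𝔟 := 𝔟) hβ)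
      have hneg : ∃ β ∈ t, c β < 0 := by
        -- The whole sum vanishes on the coroot, where `α` takes the value `2`, so the remaining
        -- values add up to `-2`.
        by_contra! hcon
        have h1 : (t.map c).sum = -2 := by
          have h2 : ((t.map c).sum : ℂ) = t.sum h := by
            rw [← Module.Dual.eval_apply ℂ H h t.sum, map_multiset_sum, Int.cast_multiset_sum,
              Multiset.map_map]
            refine congrArg _ (Multiset.map_congr rfl fun β hβ => ?_)
            simp [hc β (hs β (Multiset.mem_cons_of_mem hβ))]
          have h3 : α h + t.sum h = 0 := by
            rw [← LinearMap.add_apply, ← Multiset.sum_cons, hsum]; rfl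
          rw [hh, ← h2] at h3
          have : (((t.map c).sum : ℤ) : ℂ) = ((-2 : ℤ) : ℂ) := by
            rw [eq_neg_of_add_eq_zero_right h3]; simp
          exact Int.cast_injective this
        have h4 : 0 ≤ (t.map c).sum := Multiset.sum_nonneg (by simpa using hcon)
        omega
      obtain ⟨β, hβt, hβ⟩ := hneg
      have hβr := hs β (Multiset.mem_cons_of_mem hβt)
      obtain ⟨t', rfl⟩ := Multiset.exists_cons_of_mem hβt
      have hne0 : α + β ≠ 0 := fun h => neg_notMem_roots H h𝔟 hH hαr
        (by rwa [← eq_neg_of_add_eq_zero_right h])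
      obtain ⟨-, x, hxb, hx0, hx⟩ := (mem_roots_iff H).1 hβr
      -- A vector killed by `e` would be primitive for the `sl₂`-triple, and its weight would be a
      -- natural number rather than the negative `c β`.
      have hex : ⁅e, x⁆ ≠ 0 := by
        intro h0
        have P : ht.HasPrimitiveVectorWith x (c β : ℂ) :=
          { ne_zero := hx0
            lie_h := by rw [mem_rootSpace.1 hx h, hc β hβr]
            lie_e := h0 }
        obtain ⟨n, hn⟩ := P.exists_nat
        have : c β = n := by exact_mod_cast hn
        omega
      have hsumr : α + β ∈ roots H 𝔟 := (mem_roots_iff H).2 ⟨hne0, _,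
        𝔟.lie_mem (rootSpace_le_of_mem_roots H hαr he) hxb, hex, lie_mem_rootSpace he hx⟩
      simp only [Multiset.card_cons] at hn
      have := ih (n - 1) (by omega) ((α + β) ::ₘ t') (by simp; omega) (by
        intro γ hγ
        rcases Multiset.mem_cons.1 hγ with rfl | hγ
        · exact hsumr
        · exact hs γ (by simp [hγ])) (by
        rw [← hsum]; simp [add_assoc])
      simp at this
  intro a ha b hb hab
  obtain ⟨s, hs, rfl⟩ := AddSubmonoid.exists_multiset_of_mem_closure ha
  obtain ⟨t, ht, rfl⟩ := AddSubmonoid.exists_multiset_of_mem_closure hb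
  have := main _ (s + t) rfl (by
    intro γ hγ
    rcases Multiset.mem_add.1 hγ with h | h
    exacts [hs γ h, ht γ h]) (by simpa using hab)
  simp [(add_eq_zero.1 this).1]

variable {H} in
theorem mem_iSup_rootSpace_of_mem (hH : H ≤ 𝔟) {x : 𝔤} (hx : x ∈ 𝔟) :
    x ∈ ⨆ α ∈ insert 0 (roots H 𝔟), rootSpace H α := by
  have h1 := separated_dual.exists_sum_of_mem (S := Set.univ) 𝔟.toSubmodule
    (a := fun h : H => (LieAlgebra.ad ℂ 𝔤 (h : 𝔤))) (fun h n hn => 𝔟.lie_mem (hH h.2) hn) hx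
    (by
      simp only [Set.mem_univ, iSup_pos]
      exact (iSup_rootSpace H).ge trivial)
  refine (iSup₂_le fun α _ => ?_ : _ ≤ ⨆ α ∈ insert 0 (roots H 𝔟), rootSpace H α) h1
  rintro y ⟨hy, hyα⟩
  by_cases hy0 : y = 0
  · rw [hy0]; exact zero_mem _
  by_cases hα : α = 0
  · subst hα
    exact Submodule.mem_iSup_of_mem _ (Submodule.mem_iSup_of_mem (Set.mem_insert _ _) hyα)
  · exact Submodule.mem_iSup_of_mem _ (Submodule.mem_iSup_of_mem
      (Set.mem_insert_of_mem _ ((mem_roots_iff H).2 ⟨hα, y, hy, hy0, hyα⟩)) hyα)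

/-- Bracket of two sums of root spaces. -/
theorem lie_mem_iSup_rootSpace {S S' S'' : Set (Module.Dual ℂ H)}
    (h : ∀ α ∈ S, ∀ β ∈ S', ∀ x ∈ rootSpace H α, ∀ y ∈ rootSpace H β,
      ⁅x, y⁆ ∈ ⨆ γ ∈ S'', rootSpace H γ) {x y : 𝔤} (hx : x ∈ ⨆ α ∈ S, rootSpace H α)
    (hy : y ∈ ⨆ α ∈ S', rootSpace H α) : ⁅x, y⁆ ∈ ⨆ γ ∈ S'', rootSpace H γ := by
  have h1 : (⨆ α ∈ S, rootSpace H α) ≤ Submodule.comap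
      ((LieAlgebra.ad ℂ 𝔤 : 𝔤 →ₗ[ℂ] Module.End ℂ 𝔤).flip y) (⨆ γ ∈ S'', rootSpace H γ) := by
    refine iSup₂_le fun α hα x hx => ?_
    have h2 : (⨆ α ∈ S', rootSpace H α) ≤
        (⨆ γ ∈ S'', rootSpace H γ).comap (LieAlgebra.ad ℂ 𝔤 x) :=
      iSup₂_le fun β hβ y hy => h α hα β hβ x hx y hy
    exact h2 hy
  exact h1 hx

/-- The subalgebra whose weights lie in a given monoid. -/
def coneSubalgebra (C : AddSubmonoid (Module.Dual ℂ H)) : LieSubalgebra ℂ 𝔤 where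
  __ := (⨆ α ∈ (C : Set (Module.Dual ℂ H)), rootSpace H α : Submodule ℂ 𝔤)
  lie_mem' := fun {x y} hx hy => lie_mem_iSup_rootSpace H (fun α hα β hβ x hx y hy =>
    Submodule.mem_iSup_of_mem (α + β) (Submodule.mem_iSup_of_mem (C.add_mem hα hβ)
      (lie_mem_rootSpace hx hy))) hx hy

theorem mem_coneSubalgebra {C : AddSubmonoid (Module.Dual ℂ H)} {x : 𝔤} :
    x ∈ coneSubalgebra H C ↔ x ∈ ⨆ α ∈ (C : Set (Module.Dual ℂ H)), rootSpace H α := Iff.rfl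

/-- For a root `β`, let `r β` count the roots `γ` in `C` with `β - γ` in `C`. Since `C` is salient,
adding a nonzero element of `C` strictly raises `r`, as long as the sum is still a weight. So the
derived series moves into root spaces of ever larger `r`, while `r` is bounded by the number of
weights in `C`. -/
theorem isSolvable_coneSubalgebra {C : AddSubmonoid (Module.Dual ℂ H)} (hC : Salient C) :
    LieAlgebra.IsSolvable (coneSubalgebra H C) := by
  classical
  let S : Finset (Module.Dual ℂ H) := (finite_rootSpace_ne_bot H).toFinset.filter (· ∈ C)
  let r : Module.Dual ℂ H → ℕ := fun β => (S.filter fun γ => β - γ ∈ C).card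
  let V : ℕ → Submodule ℂ 𝔤 := fun k => ⨆ α ∈ {α | α ∈ C ∧ α ≠ 0 ∧ k ≤ r α}, rootSpace H α
  have hadd : ∀ α ∈ C, ∀ β ∈ C, α ≠ 0 → α + β ≠ 0 := fun α hα β hβ h0 h => h0 (hC α hα β hβ h)
  have hzero : ∀ α β, ∀ x ∈ rootSpace H α, ∀ y ∈ rootSpace H β, rootSpace H (α + β) = ⊥ →
      ⁅x, y⁆ = 0 := fun α β x hx y hy h => by simpa [h] using lie_mem_rootSpace hx hy
  have hr : ∀ α ∈ C, ∀ β ∈ C, β ≠ 0 → rootSpace H (α + β) ≠ ⊥ → r α + 1 ≤ r (α + β) := by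
    intro α hα β hβ hβ0 hne
    refine Finset.card_lt_card (Finset.ssubset_iff.2 ⟨α + β, ?_, ?_⟩)
    · intro h
      have := (Finset.mem_filter.1 h).2
      rw [sub_add_cancel_left] at this
      exact hβ0 (hC β hβ _ this (by simp))
    · intro γ hγ
      rcases Finset.mem_insert.1 hγ with rfl | hγ
      · simp [S, hne, C.add_mem hα hβ]
      · rw [Finset.mem_filter] at hγ ⊢
        refine ⟨hγ.1, ?_⟩
        rw [add_sub_right_comm]
        exact C.add_mem hγ.2 hβ
  have key : ∀ k, ∀ x ∈ LieAlgebra.derivedSeries ℂ (coneSubalgebra H C) (k + 1),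
      (x : 𝔤) ∈ V k := by
    intro k
    induction k with
    | zero =>
      intro x hx
      rw [LieAlgebra.derivedSeries_def, LieAlgebra.derivedSeriesOfIdeal_succ,
        ← LieSubmodule.mem_toSubmodule, LieSubmodule.lieIdeal_oper_eq_linear_span'] at hx
      induction hx using Submodule.span_induction with
      | zero => exact zero_mem _
      | add a b _ _ ha hb => exact add_mem ha hb
      | smul c a _ ha => exact Submodule.smul_mem _ c ha
      | mem z hz =>
        obtain ⟨a, -, b, -, rfl⟩ := hz
        refine lie_mem_iSup_rootSpace H ?_ a.2 b.2
        intro α hα β hβ x hx y hy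
        by_cases h0 : α + β = 0
        · have h1 := hC α hα β hβ h0
          have h2 : β = 0 := by simpa [h1] using h0
          subst h1 h2
          have : ⁅x, y⁆ = 0 := by
            have := mem_rootSpace.1 hy ⟨x, (mem_rootSpace_zero H).1 hx⟩
            simpa using this
          rw [this]; exact zero_mem _
        · exact Submodule.mem_iSup_of_mem (α + β) (Submodule.mem_iSup_of_mem
            ⟨C.add_mem hα hβ, h0, Nat.zero_le _⟩ (lie_mem_rootSpace hx hy))
    | succ k ih =>
      intro x hx
      rw [LieAlgebra.derivedSeries_def, LieAlgebra.derivedSeriesOfIdeal_succ,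
        ← LieSubmodule.mem_toSubmodule, LieSubmodule.lieIdeal_oper_eq_linear_span'] at hx
      induction hx using Submodule.span_induction with
      | zero => exact zero_mem _
      | add a b _ _ ha hb => exact add_mem ha hb
      | smul c a _ ha => exact Submodule.smul_mem _ c ha
      | mem z hz =>
        obtain ⟨a, ha, b, hb, rfl⟩ := hz
        refine lie_mem_iSup_rootSpace H ?_ (ih a ha) (ih b hb)
        intro α hα β hβ x hx y hy
        by_cases hbot : rootSpace H (α + β) = ⊥
        · rw [hzero α β x hx y hy hbot]; exact zero_mem _
        · exact Submodule.mem_iSup_of_mem (α + β) (Submodule.mem_iSup_of_mem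
            ⟨C.add_mem hα.1 hβ.1, hadd α hα.1 β hβ.1 hα.2.1,
              (Nat.succ_le_succ hα.2.2).trans (hr α hα.1 β hβ.1 hβ.2.1 hbot)⟩
            (lie_mem_rootSpace hx hy))
  rw [LieAlgebra.isSolvable_iff ℂ]
  refine ⟨S.card + 1 + 1, ?_⟩
  rw [eq_bot_iff]
  intro x hx
  have h1 := key _ x hx
  have h2 : V (S.card + 1) = ⊥ := by
    rw [eq_bot_iff]
    refine iSup₂_le fun α hα => ?_
    have := hα.2.2.trans (Finset.card_filter_le _ _)
    omega
  rw [h2, Submodule.mem_bot] at h1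
  exact (LieSubmodule.mem_bot _).2 (Subtype.ext h1)

/-- The subalgebra attached to the cone of `Φ` is solvable and contains `𝔟`; by maximality it equals
`𝔟`. -/
theorem mem_roots_of_salient (h𝔟 : IsBorel 𝔟) (hH : H ≤ 𝔟) {Φ : Set (Module.Dual ℂ H)}
    (hΦ : roots H 𝔟 ⊆ Φ) (hs : Salient (AddSubmonoid.closure Φ)) {α : Module.Dual ℂ H}
    (hα : α ∈ Φ) (hα' : α ∈ roots H (⊤ : LieSubalgebra ℂ 𝔤)) : α ∈ roots H 𝔟 := by
  have hle : 𝔟 ≤ coneSubalgebra H (AddSubmonoid.closure Φ) := by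
    intro x hx
    rw [mem_coneSubalgebra]
    have hsub : (⨆ α ∈ insert 0 (roots H 𝔟), rootSpace H α) ≤
        ⨆ α ∈ (AddSubmonoid.closure Φ : Set (Module.Dual ℂ H)), rootSpace H α :=
      biSup_mono fun β hβ => by
        rcases hβ with rfl | hβ
        · exact zero_mem _
        · exact AddSubmonoid.subset_closure (hΦ hβ)
    exact hsub (mem_iSup_rootSpace_of_mem hH hx)
  have hge := h𝔟.2 (isSolvable_coneSubalgebra H hs) hle
  rw [mem_roots_iff] at hα' ⊢
  obtain ⟨h0, x, -, hx, hxα⟩ := hα'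
  exact ⟨h0, x, hge (Submodule.mem_iSup_of_mem α (Submodule.mem_iSup_of_mem
    (AddSubmonoid.subset_closure hα) hxα)), hx, hxα⟩

/-- If neither `α` nor `-α` could be added while keeping the cone salient, there would be relations
`c + mα = 0` and `d - nα = 0` with `c, d` in the cone and `m, n > 0`. Then `nc + md = 0`, so `nc =
0` by salience and `α = 0`. -/
theorem mem_roots_or_neg_mem (h𝔟 : IsBorel 𝔟) (hH : H ≤ 𝔟) {α : Module.Dual ℂ H}
    (hα : α ∈ roots H (⊤ : LieSubalgebra ℂ 𝔤)) : α ∈ roots H 𝔟 ∨ -α ∈ roots H 𝔟 := by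
  have hsal := salient_roots H h𝔟.1 hH
  have h0 := ((mem_roots_iff H).1 hα).1
  by_contra! hcon
  have aux : ∀ β ∈ roots H (⊤ : LieSubalgebra ℂ 𝔤), β ∉ roots H 𝔟 →
      ∃ c ∈ AddSubmonoid.closure (roots H 𝔟), ∃ m : ℕ, 0 < m ∧ c + m • β = 0 := by
    intro β hβ hβ'
    by_contra! hno
    refine hβ' (mem_roots_of_salient H h𝔟 hH (Set.subset_insert β _) ?_ (Set.mem_insert _ _) hβ)
    have dec : ∀ a ∈ AddSubmonoid.closure (insert β (roots H 𝔟)),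
        ∃ c ∈ AddSubmonoid.closure (roots H 𝔟), ∃ m : ℕ, a = c + m • β := by
      intro a ha
      rw [Set.insert_eq, AddSubmonoid.closure_union, AddSubmonoid.mem_sup] at ha
      obtain ⟨y, hy, z, hz, rfl⟩ := ha
      obtain ⟨m, rfl⟩ := AddSubmonoid.mem_closure_singleton.1 hy
      exact ⟨z, hz, m, add_comm _ _⟩
    intro a ha b hb hab
    obtain ⟨c, hc, m, rfl⟩ := dec a ha
    obtain ⟨d, hd, n, rfl⟩ := dec b hb
    rcases Nat.eq_zero_or_pos (m + n) with h | h
    · obtain ⟨rfl, rfl⟩ : m = 0 ∧ n = 0 := by omega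
      simp only [zero_smul, add_zero] at hab ⊢
      exact hsal c hc d hd hab
    · refine absurd ?_ (hno (c + d) (add_mem hc hd) (m + n) h)
      rw [← hab, add_smul]; abel
  obtain ⟨c, hc, m, hm, h1⟩ := aux α hα hcon.1
  obtain ⟨d, hd, n, hn, h2⟩ := aux (-α) (neg_mem_roots_top H hα) hcon.2
  have h3 : n • c + m • d = 0 := by
    have e1 : c = -(m • α) := eq_neg_of_add_eq_zero_left h1
    have e2 : d = n • α := by rw [smul_neg] at h2; exact (sub_eq_zero.1 (by rwa [sub_eq_add_neg]))
    rw [e1, e2, smul_neg, smul_smul, smul_smul, mul_comm, neg_add_cancel]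
  have h4 := hsal _ (nsmul_mem hc n) _ (nsmul_mem hd m) h3
  rw [smul_eq_zero] at h4
  rcases h4 with h4 | h4
  · omega
  · rw [h4, zero_add, smul_eq_zero] at h1
    rcases h1 with h1 | h1
    · omega
    · exact h0 h1

end RootSpaces
end AffineO
end

noncomputable section
namespace AffineO

/-! ## Root spaces of the affine algebra -/

section AffineRoots

variable {𝔤 : Type u} [LieRing 𝔤] [LieAlgebra ℂ 𝔤] (H : LieSubalgebra ℂ 𝔤)

/-- The simultaneous eigenspaces of the affine Cartan subalgebra on the affine algebra. -/
def affRootSpace (β : Weight H) : Submodule ℂ (Affine 𝔤) :=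
  eigSpace (fun h : AffineCartan H => LieAlgebra.ad ℂ (Affine 𝔤) (cartanIncl H h)) (fun h => β h)

variable {H} in
theorem mem_affRootSpace {β : Weight H} {x : Affine 𝔤} :
    x ∈ affRootSpace H β ↔ ∀ h, ⁅cartanIncl H h, x⁆ = β h • x := mem_eigSpace

variable {H} in
theorem lie_mem_affRootSpace {β γ : Weight H} {x y : Affine 𝔤} (hx : x ∈ affRootSpace H β)
    (hy : y ∈ affRootSpace H γ) : ⁅x, y⁆ ∈ affRootSpace H (β + γ) := by
  rw [mem_affRootSpace] at *
  intro h
  rw [leibniz_lie, hx, hy, smul_lie, lie_smul, LinearMap.add_apply, add_smul]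

theorem cartanIncl_lie_loop (h : AffineCartan H) (x : Affine 𝔤) (k : ℤ) :
    ⁅cartanIncl H h, x⁆.loop k = ⁅(h.1 : 𝔤), x.loop k⁆ + (h.2.2 * k) • x.loop k := by
  have h1 : loopBracket 𝔤 (Finsupp.single 0 (h.1 : 𝔤)) x.loop k = ⁅(h.1 : 𝔤), x.loop k⁆ := by
    induction x.loop using Finsupp.induction_linear with
    | zero => simp
    | add f g hf hg => simp [hf, hg]
    | single n y =>
      rw [loopBracket_single, zero_add, Finsupp.single_apply, Finsupp.single_apply]
      split_ifs <;> simp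
  simp [cartanIncl, h1, loopD_apply, mul_smul]

theorem cartanIncl_lie_cK (h : AffineCartan H) (x : Affine 𝔤) :
    ⁅cartanIncl H h, x⁆.cK = 0 := by
  rw [Affine.lie_cK]
  change loopCocycle 𝔤 (Finsupp.single 0 (h.1 : 𝔤)) x.loop = 0
  induction x.loop using Finsupp.induction_linear with
  | zero => simp
  | add f g hf hg => simp [hf, hg]
  | single n y => rw [loopCocycle_single]; simp

theorem mem_affRootSpace_iff {β : Weight H} {x : Affine 𝔤} :
    x ∈ affRootSpace H β ↔ (∀ (h : AffineCartan H) k,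
      ⁅(h.1 : 𝔤), x.loop k⁆ + (h.2.2 * k) • x.loop k = β h • x.loop k) ∧
      ∀ h, β h * x.cK = 0 ∧ β h * x.cD = 0 := by
  rw [mem_affRootSpace]
  constructor
  · intro h
    refine ⟨fun t k => ?_, fun t => ⟨?_, ?_⟩⟩
    · rw [← cartanIncl_lie_loop, h]; rfl
    · rw [← Affine.smul_cK, ← h, cartanIncl_lie_cK]
    · rw [← Affine.smul_cD, ← h, Affine.lie_cD]
  · rintro ⟨h1, h2⟩ t
    refine Affine.ext (Finsupp.ext fun k => ?_) ?_ ?_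
    · rw [cartanIncl_lie_loop, h1]; rfl
    · rw [cartanIncl_lie_cK, Affine.smul_cK, (h2 t).1]
    · rw [Affine.lie_cD, Affine.smul_cD, (h2 t).2]

/-- The element `y ⊗ tᵏ`. -/
def loopElem (k : ℤ) : 𝔤 →ₗ[ℂ] Affine 𝔤 where
  toFun y := ⟨Finsupp.single k y, 0, 0⟩
  map_add' _ _ := by ext1 <;> simp
  map_smul' _ _ := by ext1 <;> simp

theorem loopElem_mem {α : Module.Dual ℂ H} {y : 𝔤} (hy : y ∈ rootSpace H α) (k : ℤ) :
    loopElem k y ∈ affRootSpace H (extendForm H α + (k : ℂ) • delta H) := by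
  rw [mem_affRootSpace_iff]
  refine ⟨fun h j => ?_, fun h => by simp [loopElem]⟩
  by_cases hj : k = j
  · subst hj
    simp only [loopElem, LinearMap.coe_mk, AddHom.coe_mk, Finsupp.single_eq_same]
    rw [mem_rootSpace.1 hy, ← add_smul]
    simp [extendForm, delta, mul_comm]
  · simp [loopElem, Finsupp.single_eq_of_ne (Ne.symm hj)]

theorem eq_sum_loopElem (x : Affine 𝔤) :
    x = ∑ k ∈ x.loop.support, loopElem k (x.loop k) + cartanIncl H (0, x.cK, x.cD) := by
  have hs : ∀ s : Finset ℤ, ∑ k ∈ s, loopElem k (x.loop k) =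
      (⟨∑ k ∈ s, Finsupp.single k (x.loop k), 0, 0⟩ : Affine 𝔤) := by
    classical
    intro s
    induction s using Finset.induction_on with
    | empty => rfl
    | insert a s ha ih =>
      rw [Finset.sum_insert ha, Finset.sum_insert ha, ih]
      ext1 <;> simp [loopElem]
  rw [hs]
  ext1
  · rw [Affine.add_loop]
    have := x.loop.sum_single
    rw [Finsupp.sum] at this
    simp [cartanIncl, this]
  · simp [cartanIncl]
  · simp [cartanIncl]

/-- The weight of `D` on the root space `β`, if it is an integer, determines the only power of `t`
that occurs. -/
theorem loop_eq_zero {β : Weight H} {x : Affine 𝔤} (hx : x ∈ affRootSpace H β) {k : ℤ}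
    (hk : β (0, 0, 1) ≠ k) : x.loop k = 0 := by
  have h := ((mem_affRootSpace_iff H).1 hx).1 (0, 0, 1) k
  rw [← sub_eq_zero] at h
  simp only [ZeroMemClass.coe_zero, zero_lie, zero_add, one_mul, ← sub_smul] at h
  exact (smul_eq_zero.1 h).resolve_left (sub_ne_zero.2 hk.symm)

theorem loop_mem_rootSpace {β : Weight H} {x : Affine 𝔤} (hx : x ∈ affRootSpace H β) (k : ℤ) :
    x.loop k ∈ rootSpace H (β ∘ₗ LinearMap.inl ℂ H (ℂ × ℂ)) := by
  rw [mem_rootSpace]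
  intro h
  have h := ((mem_affRootSpace_iff H).1 hx).1 (h, 0) k
  simpa using h

/-- The value `β(D)` singles out at most one power of `t`, so an element is determined by one
coefficient in `𝔤` and its components along `K` and `D`. -/
theorem finite_affRootSpace [FiniteDimensional ℂ 𝔤] (β : Weight H) :
    FiniteDimensional ℂ (affRootSpace H β) := by
  classical
  obtain ⟨k, hk⟩ : ∃ k : ℤ, ∀ j : ℤ, j ≠ k → β (0, 0, 1) ≠ j := by
    by_cases h : ∃ k : ℤ, β (0, 0, 1) = k
    · obtain ⟨k, hk⟩ := h
      exact ⟨k, fun j hj e => hj (by exact_mod_cast e.symm.trans hk)⟩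
    -- A default value: when `β(D)` is not an integer, every loop coefficient vanishes.
    · exact ⟨0, fun j _ e => h ⟨j, e⟩⟩
  let f : affRootSpace H β →ₗ[ℂ] 𝔤 × ℂ × ℂ :=
    { toFun := fun x => (x.1.loop k, x.1.cK, x.1.cD)
      map_add' := fun _ _ => rfl
      map_smul' := fun _ _ => rfl }
  refine Module.Finite.of_injective f fun x y hxy => ?_
  have hxy : (x.1.loop k, x.1.cK, x.1.cD) = (y.1.loop k, y.1.cK, y.1.cD) := hxy
  simp only [Prod.mk.injEq] at hxy
  refine Subtype.ext (Affine.ext (Finsupp.ext fun j => ?_) hxy.2.1 hxy.2.2)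
  by_cases hj : j = k
  · rw [hj]; exact hxy.1
  · rw [loop_eq_zero H x.2 (hk j hj), loop_eq_zero H y.2 (hk j hj)]

theorem cartanIncl_injective : Function.Injective (cartanIncl H) := by
  rintro ⟨h, c, d⟩ ⟨h', c', d'⟩ e
  have h1 := DFunLike.congr_fun (congrArg Affine.loop e) (0 : ℤ)
  have h2 := congrArg Affine.cK e
  have h3 := congrArg Affine.cD e
  simp only [cartanIncl, LinearMap.coe_mk, AddHom.coe_mk, Finsupp.single_eq_same] at h1 h2 h3
  rw [Subtype.ext h1, h2, h3]

/-- The monoid generated by the positive roots. -/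
abbrev posCone (𝔟 : LieSubalgebra ℂ 𝔤) : AddSubmonoid (Weight H) :=
  AddSubmonoid.closure (posRoots H 𝔟)

/-- The sum of a set of root spaces. -/
def rootPart (S : Set (Weight H)) : Submodule ℂ (Affine 𝔤) := ⨆ β ∈ S, affRootSpace H β

theorem affRootSpace_le_rootPart {S : Set (Weight H)} {β : Weight H} (hβ : β ∈ S) :
    affRootSpace H β ≤ rootPart H S := le_iSup₂_of_le β hβ le_rfl

theorem rootPart_mono {S S' : Set (Weight H)}
    (h : ∀ β ∈ S, affRootSpace H β ≠ ⊥ → β ∈ S') : rootPart H S ≤ rootPart H S' := by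
  refine iSup₂_le fun β hβ => ?_
  by_cases h0 : affRootSpace H β = ⊥
  · rw [h0]; exact bot_le
  · exact affRootSpace_le_rootPart H (h β hβ h0)

theorem rootPart_induction {S : Set (Weight H)} {N : Submodule ℂ (Affine 𝔤)}
    (h : ∀ β ∈ S, ∀ x ∈ affRootSpace H β, x ∈ N) : rootPart H S ≤ N :=
  iSup₂_le h

theorem lie_mem_rootPart {S S' S'' : Set (Weight H)} (hS : ∀ a ∈ S, ∀ b ∈ S', a + b ∈ S'')
    {x y : Affine 𝔤} (hx : x ∈ rootPart H S) (hy : y ∈ rootPart H S') :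
    ⁅x, y⁆ ∈ rootPart H S'' := by
  have h1 : rootPart H S ≤ Submodule.comap
      ((LieAlgebra.ad ℂ (Affine 𝔤) : Affine 𝔤 →ₗ[ℂ] Module.End ℂ (Affine 𝔤)).flip y)
      (rootPart H S'') := by
    refine rootPart_induction H fun α hα x hx => ?_
    have h2 : rootPart H S' ≤ (rootPart H S'').comap (LieAlgebra.ad ℂ (Affine 𝔤) x) :=
      rootPart_induction H fun β hβ y hy => affRootSpace_le_rootPart H (hS α hα β hβ)
        (lie_mem_affRootSpace hx hy)
    exact h2 hy
  exact h1 hx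

/-- The sum of the root spaces for a set closed under addition. -/
def rootSubalgebra (S : Set (Weight H)) (hS : ∀ a ∈ S, ∀ b ∈ S, a + b ∈ S) :
    LieSubalgebra ℂ (Affine 𝔤) where
  __ := rootPart H S
  lie_mem' := fun hx hy => lie_mem_rootPart H hS hx hy

variable [FiniteDimensional ℂ 𝔤] [LieAlgebra.IsSimple ℂ 𝔤] [H.IsCartanSubalgebra]

theorem affRootSpace_zero : affRootSpace H 0 = LinearMap.range (cartanIncl H) := by
  ext x
  constructor
  · intro hx
    have h0 := (mem_rootSpace_zero H).1 (by simpa using loop_mem_rootSpace H hx 0)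
    refine ⟨(⟨x.loop 0, h0⟩, x.cK, x.cD), Affine.ext (Finsupp.ext fun k => ?_) rfl rfl⟩
    by_cases hk : 0 = k
    · subst hk; simp [cartanIncl]
    · rw [loop_eq_zero H hx (k := k) (by
        rw [LinearMap.zero_apply]; exact_mod_cast hk)]
      simp [cartanIncl, Finsupp.single_eq_of_ne (Ne.symm hk)]
  · rintro ⟨h, rfl⟩
    rw [mem_affRootSpace_iff]
    refine ⟨fun t k => ?_, fun t => by simp⟩
    by_cases hk : 0 = k
    · subst hk
      have : ⁅(t.1 : 𝔤), (h.1 : 𝔤)⁆ = 0 := by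
        rw [mem_rootSpace.1 ((mem_rootSpace_zero H).2 h.1.2) t.1]; simp
      simp [cartanIncl, this]
    · simp [cartanIncl, Finsupp.single_eq_of_ne (Ne.symm hk)]

theorem iSup_affRootSpace : ⨆ β, affRootSpace H β = ⊤ := by
  rw [eq_top_iff]
  rintro x -
  rw [eq_sum_loopElem H x]
  refine add_mem (sum_mem fun k _ => ?_) (Submodule.mem_iSup_of_mem 0 ?_)
  · have h1 : ⨆ α, rootSpace H α ≤ (⨆ β, affRootSpace H β).comap (loopElem k) :=
      iSup_le fun α y hy => Submodule.mem_iSup_of_mem _ (loopElem_mem H hy k)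
    rw [iSup_rootSpace] at h1
    exact h1 trivial
  · rw [affRootSpace_zero]; exact ⟨_, rfl⟩

theorem isCompl_rootPart (S : Set (Weight H)) : IsCompl (rootPart H S) (rootPart H Sᶜ) := by
  refine ⟨separated_dual.disjoint disjoint_compl_right, codisjoint_iff.2 (eq_top_iff.2 ?_)⟩
  rw [← iSup_affRootSpace H]
  refine iSup_le fun β => ?_
  by_cases hβ : β ∈ S
  · exact (affRootSpace_le_rootPart H hβ).trans le_sup_left
  · exact (affRootSpace_le_rootPart H hβ).trans le_sup_right

variable {𝔟 : LieSubalgebra ℂ 𝔤}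

/-- A vector of nonzero weight has a nonzero loop coefficient in some degree `k`, which forces `β(K)
= 0`, `β(D) = k` and `β = α + kδ`. The sign of `k` decides, and for `k = 0` the dichotomy for the
roots of `𝔤` does. -/
theorem mem_posRoots_or_neg_mem (h𝔟 : IsBorel 𝔟) (hH : H ≤ 𝔟) {β : Weight H}
    (hβ : affRootSpace H β ≠ ⊥) : β = 0 ∨ β ∈ posRoots H 𝔟 ∨ -β ∈ posRoots H 𝔟 := by
  by_cases hβ0 : β = 0
  · exact Or.inl hβ0
  right
  obtain ⟨x, hx, hx0⟩ := Submodule.exists_mem_ne_zero_of_ne_bot hβ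
  obtain ⟨t, ht⟩ : ∃ t, β t ≠ 0 := by
    by_contra! hc; exact hβ0 (LinearMap.ext hc)
  have hx' := (mem_affRootSpace_iff H).1 hx
  obtain ⟨k, hk⟩ : ∃ k, x.loop k ≠ 0 := by
    by_contra! hc
    exact hx0 (Affine.ext (Finsupp.ext hc) ((mul_eq_zero.1 (hx'.2 t).1).resolve_left ht)
      ((mul_eq_zero.1 (hx'.2 t).2).resolve_left ht))
  set α : Module.Dual ℂ H := β ∘ₗ LinearMap.inl ℂ H (ℂ × ℂ) with hα
  have hxα : x.loop k ∈ rootSpace H α := loop_mem_rootSpace H hx k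
  have hD : β (0, 0, 1) = k := by
    by_contra hc; exact hk (loop_eq_zero H hx hc)
  have hK : β (0, 1, 0) = 0 := by
    have := hx'.1 (0, 1, 0) k
    simp only [ZeroMemClass.coe_zero, zero_lie, zero_mul, zero_smul, add_zero] at this
    exact (smul_eq_zero.1 this.symm).resolve_right hk
  have hβα : β = extendForm H α + (k : ℂ) • delta H := by
    refine LinearMap.ext fun h => ?_
    have : h = (h.1, 0) + h.2.1 • (0, 1, 0) + h.2.2 • ((0 : H), (0 : ℂ), (1 : ℂ)) := by
      ext <;> simp
    conv_lhs => rw [this]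
    rw [map_add, map_add, map_smul, map_smul, hK, hD]
    simp [extendForm, delta, hα, mul_comm]
  rcases lt_trichotomy k 0 with hk0 | hk0 | hk0
  · right
    obtain ⟨n, rfl⟩ : ∃ n : ℕ, k = -n := ⟨k.natAbs, by omega⟩
    have h1 : -β = extendForm H (-α) + (n : ℂ) • delta H := by
      rw [hβα, neg_add, ← neg_smul, Int.cast_neg, neg_neg]
      rfl
    by_cases hα0 : α = 0
    · refine Or.inr ⟨n, by omega, ?_⟩
      rw [h1, hα0]; simp [extendForm]
    · exact Or.inl (Or.inr ⟨-α, neg_mem_roots_top H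
        ((mem_roots_iff H).2 ⟨hα0, _, trivial, hk, hxα⟩), n, by omega, h1⟩)
  · have h1 : β = extendForm H α := by rw [hβα, hk0]; simp
    have hα0 : α ≠ 0 := by
      rintro h
      refine hβ0 ?_
      rw [h1, h]; simp [extendForm]
    rcases mem_roots_or_neg_mem H h𝔟 hH ((mem_roots_iff H).2 ⟨hα0, _, trivial, hk, hxα⟩) with h | h
    · exact Or.inl (Or.inl (Or.inl ⟨α, h, h1⟩))
    · exact Or.inr (Or.inl (Or.inl ⟨-α, h, by rw [h1]; rfl⟩))
  · left
    obtain ⟨n, rfl⟩ : ∃ n : ℕ, k = n := ⟨k.natAbs, by omega⟩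
    rw [Int.cast_natCast] at hβα
    by_cases hα0 : α = 0
    · refine Or.inr ⟨n, by omega, ?_⟩
      rw [hβα, hα0]; simp [extendForm]
    · exact Or.inl (Or.inr ⟨α, (mem_roots_iff H).2 ⟨hα0, _, trivial, hk, hxα⟩, n, by omega, hβα⟩)

/-- On the cone `D` takes natural number values, and elements of value `0` come from the cone of the
roots of `𝔟`. If `a + b = 0`, both values vanish and `salient_roots` applies. -/
theorem salient_posCone (h𝔟 : IsBorel 𝔟) (hH : H ≤ 𝔟) : Salient (posCone H 𝔟) := by
  have key : ∀ a ∈ posCone H 𝔟, ∃ n : ℕ, a (0, 0, 1) = n ∧ (n = 0 →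
      ∃ α ∈ AddSubmonoid.closure (roots H 𝔟), a = extendForm H α) := by
    intro a ha
    induction ha using AddSubmonoid.closure_induction with
    | mem x hx =>
      rcases hx with (⟨α, hα, rfl⟩ | ⟨α, hα, n, hn, rfl⟩) | ⟨n, hn, rfl⟩
      · exact ⟨0, by simp [extendForm], fun _ => ⟨α, AddSubmonoid.subset_closure hα, rfl⟩⟩
      · exact ⟨n, by simp [extendForm, delta], by omega⟩
      · exact ⟨n, by simp [delta], by omega⟩
    | zero => exact ⟨0, by simp, fun _ => ⟨0, zero_mem _, by simp [extendForm]⟩⟩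
    | add x y _ _ hx hy =>
      obtain ⟨n, h1, h2⟩ := hx
      obtain ⟨m, k1, k2⟩ := hy
      refine ⟨n + m, by simp [h1, k1], fun h => ?_⟩
      obtain ⟨α, hα, rfl⟩ := h2 (by omega)
      obtain ⟨α', hα', rfl⟩ := k2 (by omega)
      exact ⟨α + α', add_mem hα hα', by simp [extendForm, LinearMap.add_comp]⟩
  intro a ha b hb hab
  obtain ⟨n, h1, h2⟩ := key a ha
  obtain ⟨m, k1, k2⟩ := key b hb
  have h3 : ((n + m : ℕ) : ℂ) = 0 := by
    rw [Nat.cast_add, ← h1, ← k1, ← LinearMap.add_apply, hab]; simp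
  have h4 : n + m = 0 := by exact_mod_cast h3
  obtain ⟨α, hα, rfl⟩ := h2 (by omega)
  obtain ⟨α', hα', rfl⟩ := k2 (by omega)
  have h5 : α + α' = 0 := by
    refine LinearMap.ext fun t => ?_
    have := LinearMap.congr_fun hab (t, 0, 0)
    simpa [extendForm] using this
  rw [salient_roots H h𝔟.1 hH α hα α' hα' h5]
  simp [extendForm]

/-- The cone is much larger than the set of positive roots, but by salience a weight of the algebra
that lies in the cone is `0` or a positive root. -/
theorem rootPart_posCone (h𝔟 : IsBorel 𝔟) (hH : H ≤ 𝔟) :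
    rootPart H (posCone H 𝔟) = (affineBorel 𝔟).toSubmodule := by
  apply le_antisymm
  · have h1 : rootPart H (posCone H 𝔟 : Set (Weight H)) ≤
        rootPart H (insert 0 (posRoots H 𝔟)) := by
      refine rootPart_mono H fun β hβ hβ0 => ?_
      rcases mem_posRoots_or_neg_mem H h𝔟 hH hβ0 with h | h | h
      · exact Or.inl h
      · exact Or.inr h
      · exact Or.inl (salient_posCone H h𝔟 hH β hβ (-β) (AddSubmonoid.subset_closure h)
          (add_neg_cancel β))
    refine h1.trans (rootPart_induction H fun β hβ x hx => ?_)
    rcases hβ with rfl | (⟨α, hα, rfl⟩ | ⟨α, hα, n, hn, rfl⟩) | ⟨n, hn, rfl⟩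
    · rw [affRootSpace_zero] at hx
      obtain ⟨h, rfl⟩ := hx
      refine ⟨fun n hn => ?_, ?_⟩
      · simp [cartanIncl, Finsupp.single_eq_of_ne hn.ne]
      · simpa [cartanIncl] using hH h.1.2
    · refine ⟨fun n hn => loop_eq_zero H hx ?_, ?_⟩
      · have : (0 : ℂ) ≠ n := by exact_mod_cast hn.ne'
        simpa [extendForm] using this
      · exact rootSpace_le_of_mem_roots H hα (loop_mem_rootSpace H hx 0)
    · have h0 : ∀ k : ℤ, k ≤ 0 → x.loop k = 0 := fun k hk => loop_eq_zero H hx (by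
        have : ((n : ℤ) : ℂ) ≠ (k : ℂ) := by exact_mod_cast (by omega : (n : ℤ) ≠ k)
        simpa [extendForm, delta] using this)
      exact ⟨fun k hk => h0 k hk.le, by rw [h0 0 le_rfl]; exact zero_mem _⟩
    · have h0 : ∀ k : ℤ, k ≤ 0 → x.loop k = 0 := fun k hk => loop_eq_zero H hx (by
        have : ((n : ℤ) : ℂ) ≠ (k : ℂ) := by exact_mod_cast (by omega : (n : ℤ) ≠ k)
        simpa [delta] using this)
      exact ⟨fun k hk => h0 k hk.le, by rw [h0 0 le_rfl]; exact zero_mem _⟩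
  · intro x hx
    rw [eq_sum_loopElem H x]
    refine add_mem (sum_mem fun k _ => ?_) (affRootSpace_le_rootPart H (zero_mem _) ?_)
    · rcases lt_trichotomy k 0 with hk | rfl | hk
      · rw [hx.1 k hk, map_zero]; exact zero_mem _
      · have h1 : ⨆ α ∈ insert 0 (roots H 𝔟), rootSpace H α ≤
            (rootPart H (posCone H 𝔟)).comap (loopElem 0) := by
          refine iSup₂_le fun α hα y hy => affRootSpace_le_rootPart H ?_ (loopElem_mem H hy 0)
          rcases hα with rfl | hα
          · simp only [extendForm, LinearMap.zero_comp, Int.cast_zero, zero_smul, add_zero]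
            exact zero_mem _
          · exact AddSubmonoid.subset_closure (Or.inl (Or.inl ⟨α, hα, by simp⟩))
        exact h1 (mem_iSup_rootSpace_of_mem hH hx.2)
      · have h1 : ⨆ α, rootSpace H α ≤ (rootPart H (posCone H 𝔟)).comap (loopElem k) := by
          refine iSup_le fun α y hy => ?_
          by_cases hy0 : y = 0
          · rw [hy0]; exact zero_mem _
          have hkk : (k : ℂ) = (k.toNat : ℂ) := by
            have : ((k.toNat : ℤ) : ℂ) = ((k : ℤ) : ℂ) := by congr 1; omega
            push_cast at this; exact this.symm
          refine affRootSpace_le_rootPart H (AddSubmonoid.subset_closure ?_) (loopElem_mem H hy k)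
          by_cases hα : α = 0
          · refine Or.inr ⟨k.toNat, by omega, ?_⟩
            rw [hα, hkk]; simp [extendForm]
          · exact Or.inl (Or.inr ⟨α, (mem_roots_iff H).2 ⟨hα, y, trivial, hy0, hy⟩, k.toNat,
              by omega, by rw [hkk]⟩)
        rw [iSup_rootSpace] at h1
        exact h1 trivial
    · rw [affRootSpace_zero]; exact ⟨_, rfl⟩

theorem mem_posCone_or_neg_mem (h𝔟 : IsBorel 𝔟) (hH : H ≤ 𝔟) {β : Weight H}
    (hβ : affRootSpace H β ≠ ⊥) : β ∈ posCone H 𝔟 ∨ -β ∈ posCone H 𝔟 := by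
  rcases mem_posRoots_or_neg_mem H h𝔟 hH hβ with rfl | h | h
  · exact Or.inl (zero_mem _)
  · exact Or.inl (AddSubmonoid.subset_closure h)
  · exact Or.inr (AddSubmonoid.subset_closure h)

/-! ## Triangular decomposition -/

variable (𝔟) in
/-- The nonzero elements of the positive cone. -/
def posSet : Set (Weight H) := {β | β ∈ posCone H 𝔟 ∧ β ≠ 0}

theorem posSet_add (h𝔟 : IsBorel 𝔟) (hH : H ≤ 𝔟) {a b : Weight H} (ha : a ∈ posSet H 𝔟)
    (hb : b ∈ posCone H 𝔟) : a + b ∈ posSet H 𝔟 :=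
  ⟨add_mem ha.1 hb, fun h => ha.2 (salient_posCone H h𝔟 hH a ha.1 b hb h)⟩

/-- The subalgebra `𝔫₊`. -/
def nPlus (h𝔟 : IsBorel 𝔟) (hH : H ≤ 𝔟) : LieSubalgebra ℂ (Affine 𝔤) :=
  rootSubalgebra H (posSet H 𝔟) fun _ ha _ hb => posSet_add H h𝔟 hH ha hb.1

/-- The subalgebra `𝔫₋`. -/
def nMinus (h𝔟 : IsBorel 𝔟) (hH : H ≤ 𝔟) : LieSubalgebra ℂ (Affine 𝔤) :=
  rootSubalgebra H {β | -β ∈ posSet H 𝔟} fun a ha b hb => by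
    change -(a + b) ∈ posSet H 𝔟
    rw [neg_add]; exact posSet_add H h𝔟 hH ha hb.1

theorem mem_nMinus {h𝔟 : IsBorel 𝔟} {hH : H ≤ 𝔟} {x : Affine 𝔤} :
    x ∈ nMinus H h𝔟 hH ↔ x ∈ rootPart H {β | -β ∈ posSet H 𝔟} := Iff.rfl

theorem mem_affineBorel_iff (h𝔟 : IsBorel 𝔟) (hH : H ≤ 𝔟) {x : Affine 𝔤} :
    x ∈ affineBorel 𝔟 ↔ x ∈ rootPart H (posCone H 𝔟) := by
  rw [rootPart_posCone H h𝔟 hH]; rfl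

theorem nPlus_le (h𝔟 : IsBorel 𝔟) (hH : H ≤ 𝔟) : nPlus H h𝔟 hH ≤ affineBorel 𝔟 := by
  intro x hx
  rw [mem_affineBorel_iff H h𝔟 hH]
  exact rootPart_mono H (fun β hβ _ => hβ.1) hx

theorem cartanIncl_mem (h𝔟 : IsBorel 𝔟) (hH : H ≤ 𝔟) (h : AffineCartan H) :
    cartanIncl H h ∈ affineBorel 𝔟 := by
  rw [mem_affineBorel_iff H h𝔟 hH]
  refine affRootSpace_le_rootPart H (zero_mem _) ?_
  rw [affRootSpace_zero]; exact ⟨h, rfl⟩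

theorem cartanIncl_mem_affRootSpace (h : AffineCartan H) : cartanIncl H h ∈ affRootSpace H 0 := by
  rw [affRootSpace_zero]; exact ⟨h, rfl⟩

theorem cartanIncl_lie_cartanIncl (h h' : AffineCartan H) :
    ⁅cartanIncl H h, cartanIncl H h'⁆ = 0 := by
  rw [mem_affRootSpace.1 (cartanIncl_mem_affRootSpace H h') h]; simp

/-- The projection of the affine algebra to a sum of root spaces. -/
def rootProj (S : Set (Weight H)) : Affine 𝔤 →ₗ[ℂ] rootPart H S :=
  Submodule.projectionOnto _ _ (isCompl_rootPart H S)

theorem rootProj_of_mem {S : Set (Weight H)} {x : Affine 𝔤} (hx : x ∈ rootPart H S) :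
    rootProj H S x = ⟨x, hx⟩ :=
  Submodule.projectionOnto_apply_left (isCompl_rootPart H S) ⟨x, hx⟩

theorem rootProj_eq_zero_iff {S : Set (Weight H)} {x : Affine 𝔤} :
    rootProj H S x = 0 ↔ x ∈ rootPart H Sᶜ :=
  Submodule.projectionOnto_apply_eq_zero_iff (isCompl_rootPart H S)

/-- The two sets of weights differ, but only by weights whose root space is zero. -/
theorem rootPart_compl_neg (h𝔟 : IsBorel 𝔟) (hH : H ≤ 𝔟) :
    rootPart H {β | -β ∈ posSet H 𝔟}ᶜ = rootPart H (posCone H 𝔟) := by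
  apply le_antisymm
  · refine rootPart_mono H fun β hβ h0 => ?_
    rcases mem_posCone_or_neg_mem H h𝔟 hH h0 with h | h
    · exact h
    · by_contra hc
      refine hβ ⟨h, fun h0 => hc ?_⟩
      rw [neg_eq_zero.1 h0]; exact zero_mem _
  · refine rootPart_mono H fun β hβ h0 hc => ?_
    exact hc.2 (by rw [salient_posCone H h𝔟 hH β hβ _ hc.1 (add_neg_cancel β), neg_zero])

/-- The projection to `𝔫₋` along the Borel subalgebra. -/
def projMinus (h𝔟 : IsBorel 𝔟) (hH : H ≤ 𝔟) : Affine 𝔤 →ₗ[ℂ] nMinus H h𝔟 hH :=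
  rootProj H {β | -β ∈ posSet H 𝔟}

theorem projMinus_coe (h𝔟 : IsBorel 𝔟) (hH : H ≤ 𝔟) (x : nMinus H h𝔟 hH) :
    projMinus H h𝔟 hH x = x := rootProj_of_mem H x.2

theorem projMinus_eq_zero_iff (h𝔟 : IsBorel 𝔟) (hH : H ≤ 𝔟) {x : Affine 𝔤} :
    projMinus H h𝔟 hH x = 0 ↔ x ∈ affineBorel 𝔟 := by
  rw [mem_affineBorel_iff H h𝔟 hH, ← rootPart_compl_neg H h𝔟 hH]
  exact rootProj_eq_zero_iff H

/-- The projection to the Borel subalgebra along `𝔫₋`. -/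
def projBorel (h𝔟 : IsBorel 𝔟) (hH : H ≤ 𝔟) : Affine 𝔤 →ₗ[ℂ] affineBorel 𝔟 :=
  (LinearMap.id - (nMinus H h𝔟 hH).toSubmodule.subtype ∘ₗ projMinus H h𝔟 hH).codRestrict
    (affineBorel 𝔟).toSubmodule fun x => by
      refine (projMinus_eq_zero_iff H h𝔟 hH).1 ?_
      rw [LinearMap.sub_apply, map_sub, sub_eq_zero]
      exact (projMinus_coe H h𝔟 hH _).symm

theorem projBorel_apply (h𝔟 : IsBorel 𝔟) (hH : H ≤ 𝔟) (x : Affine 𝔤) :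
    (projBorel H h𝔟 hH x : Affine 𝔤) = x - projMinus H h𝔟 hH x := rfl

theorem projBorel_coe (h𝔟 : IsBorel 𝔟) (hH : H ≤ 𝔟) (x : affineBorel 𝔟) :
    projBorel H h𝔟 hH x = x := Subtype.ext (by
  rw [projBorel_apply, (projMinus_eq_zero_iff H h𝔟 hH).2 x.2]; simp)

theorem projBorel_of_mem_nMinus (h𝔟 : IsBorel 𝔟) (hH : H ≤ 𝔟) (x : nMinus H h𝔟 hH) :
    projBorel H h𝔟 hH x = 0 := Subtype.ext (by
  rw [projBorel_apply, projMinus_coe]; simp)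

/-- The projection of the Borel subalgebra to `𝔫₊` along the Cartan subalgebra. -/
def projPlus (h𝔟 : IsBorel 𝔟) (hH : H ≤ 𝔟) : affineBorel 𝔟 →ₗ[ℂ] nPlus H h𝔟 hH :=
  rootProj H (posSet H 𝔟) ∘ₗ (affineBorel 𝔟).toSubmodule.subtype

theorem projPlus_coe (h𝔟 : IsBorel 𝔟) (hH : H ≤ 𝔟) (x : nPlus H h𝔟 hH) :
    projPlus H h𝔟 hH (LieSubalgebra.inclusion (nPlus_le H h𝔟 hH) x) = x :=
  rootProj_of_mem H x.2

theorem rootPart_zero : rootPart H {0} = LinearMap.range (cartanIncl H) := by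
  rw [rootPart, iSup_singleton, affRootSpace_zero]

/-- The projection to the Cartan subalgebra along all other root spaces. -/
def projCartan : Affine 𝔤 →ₗ[ℂ] AffineCartan H :=
  (LinearEquiv.ofInjective (cartanIncl H) (cartanIncl_injective H)).symm.toLinearMap ∘ₗ
    Submodule.inclusion (rootPart_zero H).le ∘ₗ rootProj H {0}

theorem projCartan_cartanIncl (h : AffineCartan H) : projCartan H (cartanIncl H h) = h := by
  have h1 : cartanIncl H h ∈ rootPart H {0} :=
    affRootSpace_le_rootPart H (Set.mem_singleton 0) (cartanIncl_mem_affRootSpace H h)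
  rw [projCartan, LinearMap.comp_apply, LinearMap.comp_apply, rootProj_of_mem H h1]
  exact (LinearEquiv.symm_apply_eq _).2 (Subtype.ext rfl)

theorem projCartan_of_mem_nPlus (h𝔟 : IsBorel 𝔟) (hH : H ≤ 𝔟) (x : nPlus H h𝔟 hH) :
    projCartan H x = 0 := by
  have : rootProj H {0} (x : Affine 𝔤) = 0 := (rootProj_eq_zero_iff H).2
    (rootPart_mono H (fun β hβ _ => hβ.2) x.2)
  rw [projCartan, LinearMap.comp_apply, LinearMap.comp_apply, this, map_zero, map_zero]

theorem exists_of_projPlus_eq_zero (h𝔟 : IsBorel 𝔟) (hH : H ≤ 𝔟) {y : affineBorel 𝔟}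
    (hy : projPlus H h𝔟 hH y = 0) : ∃ h, (y : Affine 𝔤) = cartanIncl H h := by
  have h1 : (y : Affine 𝔤) ∈ rootPart H (posSet H 𝔟)ᶜ := (rootProj_eq_zero_iff H).1 hy
  have h2 := (mem_affineBorel_iff H h𝔟 hH).1 y.2
  have h3 : rootPart H (posCone H 𝔟 : Set (Weight H)) ≤
      affRootSpace H 0 ⊔ rootPart H (posSet H 𝔟) := by
    refine rootPart_induction H fun β hβ x hx => ?_
    by_cases h0 : β = 0
    · exact Submodule.mem_sup_left (h0 ▸ hx)
    · exact Submodule.mem_sup_right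
        (affRootSpace_le_rootPart H (S := posSet H 𝔟) ⟨hβ, h0⟩ hx)
  obtain ⟨a, ha, b, hb, hab⟩ := Submodule.mem_sup.1 (h3 h2)
  have h4 : a ∈ rootPart H (posSet H 𝔟)ᶜ :=
    affRootSpace_le_rootPart H (S := (posSet H 𝔟)ᶜ) (fun h : (0 : Weight H) ∈ posSet H 𝔟 => h.2 rfl) ha
  have h5 : b ∈ rootPart H (posSet H 𝔟)ᶜ := by
    rw [← hab] at h1
    exact (Submodule.add_mem_iff_right _ h4).1 h1
  have h6 : b = 0 := Submodule.disjoint_def.1 (isCompl_rootPart H (posSet H 𝔟)).disjoint b hb h5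
  rw [affRootSpace_zero] at ha
  obtain ⟨h, rfl⟩ := ha
  exact ⟨h, by rw [← hab, h6, add_zero]⟩

theorem weightLE_refl (μ : Weight H) : WeightLE H 𝔟 μ μ := by
  rw [WeightLE, sub_self]; exact zero_mem _

theorem WeightLE.trans {H : LieSubalgebra ℂ 𝔤} {μ ν γ : Weight H} (h : WeightLE H 𝔟 μ ν)
    (h' : WeightLE H 𝔟 ν γ) : WeightLE H 𝔟 μ γ := by
  rw [WeightLE] at *
  rw [← sub_add_sub_cancel γ ν μ]; exact add_mem h' h

theorem WeightLE.antisymm (h𝔟 : IsBorel 𝔟) (hH : H ≤ 𝔟) {μ ν : Weight H} (h : WeightLE H 𝔟 μ ν)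
    (h' : WeightLE H 𝔟 ν μ) : μ = ν := by
  have := salient_posCone H h𝔟 hH _ h _ h' (by abel)
  exact (sub_eq_zero.1 this).symm

end AffineRoots
end AffineO
end

noncomputable section
namespace AffineO

/-! ## Generalities on modules over the affine algebra -/

section Hom

variable {𝔤 : Type u} [LieRing 𝔤] [LieAlgebra ℂ 𝔤] {A : Type u} [CommRing A] [Algebra ℂ A]

namespace AffineMod

theorem Hom.comp_apply {M N K : AffineMod 𝔤 A} (f : M ⟶ N) (g : N ⟶ K) (m : M.carrier) :
    (f ≫ g).toLin m = g.toLin (f.toLin m) := rfl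

theorem hom_ext {M N : AffineMod 𝔤 A} {f g : M ⟶ N} (h : ∀ m, f.toLin m = g.toLin m) : f = g :=
  Hom.ext (LinearMap.ext h)

theorem Hom.congr_apply {M N : AffineMod 𝔤 A} {f g : M ⟶ N} (h : f = g) (m : M.carrier) :
    f.toLin m = g.toLin m := by rw [h]

theorem smul_ρ (M : AffineMod 𝔤 A) (c : ℂ) (x : Affine 𝔤) (m : M.carrier) :
    M.ρ (c • x) m = algebraMap ℂ A c • M.ρ x m := by
  rw [map_smulₛₗ]; rfl

theorem ρ_ρ (M : AffineMod 𝔤 A) (x y : Affine 𝔤) (m : M.carrier) :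
    M.ρ x (M.ρ y m) = M.ρ ⁅x, y⁆ m + M.ρ y (M.ρ x m) := by
  rw [M.ρ_lie]; simp

/-- The elements of the affine algebra that map a given vector to a given submodule. -/
def transporter (M : AffineMod 𝔤 A) (m : M.carrier) (N : Submodule A M.carrier) :
    Submodule ℂ (Affine 𝔤) where
  carrier := {x | M.ρ x m ∈ N}
  add_mem' := fun {x y} hx hy => by
    change M.ρ (x + y) m ∈ N
    rw [map_add]; exact N.add_mem hx hy
  zero_mem' := by
    change M.ρ 0 m ∈ N
    rw [map_zero]; exact N.zero_mem
  smul_mem' := fun c x hx => by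
    change M.ρ (c • x) m ∈ N
    rw [smul_ρ]; exact N.smul_mem _ hx

/-- The submodule generated by a subspace. -/
def gen (M : AffineMod 𝔤 A) (W : Submodule A M.carrier) : Submodule A M.carrier :=
  sInf {N | W ≤ N ∧ M.IsStable N}

theorem le_gen (M : AffineMod 𝔤 A) (W : Submodule A M.carrier) : W ≤ M.gen W :=
  le_sInf fun _ h => h.1

theorem gen_le {M : AffineMod 𝔤 A} {W N : Submodule A M.carrier} (h : W ≤ N)
    (hN : M.IsStable N) : M.gen W ≤ N := sInf_le ⟨h, hN⟩

theorem isStable_gen (M : AffineMod 𝔤 A) (W : Submodule A M.carrier) : M.IsStable (M.gen W) := by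
  intro x m hm
  rw [Submodule.mem_comap]
  refine Submodule.mem_sInf.2 fun N hN => hN.2 x ((Submodule.mem_sInf.1 hm) N hN)

theorem gen_mono {M : AffineMod 𝔤 A} {W W' : Submodule A M.carrier} (h : W ≤ W') :
    M.gen W ≤ M.gen W' := gen_le (h.trans (le_gen M W')) (isStable_gen M W')

theorem isStable_comap {M N : AffineMod 𝔤 A} (f : M ⟶ N) {K : Submodule A N.carrier}
    (hK : N.IsStable K) : M.IsStable (K.comap f.toLin) := fun x m hm => by
  rw [Submodule.mem_comap, Submodule.mem_comap, f.comm]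
  exact hK x hm

theorem isStable_map {M N : AffineMod 𝔤 A} (f : M ⟶ N) {K : Submodule A M.carrier}
    (hK : M.IsStable K) : N.IsStable (K.map f.toLin) := by
  rintro x _ ⟨m, hm, rfl⟩
  exact ⟨M.ρ x m, hK x hm, f.comm x m⟩

theorem isStable_bot (M : AffineMod 𝔤 A) : M.IsStable ⊥ := fun x m hm => by
  rw [Submodule.mem_bot] at hm
  simp [hm]

theorem isStable_ker {M N : AffineMod 𝔤 A} (f : M ⟶ N) : M.IsStable (LinearMap.ker f.toLin) :=
  isStable_comap f (isStable_bot N)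

theorem map_gen {M N : AffineMod 𝔤 A} (f : M ⟶ N) (W : Submodule A M.carrier) :
    (M.gen W).map f.toLin = N.gen (W.map f.toLin) := by
  apply le_antisymm
  · rw [Submodule.map_le_iff_le_comap]
    exact gen_le (Submodule.map_le_iff_le_comap.1 (le_gen N _)) (isStable_comap f (isStable_gen N _))
  · exact gen_le (Submodule.map_mono (le_gen M W)) (isStable_map f (isStable_gen M W))

/-- A map from a quotient. -/
def quotLift {M N : AffineMod 𝔤 A} (f : M ⟶ N) (K : Submodule A M.carrier) (hK : M.IsStable K)
    (h : K ≤ LinearMap.ker f.toLin) : M.quot K hK ⟶ N where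
  toLin := K.liftQ f.toLin h
  comm x m := by
    obtain ⟨m, rfl⟩ := K.mkQ_surjective m
    exact f.comm x m

theorem quotMk_quotLift {M N : AffineMod 𝔤 A} (f : M ⟶ N) (K : Submodule A M.carrier)
    (hK : M.IsStable K) (h : K ≤ LinearMap.ker f.toLin) :
    M.quotMk K hK ≫ quotLift f K hK h = f := rfl

theorem quotMk_surjective (M : AffineMod 𝔤 A) (K : Submodule A M.carrier) (hK : M.IsStable K) :
    Function.Surjective (M.quotMk K hK).toLin := K.mkQ_surjective

theorem ker_quotMk (M : AffineMod 𝔤 A) (K : Submodule A M.carrier) (hK : M.IsStable K) :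
    LinearMap.ker (M.quotMk K hK).toLin = K := K.ker_mkQ

/-- Maps from the target of a surjection. -/
theorem exists_desc {M N K : AffineMod 𝔤 A} (g : M ⟶ N) (hg : Function.Surjective g.toLin)
    (f : M ⟶ K) (h : LinearMap.ker g.toLin ≤ LinearMap.ker f.toLin) : ∃ k : N ⟶ K, g ≫ k = f := by
  choose s hs using hg
  have key : ∀ m, f.toLin (s (g.toLin m)) = f.toLin m := fun m => by
    rw [← sub_eq_zero, ← map_sub]
    exact h (by rw [LinearMap.mem_ker, map_sub, hs, sub_self])
  refine ⟨⟨⟨⟨fun n => f.toLin (s n), fun a b => ?_⟩, fun c a => ?_⟩, fun x a => ?_⟩,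
    hom_ext key⟩
  · rw [← hs a, ← hs b, ← map_add, key, key, key, map_add]
  · change f.toLin (s (c • a)) = c • f.toLin (s a)
    rw [← hs a, ← map_smul, key, key, map_smul]
  · change f.toLin (s (N.ρ x a)) = K.ρ x (f.toLin (s a))
    rw [← hs a, ← g.comm, key, key, f.comm]

/-- A stable submodule as a module. -/
def sub (M : AffineMod 𝔤 A) (N : Submodule A M.carrier) (hN : M.IsStable N) :
    AffineMod 𝔤 A where
  carrier := N
  ρ :=
    { toFun := fun x => (M.ρ x).restrict (hN x)
      map_add' := fun x y => by ext; simp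
      map_smul' := fun c x => by ext; simp }
  ρ_lie x y := by ext; simp [M.ρ_lie]

/-- The inclusion of a submodule. -/
def subι (M : AffineMod 𝔤 A) (N : Submodule A M.carrier) (hN : M.IsStable N) :
    M.sub N hN ⟶ M where
  toLin := N.subtype
  comm _ _ := rfl

end AffineMod

open AffineMod

/-- A property of modules is closed under quotients if it passes to surjective images. -/
def QuotClosed (C : ObjectProperty (AffineMod 𝔤 A)) : Prop :=
  ∀ (M N : AffineMod 𝔤 A) (f : M ⟶ N), Function.Surjective f.toLin → C M → C N

/-- Categorical projectivity tests against epimorphisms of `C`. These are surjective because the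
cokernel stays in `C`: the quotient map and the zero map agree after composition with the
epimorphism. -/
theorem projective_of_lift {C : ObjectProperty (AffineMod 𝔤 A)} (hC : QuotClosed C)
    {P : AffineMod 𝔤 A} (hP : C P)
    (h : ∀ (M N : AffineMod 𝔤 A), C M → C N → ∀ f : M ⟶ N, Function.Surjective f.toLin →
      ∀ p : P ⟶ N, ∃ q : P ⟶ M, q ≫ f = p) : Projective (⟨P, hP⟩ : C.FullSubcategory) := by
  constructor
  intro E X f e he
  have hsurj : Function.Surjective e.hom.toLin := by
    have hq := hC _ _ _ (quotMk_surjective X.obj _ (isStable_range e.hom)) X.property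
    let z : X.obj ⟶ X.obj.quot _ (isStable_range e.hom) := ⟨0, fun x m => by simp⟩
    have h1 : e ≫ (ObjectProperty.homMk (X.obj.quotMk _ (isStable_range e.hom)) :
        X ⟶ ⟨_, hq⟩) = e ≫ ObjectProperty.homMk z := by
      refine ObjectProperty.hom_ext _ (hom_ext fun m => ?_)
      exact (Submodule.Quotient.mk_eq_zero _).2 ⟨m, rfl⟩
    have h2 := (cancel_epi e).1 h1
    have h3 : X.obj.quotMk _ (isStable_range e.hom) = z := congrArg (fun k => k.hom) h2
    intro m
    have h4 := Hom.congr_apply h3 m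
    exact (Submodule.Quotient.mk_eq_zero _).1 h4
  obtain ⟨q, hq⟩ := h _ _ E.property X.property e.hom hsurj f.hom
  exact ⟨ObjectProperty.homMk q, ObjectProperty.hom_ext _ hq⟩

theorem exists_lift {C : ObjectProperty (AffineMod 𝔤 A)} {P : AffineMod 𝔤 A} {hP : C P}
    (h : Projective (⟨P, hP⟩ : C.FullSubcategory)) {M N : AffineMod 𝔤 A} (hM : C M) (hN : C N)
    (f : M ⟶ N) (hf : Function.Surjective f.toLin) (p : P ⟶ N) : ∃ q : P ⟶ M, q ≫ f = p := by
  let f' : (⟨M, hM⟩ : C.FullSubcategory) ⟶ ⟨N, hN⟩ := ObjectProperty.homMk f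
  let p' : (⟨P, hP⟩ : C.FullSubcategory) ⟶ ⟨N, hN⟩ := ObjectProperty.homMk p
  have : Epi f' := by
    constructor
    intro Z g k hgk
    refine ObjectProperty.hom_ext _ (hom_ext fun n => ?_)
    obtain ⟨m, rfl⟩ := hf n
    exact Hom.congr_apply (congrArg (fun k => k.hom) hgk) m
  exact ⟨(Projective.factorThru p' f').hom, congrArg (fun k => k.hom)
    (Projective.factorThru_comp p' f')⟩

end Hom

section Weights

variable {𝔤 : Type u} [LieRing 𝔤] [LieAlgebra ℂ 𝔤] (H : LieSubalgebra ℂ 𝔤)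
  {A : Type u} [CommRing A] [Algebra ℂ A] [Algebra (SymmetricAlgebra ℂ H) A]

open AffineMod

variable (A) in
/-- The character by which the affine Cartan subalgebra acts on a weight space. -/
def weightChar (lam : Weight H) (h : AffineCartan H) : A := algebraMap ℂ A (lam h) + tau H A h

/-- The deformation `τ` cancels in the difference of two characters, leaving a nonzero complex
number, which is a unit in `A`. So weight spaces over `A` behave as over a field. -/
theorem separated_weightChar : Separated (weightChar H A) := by
  intro lam μ h
  obtain ⟨t, ht⟩ := separated_dual lam μ h
  refine ⟨t, ?_⟩
  rw [weightChar, weightChar, add_sub_add_right_eq_sub, ← map_sub]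
  exact ht.map _

theorem isWeightModule_iff {M : AffineMod 𝔤 A} :
    IsWeightModule H M ↔ ⨆ lam, weightSpace H M lam = ⊤ :=
  ⟨fun h => h.2, fun h => ⟨(separated_weightChar H).iSupIndep, h⟩⟩

variable {H} in
theorem hom_mem_weightSpace {M N : AffineMod 𝔤 A} (f : M ⟶ N) {μ : Weight H} {m : M.carrier}
    (hm : m ∈ weightSpace H M μ) : f.toLin m ∈ weightSpace H N μ :=
  map_mem_eigSpace (fun t => f.comm (cartanIncl H t)) hm

variable {H} in
theorem ρ_mem_weightSpace {M : AffineMod 𝔤 A} {β μ : Weight H} {x : Affine 𝔤} {m : M.carrier}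
    (hx : x ∈ affRootSpace H β) (hm : m ∈ weightSpace H M μ) :
    M.ρ x m ∈ weightSpace H M (β + μ) := by
  rw [mem_weightSpace] at *
  intro h
  rw [ρ_ρ, mem_affRootSpace.1 hx, hm, smul_ρ, map_smul, ← add_smul, LinearMap.add_apply, map_add]
  congr 1
  ring

/-- All weights of the module lie in `J`. -/
def WeightsIn (J : Set (Weight H)) (M : AffineMod 𝔤 A) : Prop :=
  ⨆ μ ∈ J, weightSpace H M μ = ⊤

variable {H}

theorem WeightsIn.of_surjective {J : Set (Weight H)} {M N : AffineMod 𝔤 A} (f : M ⟶ N)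
    (hf : Function.Surjective f.toLin) (h : WeightsIn H J M) : WeightsIn H J N :=
  iSup_eigSpace_eq_top_of_surjective (fun t => f.comm (cartanIncl H t)) hf h

theorem WeightsIn.eq_zero {J : Set (Weight H)} {M : AffineMod 𝔤 A} (h : WeightsIn H J M)
    {μ : Weight H} (hμ : μ ∉ J) {m : M.carrier} (hm : m ∈ weightSpace H M μ) : m = 0 :=
  (separated_weightChar H).eq_zero_of_mem hμ hm (by
    have := h.ge (Submodule.mem_top (x := m))
    exact this)

theorem WeightsIn.mono {J J' : Set (Weight H)} {M : AffineMod 𝔤 A} (h : WeightsIn H J M)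
    (hJ : J ⊆ J') : WeightsIn H J' M := by
  rw [WeightsIn, eq_top_iff, ← h]
  exact biSup_mono hJ

theorem WeightsIn.of_forall {J J' : Set (Weight H)} {M : AffineMod 𝔤 A} (h : WeightsIn H J M)
    (hJ : ∀ μ ∈ J, weightSpace H M μ ≠ ⊥ → μ ∈ J') : WeightsIn H J' M := by
  rw [WeightsIn, eq_top_iff, ← h]
  refine iSup₂_le fun μ hμ => ?_
  by_cases h0 : weightSpace H M μ = ⊥
  · rw [h0]; exact bot_le
  · exact le_iSup₂_of_le μ (hJ μ hμ h0) le_rfl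

/-- Weight vectors lift along surjections. -/
theorem WeightsIn.exists_lift {J : Set (Weight H)} {M N : AffineMod 𝔤 A} (h : WeightsIn H J M)
    (f : M ⟶ N) (hf : Function.Surjective f.toLin) {μ : Weight H} {n : N.carrier}
    (hn : n ∈ weightSpace H N μ) : ∃ m ∈ weightSpace H M μ, f.toLin m = n := by
  obtain ⟨m, rfl⟩ := hf n
  exact (separated_weightChar H).exists_mem_of_map_mem (fun t => f.comm (cartanIncl H t))
    (h.ge (Submodule.mem_top (x := m))) hn

variable (H) in
/-- The submodule complementary to a weight space. -/
def weightCompl (M : AffineMod 𝔤 A) (ν : Weight H) : Submodule A M.carrier :=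
  ⨆ μ ∈ ({ν}ᶜ : Set (Weight H)), weightSpace H M μ

theorem WeightsIn.isCompl {J : Set (Weight H)} {M : AffineMod 𝔤 A} (h : WeightsIn H J M)
    (ν : Weight H) : IsCompl (weightSpace H M ν) (weightCompl H M ν) := by
  refine ⟨?_, codisjoint_iff.2 (eq_top_iff.2 ?_)⟩
  · have := (separated_weightChar (A := A) H).disjoint (a := fun h => M.ρ (cartanIncl H h))
      (disjoint_compl_right (a := ({ν} : Set (Weight H))))
    rw [iSup_singleton] at this
    exact this
  · rw [← h]
    refine iSup₂_le fun μ hμ => ?_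
    by_cases hμν : μ = ν
    · rw [hμν]; exact le_sup_left
    · exact le_sup_of_le_right (le_iSup₂_of_le μ hμν le_rfl)

/-- A submodule stable under the affine Borel subalgebra. -/
def BStable (𝔟 : LieSubalgebra ℂ 𝔤) (M : AffineMod 𝔤 A) (N : Submodule A M.carrier) : Prop :=
  ∀ x ∈ affineBorel 𝔟, N ≤ N.comap (M.ρ x)

variable {𝔟 : LieSubalgebra ℂ 𝔤}

theorem BStable.sup {M : AffineMod 𝔤 A} {N N' : Submodule A M.carrier} (h : BStable 𝔟 M N)
    (h' : BStable 𝔟 M N') : BStable 𝔟 M (N ⊔ N') := fun x hx =>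
  sup_le ((h x hx).trans (Submodule.comap_mono le_sup_left))
    ((h' x hx).trans (Submodule.comap_mono le_sup_right))

theorem BStable.iSup {ι : Sort*} {M : AffineMod 𝔤 A} {N : ι → Submodule A M.carrier}
    (h : ∀ i, BStable 𝔟 M (N i)) : BStable 𝔟 M (⨆ i, N i) := fun x hx =>
  iSup_le fun i => (h i x hx).trans (Submodule.comap_mono (le_iSup N i))

variable (𝔟) in
/-- The vectors contained in a finitely generated submodule for the affine Borel subalgebra. -/
def locFin (M : AffineMod 𝔤 A) : Submodule A M.carrier where
  carrier := {m | ∃ N : Submodule A M.carrier, m ∈ N ∧ N.FG ∧ BStable 𝔟 M N}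
  add_mem' := by
    rintro m m' ⟨N, h1, h2, h3⟩ ⟨N', k1, k2, k3⟩
    exact ⟨N ⊔ N', add_mem (Submodule.mem_sup_left h1) (Submodule.mem_sup_right k1), h2.sup k2,
      h3.sup k3⟩
  zero_mem' := ⟨⊥, zero_mem _, Submodule.fg_bot, fun x _ m hm => by
    rw [Submodule.mem_bot] at hm; simp [hm]⟩
  smul_mem' := by
    rintro a m ⟨N, h1, h2, h3⟩
    exact ⟨N, N.smul_mem a h1, h2, h3⟩

theorem exists_fg_bStable_of_forall {M : AffineMod 𝔤 A} {m : M.carrier} {E : Submodule ℂ (Affine 𝔤)}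
    (hE : FiniteDimensional ℂ E) (h : ∀ x ∈ E, M.ρ x m ∈ locFin 𝔟 M) :
    ∃ N : Submodule A M.carrier, (∀ x ∈ E, M.ρ x m ∈ N) ∧ N.FG ∧ BStable 𝔟 M N := by
  classical
  obtain ⟨s, hs⟩ := (Module.finite_def.1 hE).map E.subtype
  rw [Submodule.map_top, Submodule.range_subtype] at hs
  have hsE : ∀ x : s, (x : Affine 𝔤) ∈ E := fun x => hs ▸ Submodule.subset_span x.2
  choose N h1 h2 h3 using fun x : s => h x (hsE x)
  refine ⟨⨆ x, N x, fun x hx => ?_, Submodule.fg_iSup N h2, BStable.iSup h3⟩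
  have : E ≤ M.transporter m (⨆ x, N x) := by
    rw [← hs, Submodule.span_le]
    intro x hx
    exact Submodule.mem_iSup_of_mem ⟨x, hx⟩ (h1 ⟨x, hx⟩)
  exact this hx

variable [FiniteDimensional ℂ 𝔤] [LieAlgebra.IsSimple ℂ 𝔤] [H.IsCartanSubalgebra]

theorem bStable_iff (h𝔟 : IsBorel 𝔟) (hH : H ≤ 𝔟) {M : AffineMod 𝔤 A}
    {N : Submodule A M.carrier} : BStable 𝔟 M N ↔ ∀ β ∈ posCone H 𝔟, ∀ x ∈ affRootSpace H β,
      ∀ m ∈ N, M.ρ x m ∈ N := by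
  constructor
  · intro h β hβ x hx m hm
    exact h x ((mem_affineBorel_iff H h𝔟 hH).2 (affRootSpace_le_rootPart H hβ hx)) hm
  · intro h x hx m hm
    have h1 : rootPart H (posCone H 𝔟) ≤ M.transporter m N :=
      rootPart_induction H fun β hβ x hx => h β hβ x hx m hm
    exact h1 ((mem_affineBorel_iff H h𝔟 hH).1 hx)

/-- Induction on the number of weights of `J` above `μ`. Only finitely many degrees `β` raise `μ`
within `J`, each root space is finite-dimensional, and the raised vectors are covered by the
induction hypothesis, so adjoining `m` itself keeps the subspace finitely generated. -/
theorem weightSpace_le_locFin (h𝔟 : IsBorel 𝔟) (hH : H ≤ 𝔟) {J : Set (Weight H)}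
    (hJ : IsLocallyBounded H 𝔟 J) {M : AffineMod 𝔤 A} (hM : WeightsIn H J M) (n : ℕ) :
    ∀ μ, {γ | γ ∈ J ∧ WeightLE H 𝔟 μ γ}.ncard ≤ n → weightSpace H M μ ≤ locFin 𝔟 M := by
  induction n with
  | zero =>
    intro μ hμ m hm
    rw [nonpos_iff_eq_zero, Set.ncard_eq_zero (hJ μ)] at hμ
    rw [hM.eq_zero (fun hc => (hμ.le ⟨hc, weightLE_refl H μ⟩ : μ ∈ (∅ : Set _))) hm]
    exact zero_mem _
  | succ n ih =>
    intro μ hμ m hm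
    by_cases hμJ : μ ∈ J
    swap
    · rw [hM.eq_zero hμJ hm]; exact zero_mem _
    let B : Set (Weight H) := {β | β ∈ posSet H 𝔟 ∧ β + μ ∈ J}
    have hB : B.Finite := by
      refine Set.Finite.of_finite_image (f := fun β => β + μ) ((hJ μ).subset ?_)
        (fun a _ b _ h => add_right_cancel h)
      rintro _ ⟨β, hβ, rfl⟩
      refine ⟨hβ.2, ?_⟩
      rw [WeightLE, add_sub_cancel_right]; exact hβ.1.1
    have hN : ∀ β : B, ∃ N : Submodule A M.carrier,
        (∀ x ∈ affRootSpace H β.1, M.ρ x m ∈ N) ∧ N.FG ∧ BStable 𝔟 M N := by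
      intro β
      refine exists_fg_bStable_of_forall (finite_affRootSpace H _) fun x hx => ?_
      refine ih (β.1 + μ) ?_ (ρ_mem_weightSpace hx hm)
      have hlt : {γ | γ ∈ J ∧ WeightLE H 𝔟 (β.1 + μ) γ} ⊂ {γ | γ ∈ J ∧ WeightLE H 𝔟 μ γ} := by
        have hle : WeightLE H 𝔟 μ (β.1 + μ) := by
          rw [WeightLE, add_sub_cancel_right]; exact β.2.1.1
        refine ⟨fun γ hγ => ⟨hγ.1, hle.trans hγ.2⟩, fun hc => ?_⟩
        have := (hc ⟨hμJ, weightLE_refl H μ⟩).2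
        exact β.2.1.2 (by simpa using (WeightLE.antisymm H h𝔟 hH hle this).symm)
      have := Set.ncard_lt_ncard hlt (hJ μ)
      omega
    choose N h1 h2 h3 using hN
    have := hB.to_subtype
    refine ⟨Submodule.span A {m} ⊔ ⨆ β, N β, Submodule.mem_sup_left
      (Submodule.mem_span_singleton_self m), (Submodule.fg_span_singleton m).sup
      (Submodule.fg_iSup N h2), (bStable_iff h𝔟 hH).2 fun β hβ x hx w hw => ?_⟩
    obtain ⟨w₁, hw₁, w₂, hw₂, rfl⟩ := Submodule.mem_sup.1 hw
    rw [map_add]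
    refine add_mem ?_ (Submodule.mem_sup_right ((bStable_iff h𝔟 hH).1 (BStable.iSup h3) β hβ x hx
      _ hw₂))
    obtain ⟨a, rfl⟩ := Submodule.mem_span_singleton.1 hw₁
    rw [map_smul]
    refine Submodule.smul_mem _ a ?_
    by_cases hβ0 : β = 0
    · subst hβ0
      rw [affRootSpace_zero] at hx
      obtain ⟨h, rfl⟩ := hx
      rw [(mem_weightSpace H).1 hm h]
      exact Submodule.smul_mem _ _ (Submodule.mem_sup_left (Submodule.mem_span_singleton_self m))
    by_cases hβJ : β + μ ∈ J
    · exact Submodule.mem_sup_right (Submodule.mem_iSup_of_mem ⟨β, ⟨hβ, hβ0⟩, hβJ⟩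
        (h1 ⟨β, ⟨hβ, hβ0⟩, hβJ⟩ x hx))
    · rw [hM.eq_zero hβJ (ρ_mem_weightSpace hx hm)]
      exact zero_mem _

/-- Independence of the weight spaces and local finiteness come for free, so membership becomes a
single condition that passes to quotients. -/
theorem truncO_iff (h𝔟 : IsBorel 𝔟) (hH : H ≤ 𝔟) {J : Set (Weight H)}
    (hJ : IsLocallyBounded H 𝔟 J) {M : AffineMod 𝔤 A} :
    truncO H 𝔟 A J M ↔ WeightsIn H J M := by
  constructor
  · rintro ⟨⟨⟨-, h2⟩, -⟩, h3⟩
    exact iSup_mem_eq_top_of_eigSpace h2 h3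
  · intro h
    refine ⟨⟨(isWeightModule_iff H).2 ?_, fun m => ?_⟩, fun μ hμ => ?_⟩
    · rw [eq_top_iff, ← h]
      exact iSup₂_le fun μ _ => le_iSup _ μ
    · have h1 : (⊤ : Submodule A M.carrier) ≤ locFin 𝔟 M := by
        rw [← h]
        exact iSup₂_le fun μ _ => weightSpace_le_locFin h𝔟 hH hJ h _ μ le_rfl
      exact h1 trivial
    · by_contra hc
      exact hμ (eq_bot_iff.2 fun m hm => h.eq_zero hc hm)

theorem quotClosed_truncO (h𝔟 : IsBorel 𝔟) (hH : H ≤ 𝔟) {J : Set (Weight H)}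
    (hJ : IsLocallyBounded H 𝔟 J) : QuotClosed (truncO H 𝔟 A J) := fun M N f hf hM => by
  rw [truncO_iff h𝔟 hH hJ] at *
  exact hM.of_surjective f hf

/-- This plays the role of `U(𝔤^) = U(𝔫₋) U(𝔟^)`: starting from a `𝔟^`-stable subspace, lowering
operators alone reach the whole submodule it generates. -/
theorem gen_le_of_bStable (h𝔟 : IsBorel 𝔟) (hH : H ≤ 𝔟) {M : AffineMod 𝔤 A}
    {W S : Submodule A M.carrier} (hW : BStable 𝔟 M W) (hWS : W ≤ S)
    (hS : ∀ β ∈ posSet H 𝔟, ∀ x ∈ affRootSpace H (-β), ∀ m ∈ S, M.ρ x m ∈ S) : M.gen W ≤ S := by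
  have hS' : ∀ x ∈ nMinus H h𝔟 hH, ∀ m ∈ S, M.ρ x m ∈ S := by
    intro x hx m hm
    have h1 : rootPart H {β | -β ∈ posSet H 𝔟} ≤ M.transporter m S :=
      rootPart_induction H fun β hβ x hx => hS (-β) hβ x (by rwa [neg_neg]) m hm
    exact h1 hx
  set T : Set (Submodule A M.carrier) :=
    {S | W ≤ S ∧ ∀ x ∈ nMinus H h𝔟 hH, ∀ m ∈ S, M.ρ x m ∈ S} with hT
  have hR : ∀ x ∈ nMinus H h𝔟 hH, ∀ m ∈ sInf T, M.ρ x m ∈ sInf T := fun x hx m hm =>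
    Submodule.mem_sInf.2 fun S hS => hS.2 x hx m (Submodule.mem_sInf.1 hm S hS)
  have hWR : W ≤ sInf T := le_sInf fun S hS => hS.1
  -- The smallest `𝔫₋`-stable subspace containing `W` is stable under everything: the vectors that
  -- the whole algebra keeps inside it contain `W` and are again `𝔫₋`-stable, hence exhaust it.
  let V : Submodule A M.carrier :=
    { carrier := {m | m ∈ sInf T ∧ ∀ y, M.ρ y m ∈ sInf T}
      add_mem' := fun {a b} ha hb => ⟨add_mem ha.1 hb.1, fun y => by
        rw [map_add]; exact add_mem (ha.2 y) (hb.2 y)⟩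
      zero_mem' := ⟨zero_mem _, fun y => by rw [map_zero]; exact zero_mem _⟩
      smul_mem' := fun c a ha => ⟨Submodule.smul_mem _ c ha.1, fun y => by
        rw [map_smul]; exact Submodule.smul_mem _ c (ha.2 y)⟩ }
  have hV : sInf T ≤ V := by
    refine sInf_le ⟨fun w hw => ⟨hWR hw, fun y => ?_⟩, fun x hx m hm => ⟨hR x hx m hm.1, fun y => ?_⟩⟩
    · have : y = projMinus H h𝔟 hH y + projBorel H h𝔟 hH y := by
        rw [projBorel_apply]; abel
      rw [this, map_add, LinearMap.add_apply]
      exact add_mem (hR _ (projMinus H h𝔟 hH y).2 _ (hWR hw))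
        (hWR (hW _ (projBorel H h𝔟 hH y).2 hw))
    · rw [ρ_ρ]
      exact add_mem (hm.2 _) (hR x hx _ (hm.2 y))
  have h1 : M.gen W ≤ sInf T := gen_le hWR fun y m hm => (hV hm).2 y
  exact h1.trans (sInf_le ⟨hWS, hS'⟩)

variable (𝔟) in
/-- A maximal element of a set of weights. -/
def IsMaxWeight (J : Set (Weight H)) (ν : Weight H) : Prop :=
  ∀ γ ∈ J, WeightLE H 𝔟 ν γ → γ = ν

/-- A maximal weight space is contained in every generating subspace stable under the Borel
subalgebra. -/
theorem weightSpace_le_of_gen_eq_top (h𝔟 : IsBorel 𝔟) (hH : H ≤ 𝔟) {J : Set (Weight H)}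
    {M : AffineMod 𝔤 A} (hM : WeightsIn H J M) {ν : Weight H} (hν : IsMaxWeight 𝔟 J ν)
    {N : Submodule A M.carrier} (hN : BStable 𝔟 M N) (hgen : M.gen N = ⊤) :
    weightSpace H M ν ≤ N := by
  have hst : ∀ t, ∀ n ∈ N, M.ρ (cartanIncl H t) n ∈ N := fun t n hn =>
    hN _ (cartanIncl_mem H h𝔟 hH t) hn
  -- By maximality of `ν`, a lowering operator applied to a weight vector never lands in weight `ν`.
  -- So the generated submodule has nothing in weight `ν` beyond what `N` already has.
  have key : M.gen N ≤ (N ⊓ weightSpace H M ν) ⊔ weightCompl H M ν := by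
    refine gen_le_of_bStable h𝔟 hH hN ?_ ?_
    · intro n hn
      have := (separated_weightChar H).exists_sum_of_mem N hst hn
        (hM.ge (Submodule.mem_top (x := n)))
      suffices hle : ⨆ μ ∈ J, N ⊓ weightSpace H M μ ≤
          (N ⊓ weightSpace H M ν) ⊔ weightCompl H M ν from hle this
      refine iSup₂_le fun μ hμ => ?_
      by_cases hμν : μ = ν
      · subst hμν; exact le_sup_left
      · exact le_sup_of_le_right (inf_le_right.trans (le_iSup₂_of_le μ hμν le_rfl))
    · intro β hβ x hx m hm
      have h1 : (⊤ : Submodule A M.carrier) ≤ (weightCompl H M ν).comap (M.ρ x) := by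
        rw [← hM]
        refine iSup₂_le fun μ hμ m hm => ?_
        have h2 := ρ_mem_weightSpace hx hm
        by_cases hμν : -β + μ = ν
        · have h3 : μ = ν := hν μ hμ (by
            rw [WeightLE, ← hμν]; simpa using hβ.1)
          refine absurd ?_ hβ.2
          rw [h3] at hμν
          simpa using hμν
        · exact le_iSup₂_of_le (f := fun μ (_ : μ ∈ ({ν}ᶜ : Set (Weight H))) => weightSpace H M μ)
            _ hμν le_rfl h2
      exact Submodule.mem_sup_right (h1 trivial)
  intro m hm
  rw [hgen] at key
  obtain ⟨a, ha, b, hb, hab⟩ := Submodule.mem_sup.1 (key (Submodule.mem_top (x := m)))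
  have h0 : b = 0 := by
    refine Submodule.disjoint_def.1 (hM.isCompl ν).disjoint b ?_ hb
    have : b = m - a := by rw [← hab]; abel
    rw [this]; exact sub_mem hm ha.2
  rw [← hab, h0, add_zero]
  exact ha.1

/-- On a maximal weight space the Cartan subalgebra acts by scalars, and raising operators act by
zero. -/
theorem bStable_of_isMaxWeight (h𝔟 : IsBorel 𝔟) (hH : H ≤ 𝔟) {J : Set (Weight H)}
    {M : AffineMod 𝔤 A} (hM : WeightsIn H J M) {ν : Weight H} (hν : IsMaxWeight 𝔟 J ν)
    {N : Submodule A M.carrier} (hN : N ≤ weightSpace H M ν) : BStable 𝔟 M N := by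
  rw [bStable_iff h𝔟 hH]
  intro β hβ x hx m hm
  by_cases hβ0 : β = 0
  · subst hβ0
    rw [affRootSpace_zero] at hx
    obtain ⟨h, rfl⟩ := hx
    rw [(mem_weightSpace H).1 (hN hm) h]
    exact N.smul_mem _ hm
  · rw [hM.eq_zero (fun hc => hβ0 ?_) (ρ_mem_weightSpace hx (hN hm))]
    · exact zero_mem _
    · simpa using hν _ hc (by rw [WeightLE, add_sub_cancel_right]; exact hβ)

end Weights
end AffineO
end

noncomputable section
namespace AffineO

/-! ## Construction of projective objects -/

section Complex

variable {𝔤 : Type u} [LieRing 𝔤] [LieAlgebra ℂ 𝔤] {A : Type u} [CommRing A] [Algebra ℂ A]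

/-- The complex vector space underlying a module. -/
@[reducible] def AffineMod.moduleC (M : AffineMod 𝔤 A) : Module ℂ M.carrier :=
  Module.compHom M.carrier (algebraMap ℂ A)

attribute [local instance] AffineMod.moduleC

theorem AffineMod.isScalarTowerC (M : AffineMod 𝔤 A) : IsScalarTower ℂ A M.carrier :=
  ⟨fun c a m => by
    change (c • a) • m = algebraMap ℂ A c • a • m
    rw [Algebra.smul_def, mul_smul]⟩

attribute [local instance] AffineMod.isScalarTowerC

/-- The action as a complex linear map. -/
def AffineMod.ρC (M : AffineMod 𝔤 A) : Affine 𝔤 →ₗ[ℂ] Module.End A M.carrier where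
  toFun x := M.ρ x
  map_add' x y := map_add _ x y
  map_smul' c x := LinearMap.ext fun m => M.smul_ρ c x m

/-- A module over the affine Borel subalgebra with coefficients in `A`. -/
structure BorelMod (𝔟 : LieSubalgebra ℂ 𝔤) (A : Type u) [CommRing A] [Algebra ℂ A] where
  /-- the underlying type -/
  carrier : Type u
  [addCommGroup : AddCommGroup carrier]
  [module : Module A carrier]
  [moduleC : Module ℂ carrier]
  [isScalarTower : IsScalarTower ℂ A carrier]
  /-- the action -/
  σ : affineBorel 𝔟 →ₗ[ℂ] Module.End A carrier
  σ_lie : ∀ x y, σ ⁅x, y⁆ = σ x * σ y - σ y * σ x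

variable (H : LieSubalgebra ℂ 𝔤) [Algebra (SymmetricAlgebra ℂ H) A]
  [IsScalarTower ℂ (SymmetricAlgebra ℂ H) A]

variable (A) in
/-- The character of a weight space as a linear map. -/
def weightCharL (lam : Weight H) : AffineCartan H →ₗ[ℂ] A where
  toFun h := weightChar H A lam h
  map_add' h h' := by
    simp only [weightChar, tau, map_add, Prod.fst_add]; ring
  map_smul' c h := by
    simp only [weightChar, tau, Prod.smul_fst, map_smul, RingHom.id_apply, smul_add, smul_eq_mul,
      map_mul]
    congr 1
    · rw [Algebra.smul_def]
    · rw [Algebra.smul_def, map_mul, Algebra.smul_def c, ← IsScalarTower.algebraMap_apply]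

variable [FiniteDimensional ℂ 𝔤] [LieAlgebra.IsSimple ℂ 𝔤] [H.IsCartanSubalgebra]
  {𝔟 : LieSubalgebra ℂ 𝔤} (h𝔟 : IsBorel 𝔟) (hH : H ≤ 𝔟)

variable (A) in
/-- The action of the Borel subalgebra on the coefficients through the character of a weight. -/
def charAct (𝔟 : LieSubalgebra ℂ 𝔤) (lam : Weight H) : affineBorel 𝔟 →ₗ[ℂ] Module.End A A where
  toFun y := weightCharL A H lam (projCartan H y) • LinearMap.id
  map_add' y y' := by simp [add_smul]
  map_smul' c y := by
    have : projCartan H ((c • y : affineBorel 𝔟) : Affine 𝔤) = c • projCartan H y :=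
      map_smul (projCartan H) c (y : Affine 𝔤)
    rw [this, map_smul, RingHom.id_apply, smul_assoc]

theorem charAct_of_nPlus (lam : Weight H) (x : nPlus H h𝔟 hH) :
    charAct A H 𝔟 lam (LieSubalgebra.inclusion (nPlus_le H h𝔟 hH) x) = 0 := by
  change weightCharL A H lam (projCartan H (x : Affine 𝔤)) • (LinearMap.id : A →ₗ[A] A) = 0
  rw [projCartan_of_mem_nPlus H h𝔟 hH, map_zero, zero_smul]

variable (A) in
/-- The action of the Borel subalgebra on `A ⊗ U(𝔫₊)`. -/
def freeAct (lam : Weight H) :=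
  indAct (A := A) (X := A) (LieSubalgebra.inclusion (nPlus_le H h𝔟 hH)) (projPlus H h𝔟 hH)
    (charAct A H 𝔟 lam)

theorem freeAct_ι (lam : Weight H) (x : nPlus H h𝔟 hH) (z) :
    freeAct A H h𝔟 hH lam z (LieSubalgebra.inclusion (nPlus_le H h𝔟 hH) x) =
      envMul (A := A) (envι x) z :=
  indAct_ι _ _ _ (projPlus_coe H h𝔟 hH) (charAct_of_nPlus H h𝔟 hH lam) x z

theorem lie_eq_zero_of_projPlus_eq_zero {y y' : affineBorel 𝔟} (hy : projPlus H h𝔟 hH y = 0)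
    (hy' : projPlus H h𝔟 hH y' = 0) : ⁅y, y'⁆ = 0 := by
  obtain ⟨h, hh⟩ := exists_of_projPlus_eq_zero H h𝔟 hH hy
  obtain ⟨h', hh'⟩ := exists_of_projPlus_eq_zero H h𝔟 hH hy'
  refine Subtype.ext ?_
  rw [LieSubalgebra.coe_bracket, hh, hh', cartanIncl_lie_cartanIncl]; rfl

variable (A) in
/-- The `𝔟^`-module `U(𝔟^) ⊗_{U(𝔥^)} A_lam`. -/
def freeBorel (lam : Weight H) : BorelMod 𝔟 A where
  carrier := A ⊗[ℂ] UniversalEnvelopingAlgebra ℂ (nPlus H h𝔟 hH)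
  σ :=
    { toFun := fun y =>
        { toFun := fun z => freeAct A H h𝔟 hH lam z y
          map_add' := fun z z' => by rw [map_add]; rfl
          map_smul' := fun a z => by rw [map_smul]; rfl }
      map_add' := fun y y' => LinearMap.ext fun z => map_add (freeAct A H h𝔟 hH lam z) y y'
      map_smul' := fun c y => LinearMap.ext fun z => map_smul (freeAct A H h𝔟 hH lam z) c y }
  σ_lie y y' := LinearMap.ext fun z => by
    refine indAct_lie _ _ _ (projPlus_coe H h𝔟 hH) (charAct_of_nPlus H h𝔟 hH lam) ?_ ?_ y y' z
    · intro y y' hy hy'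
      rw [lie_eq_zero_of_projPlus_eq_zero H h𝔟 hH hy hy', map_zero]
    · intro y y' hy hy'
      rw [lie_eq_zero_of_projPlus_eq_zero H h𝔟 hH hy hy', map_zero]
      refine LinearMap.ext fun a => ?_
      change 0 = weightCharL A H lam (projCartan H y) • weightCharL A H lam (projCartan H y') • a -
        weightCharL A H lam (projCartan H y') • weightCharL A H lam (projCartan H y) • a
      rw [smul_comm, sub_self]

variable {H} in
/-- The element of the Borel subalgebra given by an element of the Cartan subalgebra. -/
def cartanBorel (h : AffineCartan H) : affineBorel 𝔟 := ⟨_, cartanIncl_mem H h𝔟 hH h⟩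

theorem free_eq_top (lam : Weight H)
    (S : Submodule A (A ⊗[ℂ] UniversalEnvelopingAlgebra ℂ (nPlus H h𝔟 hH)))
    (h1 : 1 ⊗ₜ[ℂ] 1 ∈ S) (hS : ∀ x : nPlus H h𝔟 hH, ∀ z ∈ S,
      freeAct A H h𝔟 hH lam z (LieSubalgebra.inclusion (nPlus_le H h𝔟 hH) x) ∈ S) : S = ⊤ := by
  refine ind_eq_top S (fun a => ?_) fun x z hz => ?_
  · have := S.smul_mem a h1
    rwa [TensorProduct.smul_tmul', smul_eq_mul, mul_one] at this
  · rw [← freeAct_ι H h𝔟 hH lam]; exact hS x z hz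

theorem freeAct_cartanBorel (lam : Weight H) (h : AffineCartan H) :
    freeAct A H h𝔟 hH lam (1 ⊗ₜ 1) (cartanBorel h𝔟 hH h) = weightChar H A lam h • (1 ⊗ₜ 1) := by
  have h0 : projPlus H h𝔟 hH (cartanBorel h𝔟 hH h) = 0 := (rootProj_eq_zero_iff H).2
    (affRootSpace_le_rootPart H (S := (posSet H 𝔟)ᶜ)
      (fun h : (0 : Weight H) ∈ posSet H 𝔟 => h.2 rfl) (cartanIncl_mem_affRootSpace H h))
  have h1 : charAct A H 𝔟 lam (cartanBorel h𝔟 hH h) 1 = weightChar H A lam h • 1 := by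
    change weightCharL A H lam (projCartan H (cartanIncl H h)) • (1 : A) = weightChar H A lam h • 1
    rw [projCartan_cartanIncl]; rfl
  rw [freeAct, indAct_one, h0, map_zero, TensorProduct.tmul_zero, zero_add, h1,
    TensorProduct.smul_tmul']

/-- Frobenius reciprocity from the Cartan to the Borel subalgebra: a vector of weight `lam` is the
same as a Cartan-equivariant map from `A_lam`. -/
theorem exists_free_lift (lam : Weight H) (M : AffineMod 𝔤 A) {m : M.carrier}
    (hm : m ∈ weightSpace H M lam) :
    ∃ f : A ⊗[ℂ] UniversalEnvelopingAlgebra ℂ (nPlus H h𝔟 hH) →ₗ[A] M.carrier,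
      f (1 ⊗ₜ 1) = m ∧ ∀ (x : affineBorel 𝔟) z, f (freeAct A H h𝔟 hH lam z x) = M.ρ x (f z) := by
  let ρ : affineBorel 𝔟 →ₗ[ℂ] Module.End A M.carrier :=
    M.ρC ∘ₗ (affineBorel 𝔟).toSubmodule.subtype
  have hρ : ∀ x y, ρ ⁅x, y⁆ = ρ x * ρ y - ρ y * ρ x := fun x y => M.ρ_lie x y
  let ι := LieSubalgebra.inclusion (nPlus_le H h𝔟 hH)
  have hρ' : ∀ x y, (ρ ∘ₗ (ι : nPlus H h𝔟 hH →ₗ[ℂ] affineBorel 𝔟)) ⁅x, y⁆ =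
      (ρ ∘ₗ (ι : nPlus H h𝔟 hH →ₗ[ℂ] affineBorel 𝔟)) x *
      (ρ ∘ₗ (ι : nPlus H h𝔟 hH →ₗ[ℂ] affineBorel 𝔟)) y -
      (ρ ∘ₗ (ι : nPlus H h𝔟 hH →ₗ[ℂ] affineBorel 𝔟)) y *
      (ρ ∘ₗ (ι : nPlus H h𝔟 hH →ₗ[ℂ] affineBorel 𝔟)) x := fun x y => hρ (ι x) (ι y)
  refine ⟨indLift (ρ ∘ₗ (ι : nPlus H h𝔟 hH →ₗ[ℂ] affineBorel 𝔟)) hρ'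
    (LinearMap.toSpanSingleton A M.carrier m), ?_, fun x ξ => ?_⟩
  · rw [indLift_one]; simp
  · refine indLift_indAct _ _ _ (projPlus_coe H h𝔟 hH) (charAct_of_nPlus H h𝔟 hH lam) ρ hρ
      hρ' _ (fun y hy a => ?_) x ξ
    obtain ⟨h, hh⟩ := exists_of_projPlus_eq_zero H h𝔟 hH hy
    change (weightCharL A H lam (projCartan H y) • a) • m = M.ρ y (a • m)
    rw [hh, projCartan_cartanIncl, map_smul, (mem_weightSpace H).1 hm, smul_eq_mul, mul_comm,
      mul_smul]
    rfl

theorem projective_free :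
    Module.Projective A (A ⊗[ℂ] UniversalEnvelopingAlgebra ℂ (nPlus H h𝔟 hH)) := inferInstance

variable (A) in
/-- The generator of `U(𝔟^) ⊗_{U(𝔥^)} A_lam`. -/
def freeGen (lam : Weight H) : (freeBorel A H h𝔟 hH lam).carrier :=
  ((1 : A) ⊗ₜ[ℂ] 1 : A ⊗[ℂ] UniversalEnvelopingAlgebra ℂ (nPlus H h𝔟 hH))

attribute [local instance] BorelMod.addCommGroup BorelMod.module BorelMod.moduleC
  BorelMod.isScalarTower

/-- The weight spaces of a module over the Borel subalgebra. -/
def BorelMod.weightSpace (X : BorelMod 𝔟 A) (μ : Weight H) : Submodule A X.carrier :=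
  eigSpace (fun h => X.σ (cartanBorel h𝔟 hH h)) (weightChar H A μ)

theorem BorelMod.σ_mem_weightSpace (X : BorelMod 𝔟 A) {β μ : Weight H} {x : affineBorel 𝔟}
    (hx : (x : Affine 𝔤) ∈ affRootSpace H β) {ξ : X.carrier} (hξ : ξ ∈ X.weightSpace H h𝔟 hH μ) :
    X.σ x ξ ∈ X.weightSpace H h𝔟 hH (β + μ) := by
  rw [weightSpace, mem_eigSpace] at *
  intro h
  have h1 : ⁅cartanBorel h𝔟 hH h, x⁆ = β h • x := Subtype.ext (mem_affRootSpace.1 hx h)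
  have h2 := LinearMap.congr_fun (X.σ_lie (cartanBorel h𝔟 hH h) x) ξ
  rw [h1, map_smul, LinearMap.sub_apply, Module.End.mul_apply, Module.End.mul_apply, hξ,
    map_smul, eq_sub_iff_add_eq] at h2
  rw [← h2, LinearMap.smul_apply, ← algebraMap_smul A (β h), ← add_smul, weightChar, weightChar,
    LinearMap.add_apply, map_add, add_assoc]

/-- The subspace of a module over the Borel subalgebra on which elements of a sum of root spaces
act into a given submodule. -/
theorem BorelMod.forall_of_rootPart (X : BorelMod 𝔟 A) {S : Set (Weight H)}
    (hS : ∀ β ∈ S, affRootSpace H β ≤ (affineBorel 𝔟).toSubmodule) (N N' : Submodule A X.carrier)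
    (h : ∀ β ∈ S, ∀ x : affineBorel 𝔟, (x : Affine 𝔤) ∈ affRootSpace H β → ∀ ξ ∈ N, X.σ x ξ ∈ N')
    (x : affineBorel 𝔟) (hx : (x : Affine 𝔤) ∈ rootPart H S) (ξ : X.carrier) (hξ : ξ ∈ N) :
    X.σ x ξ ∈ N' := by
  let T : Submodule ℂ (affineBorel 𝔟) :=
    { carrier := {x | X.σ x ξ ∈ N'}
      add_mem' := fun {x y} hx hy => by
        change X.σ (x + y) ξ ∈ N'
        rw [map_add]; exact N'.add_mem hx hy
      zero_mem' := by
        change X.σ 0 ξ ∈ N'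
        rw [map_zero]; exact N'.zero_mem
      smul_mem' := fun c x hx => by
        change X.σ (c • x) ξ ∈ N'
        rw [map_smul, LinearMap.smul_apply, ← algebraMap_smul A c]; exact N'.smul_mem _ hx }
  have h1 : rootPart H S ≤ T.map (affineBorel 𝔟).toSubmodule.subtype :=
    rootPart_induction H fun β hβ y hy => ⟨⟨y, hS β hβ hy⟩, h β hβ ⟨y, hS β hβ hy⟩ hy ξ hξ, rfl⟩
  obtain ⟨y, hy, hyx⟩ := h1 hx
  rwa [← Subtype.ext hyx]

theorem affRootSpace_le_affineBorel (h𝔟 : IsBorel 𝔟) (hH : H ≤ 𝔟) {β : Weight H} (hβ : β ∈ posCone H 𝔟) :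
    affRootSpace H β ≤ (affineBorel 𝔟).toSubmodule := fun _ hx =>
  (mem_affineBorel_iff H h𝔟 hH).2 (affRootSpace_le_rootPart H (SetLike.mem_coe.2 hβ) hx)

variable (A) in
-- Records what is used of `A ⊗ U(𝔫₊)` and forgets the tensor product. It is a weight module because
-- its generator is a weight vector and `𝔫₊` preserves the sum of the weight spaces.
theorem exists_borelMod_free (lam : Weight H) : ∃ (X : BorelMod 𝔟 A) (ξ₀ : X.carrier),
    Module.Projective A X.carrier ∧ ⨆ μ, X.weightSpace H h𝔟 hH μ = ⊤ ∧
    ξ₀ ∈ X.weightSpace H h𝔟 hH lam ∧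
    (∀ S : Submodule A X.carrier, ξ₀ ∈ S → (∀ x, ∀ ξ ∈ S, X.σ x ξ ∈ S) → S = ⊤) ∧
    ∀ (M : AffineMod 𝔤 A), ∀ m ∈ weightSpace H M lam, ∃ f : X.carrier →ₗ[A] M.carrier,
      f ξ₀ = m ∧ ∀ x ξ, f (X.σ x ξ) = M.ρ x (f ξ) := by
  have hξ : freeGen A H h𝔟 hH lam ∈
      BorelMod.weightSpace H h𝔟 hH (freeBorel A H h𝔟 hH lam) lam :=
    mem_eigSpace.2 (freeAct_cartanBorel H h𝔟 hH lam)
  have hgen : ∀ S : Submodule A (freeBorel A H h𝔟 hH lam).carrier, freeGen A H h𝔟 hH lam ∈ S →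
      (∀ x : nPlus H h𝔟 hH, ∀ ξ ∈ S, (freeBorel A H h𝔟 hH lam).σ
        (LieSubalgebra.inclusion (nPlus_le H h𝔟 hH) x) ξ ∈ S) → S = ⊤ :=
    fun S h1 hS => free_eq_top H h𝔟 hH lam S h1 hS
  refine ⟨freeBorel A H h𝔟 hH lam, freeGen A H h𝔟 hH lam, projective_free H h𝔟 hH, ?_,
    hξ, fun S h1 hS => hgen S h1 fun x ξ hξ => hS _ ξ hξ,
    fun M m hm => exists_free_lift H h𝔟 hH lam M hm⟩
  refine hgen _ (Submodule.mem_iSup_of_mem lam hξ) fun x ξ hξ => ?_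
  refine BorelMod.forall_of_rootPart H (freeBorel A H h𝔟 hH lam) (S := posSet H 𝔟)
    (fun β hβ => affRootSpace_le_affineBorel H h𝔟 hH hβ.1) _ _ ?_
    (LieSubalgebra.inclusion (nPlus_le H h𝔟 hH) x) x.2 ξ hξ
  intro β hβ y hy ξ hξ
  have h2 : ⨆ μ, (freeBorel A H h𝔟 hH lam).weightSpace H h𝔟 hH μ ≤
      (⨆ μ, (freeBorel A H h𝔟 hH lam).weightSpace H h𝔟 hH μ).comap
        ((freeBorel A H h𝔟 hH lam).σ y) := iSup_le fun μ ξ hξ =>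
    Submodule.mem_iSup_of_mem (β + μ) (BorelMod.σ_mem_weightSpace H h𝔟 hH _ hy hξ)
  exact h2 hξ

end Complex
end AffineO
end

noncomputable section
namespace AffineO

/-! ### Cutting a Borel module down to the weights in `J` -/

section Truncation

variable {𝔤 : Type u} [LieRing 𝔤] [LieAlgebra ℂ 𝔤] {A : Type u} [CommRing A] [Algebra ℂ A]

attribute [local instance] AffineMod.moduleC AffineMod.isScalarTowerC BorelMod.addCommGroup
  BorelMod.module BorelMod.moduleC BorelMod.isScalarTower

theorem projective_of_isCompl {V : Type*} [AddCommGroup V] [Module A V] [Module.Projective A V]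
    {K K' : Submodule A V} (h : IsCompl K K') : Module.Projective A K :=
  Module.Projective.of_split K.subtype (Submodule.projectionOnto K K' h)
    (LinearMap.ext fun x => Submodule.projectionOnto_apply_left h x)

/-- The quotient of a module over the Borel subalgebra. -/
def BorelMod.quot {𝔟 : LieSubalgebra ℂ 𝔤} (X : BorelMod 𝔟 A) (K : Submodule A X.carrier)
    (hK : ∀ x, K ≤ K.comap (X.σ x)) : BorelMod 𝔟 A where
  carrier := X.carrier ⧸ K
  σ :=
    { toFun := fun x => K.mapQ K (X.σ x) (hK x)
      map_add' := fun x y => by ext; simp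
      map_smul' := fun c x => by ext; simp }
  σ_lie x y := by ext; simp [X.σ_lie]

variable (H : LieSubalgebra ℂ 𝔤) [Algebra (SymmetricAlgebra ℂ H) A]
  [IsScalarTower ℂ (SymmetricAlgebra ℂ H) A]
  [FiniteDimensional ℂ 𝔤] [LieAlgebra.IsSimple ℂ 𝔤] [H.IsCartanSubalgebra]
  {𝔟 : LieSubalgebra ℂ 𝔤} (h𝔟 : IsBorel 𝔟) (hH : H ≤ 𝔟)

variable (A) in
/-- The largest quotient of `U(𝔟^) ⊗_{U(𝔥^)} A_lam` with weights in `J`. -/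
theorem exists_borelMod_trunc {J : Set (Weight H)} (hJ : IsOpenWeights H 𝔟 J) (lam : Weight H) :
    ∃ (X : BorelMod 𝔟 A) (ξ₀ : X.carrier),
    Module.Projective A X.carrier ∧ ⨆ μ ∈ J, X.weightSpace H h𝔟 hH μ = ⊤ ∧
    ξ₀ ∈ X.weightSpace H h𝔟 hH lam ∧
    (∀ S : Submodule A X.carrier, ξ₀ ∈ S → (∀ x, ∀ ξ ∈ S, X.σ x ξ ∈ S) → S = ⊤) ∧
    ∀ (M : AffineMod 𝔤 A), WeightsIn H J M → ∀ m ∈ weightSpace H M lam,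
      ∃ f : X.carrier →ₗ[A] M.carrier, f ξ₀ = m ∧ ∀ x ξ, f (X.σ x ξ) = M.ρ x (f ξ) := by
  obtain ⟨X, ξ₀, hX, hw, hξ, hgen, hlift⟩ := exists_borelMod_free A H h𝔟 hH lam
  let K := ⨆ μ ∈ Jᶜ, X.weightSpace H h𝔟 hH μ
  -- The Borel subalgebra only raises weights, and the complement of an open set is closed under
  -- raising.
  have hK : ∀ x, K ≤ K.comap (X.σ x) := fun x ξ hξ => by
    refine BorelMod.forall_of_rootPart H X (S := posCone H 𝔟)
      (fun β hβ => affRootSpace_le_affineBorel H h𝔟 hH hβ) K K ?_ x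
      ((mem_affineBorel_iff H h𝔟 hH).1 x.2) ξ hξ
    intro β hβ y hy ξ hξ
    have h2 : K ≤ K.comap (X.σ y) := iSup₂_le fun μ hμ ξ hξ =>
      Submodule.mem_iSup_of_mem (β + μ) (Submodule.mem_iSup_of_mem (fun hc => hμ (hJ _ hc μ (by
        rw [WeightLE, add_sub_cancel_right]; exact hβ))) (X.σ_mem_weightSpace H h𝔟 hH hy hξ))
    exact h2 hξ
  -- An `A`-linear complement suffices to keep the quotient projective over `A`.
  have hcompl : IsCompl (⨆ μ ∈ J, X.weightSpace H h𝔟 hH μ) K := by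
    refine ⟨(separated_weightChar (A := A) H).disjoint disjoint_compl_right,
      codisjoint_iff.2 (eq_top_iff.2 ?_)⟩
    rw [← hw]
    refine iSup_le fun μ => ?_
    by_cases hμ : μ ∈ J
    · exact le_sup_of_le_left (le_iSup₂_of_le μ hμ le_rfl)
    · exact le_sup_of_le_right (le_iSup₂_of_le μ hμ le_rfl)
  let mk : X.carrier →ₗ[A] (X.quot K hK).carrier := K.mkQ
  have hmk : ∀ t (ξ : X.carrier), mk (X.σ (cartanBorel h𝔟 hH t) ξ) =
      (X.quot K hK).σ (cartanBorel h𝔟 hH t) (mk ξ) := fun _ _ => rfl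
  refine ⟨X.quot K hK, mk ξ₀, ?_, ?_, map_mem_eigSpace hmk hξ, ?_, ?_⟩
  · have := projective_of_isCompl hcompl
    exact Module.Projective.of_equiv (Submodule.quotientEquivOfIsCompl K _ hcompl.symm).symm
  · have h1 : (⊤ : Submodule A X.carrier) ≤
        (⨆ μ ∈ J, (X.quot K hK).weightSpace H h𝔟 hH μ).comap mk := by
      rw [← hw]
      refine iSup_le fun μ ξ hξ => ?_
      by_cases hμ : μ ∈ J
      · exact Submodule.mem_iSup_of_mem μ (Submodule.mem_iSup_of_mem hμ (map_mem_eigSpace hmk hξ))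
      · have h0 : mk ξ = 0 := (Submodule.Quotient.mk_eq_zero K).2
          (Submodule.mem_iSup_of_mem μ (Submodule.mem_iSup_of_mem hμ hξ))
        rw [Submodule.mem_comap, h0]
        exact zero_mem _
    rw [eq_top_iff]
    intro z _
    obtain ⟨ξ, rfl⟩ := K.mkQ_surjective z
    exact h1 trivial
  · intro S h1 hS
    have h2 := hgen (S.comap mk) h1 fun x ξ hξ => hS x _ hξ
    rw [eq_top_iff]
    intro z _
    obtain ⟨ξ, rfl⟩ := K.mkQ_surjective z
    exact h2.ge (Submodule.mem_top (x := ξ))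
  · intro M hM m hm
    obtain ⟨f, hf, hf'⟩ := hlift M m hm
    have hKf : K ≤ LinearMap.ker f := iSup₂_le fun μ hμ ξ hξ => hM.eq_zero hμ
      (map_mem_eigSpace (a' := fun h => M.ρ (cartanIncl H h))
        (fun t ξ => hf' (cartanBorel h𝔟 hH t) ξ) hξ)
    refine ⟨K.liftQ f hKf, hf, fun x ξ => ?_⟩
    obtain ⟨ξ, rfl⟩ := K.mkQ_surjective ξ
    exact hf' x ξ

end Truncation

/-! ### Induction from the affine Borel subalgebra -/

section Induced

variable {𝔤 : Type u} [LieRing 𝔤] [LieAlgebra ℂ 𝔤] {A : Type u} [CommRing A] [Algebra ℂ A]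
  (H : LieSubalgebra ℂ 𝔤)
  [FiniteDimensional ℂ 𝔤] [LieAlgebra.IsSimple ℂ 𝔤] [H.IsCartanSubalgebra]
  {𝔟 : LieSubalgebra ℂ 𝔤} (h𝔟 : IsBorel 𝔟) (hH : H ≤ 𝔟)
  {X : Type u} [AddCommGroup X] [Module A X] [Module ℂ X] [IsScalarTower ℂ A X]
  (σ : affineBorel 𝔟 →ₗ[ℂ] Module.End A X) (hσ : ∀ x y, σ ⁅x, y⁆ = σ x * σ y - σ y * σ x)

/-- The action of the affine algebra on an induced module. -/
def inducedAct := indAct (A := A) (X := X) (nMinus H h𝔟 hH).incl (projMinus H h𝔟 hH)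
    (σ ∘ₗ projBorel H h𝔟 hH)

theorem inducedAct_ι (x : nMinus H h𝔟 hH) (z) :
    inducedAct H h𝔟 hH σ z x = envMul (A := A) (envι x) z :=
  indAct_ι _ _ _ (projMinus_coe H h𝔟 hH) (fun x => by
    rw [LinearMap.comp_apply, LieSubalgebra.coe_incl, projBorel_of_mem_nMinus, map_zero]) x z

theorem inducedAct_one (ξ : X) (y : affineBorel 𝔟) :
    inducedAct H h𝔟 hH σ (ξ ⊗ₜ 1) y = σ y ξ ⊗ₜ 1 := by
  rw [inducedAct, indAct_one, (projMinus_eq_zero_iff H h𝔟 hH).2 y.2, LinearMap.comp_apply,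
    projBorel_coe, map_zero, TensorProduct.tmul_zero, zero_add]

include hσ in
theorem inducedAct_lie (x y : Affine 𝔤) (z : X ⊗[ℂ] UniversalEnvelopingAlgebra ℂ (nMinus H h𝔟 hH)) :
    inducedAct H h𝔟 hH σ z ⁅x, y⁆ = inducedAct H h𝔟 hH σ (inducedAct H h𝔟 hH σ z y) x -
      inducedAct H h𝔟 hH σ (inducedAct H h𝔟 hH σ z x) y := by
  refine indAct_lie _ _ _ (projMinus_coe H h𝔟 hH) (fun x => by
    rw [LinearMap.comp_apply, LieSubalgebra.coe_incl, projBorel_of_mem_nMinus, map_zero])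
    (fun y y' hy hy' => ?_) (fun y y' hy hy' => ?_) x y z
  · rw [projMinus_eq_zero_iff] at *
    exact (affineBorel 𝔟).lie_mem hy hy'
  · rw [projMinus_eq_zero_iff] at *
    have h1 := projBorel_coe H h𝔟 hH ⟨y, hy⟩
    have h2 := projBorel_coe H h𝔟 hH ⟨y', hy'⟩
    have h3 := projBorel_coe H h𝔟 hH ⁅(⟨y, hy⟩ : affineBorel 𝔟), ⟨y', hy'⟩⁆
    rw [LieSubalgebra.coe_bracket] at h3
    simp only [LinearMap.comp_apply] at *
    rw [h1, h2, h3, hσ]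

/-- The induced module. -/
def induced : AffineMod 𝔤 A where
  carrier := X ⊗[ℂ] UniversalEnvelopingAlgebra ℂ (nMinus H h𝔟 hH)
  ρ :=
    { toFun := fun y =>
        { toFun := fun z => inducedAct H h𝔟 hH σ z y
          map_add' := fun z z' => by rw [map_add]; rfl
          map_smul' := fun a z => by rw [map_smul]; rfl }
      map_add' := fun y y' => LinearMap.ext fun z => map_add (inducedAct H h𝔟 hH σ z) y y'
      map_smul' := fun c y => LinearMap.ext fun z =>
        (map_smul (inducedAct H h𝔟 hH σ z) c y).trans (algebraMap_smul A c _).symm }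
  ρ_lie x y := LinearMap.ext fun z => inducedAct_lie H h𝔟 hH σ hσ x y z

attribute [local instance] AffineMod.moduleC AffineMod.isScalarTowerC

theorem exists_induced_lift (M : AffineMod 𝔤 A) (f : X →ₗ[A] M.carrier)
    (hf : ∀ (x : affineBorel 𝔟) ξ, f (σ x ξ) = M.ρ x (f ξ)) :
    ∃ F : X ⊗[ℂ] UniversalEnvelopingAlgebra ℂ (nMinus H h𝔟 hH) →ₗ[A] M.carrier,
      (∀ ξ, F (ξ ⊗ₜ 1) = f ξ) ∧ ∀ y z, F (inducedAct H h𝔟 hH σ z y) = M.ρ y (F z) := by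
  have hρ' : ∀ x y, (M.ρC ∘ₗ ((nMinus H h𝔟 hH).incl : nMinus H h𝔟 hH →ₗ[ℂ] Affine 𝔤)) ⁅x, y⁆ =
      (M.ρC ∘ₗ ((nMinus H h𝔟 hH).incl : nMinus H h𝔟 hH →ₗ[ℂ] Affine 𝔤)) x *
      (M.ρC ∘ₗ ((nMinus H h𝔟 hH).incl : nMinus H h𝔟 hH →ₗ[ℂ] Affine 𝔤)) y -
      (M.ρC ∘ₗ ((nMinus H h𝔟 hH).incl : nMinus H h𝔟 hH →ₗ[ℂ] Affine 𝔤)) y *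
      (M.ρC ∘ₗ ((nMinus H h𝔟 hH).incl : nMinus H h𝔟 hH →ₗ[ℂ] Affine 𝔤)) x :=
    fun x y => M.ρ_lie x y
  refine ⟨indLift (M.ρC ∘ₗ ((nMinus H h𝔟 hH).incl : nMinus H h𝔟 hH →ₗ[ℂ] Affine 𝔤)) hρ' f,
    fun ξ => indLift_one _ _ _ _, fun y z => ?_⟩
  refine indLift_indAct _ _ _ (projMinus_coe H h𝔟 hH) (fun x => by
    rw [LinearMap.comp_apply, LieSubalgebra.coe_incl, projBorel_of_mem_nMinus, map_zero]) M.ρC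
    (fun x y => M.ρ_lie x y) hρ' f (fun y hy ξ => ?_) y z
  rw [projMinus_eq_zero_iff] at hy
  have h1 := projBorel_coe H h𝔟 hH ⟨y, hy⟩
  simp only [LinearMap.comp_apply] at *
  rw [h1]
  exact hf ⟨y, hy⟩ ξ

/-- Every linear map on the generators of an induced module extends to a map commuting with
`𝔫₋`. -/
theorem exists_induced_extension
    (f : X →ₗ[A] X ⊗[ℂ] UniversalEnvelopingAlgebra ℂ (nMinus H h𝔟 hH)) :
    ∃ F : X ⊗[ℂ] UniversalEnvelopingAlgebra ℂ (nMinus H h𝔟 hH) →ₗ[A]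
        X ⊗[ℂ] UniversalEnvelopingAlgebra ℂ (nMinus H h𝔟 hH),
      (∀ ξ, F (ξ ⊗ₜ 1) = f ξ) ∧ ∀ (y : nMinus H h𝔟 hH) z, F (inducedAct H h𝔟 hH σ z y) =
        inducedAct H h𝔟 hH σ (F z) y := by
  have hρ : ∀ x y : nMinus H h𝔟 hH, (envMul (A := A) (X := X) ∘ₗ envι) ⁅x, y⁆ =
      (envMul (A := A) (X := X) ∘ₗ envι) x * (envMul (A := A) (X := X) ∘ₗ envι) y -
      (envMul (A := A) (X := X) ∘ₗ envι) y * (envMul (A := A) (X := X) ∘ₗ envι) x := by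
    intro x y
    refine LinearMap.ext fun z => ?_
    simp only [LinearMap.comp_apply, envι_lie, map_sub, LinearMap.sub_apply,
      Module.End.mul_apply, envMul_mul]
  refine ⟨indLift (envMul (A := A) (X := X) ∘ₗ envι) hρ f, fun ξ => indLift_one _ _ _ _,
    fun y z => ?_⟩
  rw [inducedAct_ι, inducedAct_ι, indLift_mul]
  rfl

theorem induced_eq_top (S : Submodule A (X ⊗[ℂ] UniversalEnvelopingAlgebra ℂ (nMinus H h𝔟 hH)))
    (h1 : ∀ ξ : X, ξ ⊗ₜ 1 ∈ S) (hS : ∀ (x : nMinus H h𝔟 hH), ∀ z ∈ S,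
      inducedAct H h𝔟 hH σ z x ∈ S) : S = ⊤ := by
  refine ind_eq_top S h1 fun x z hz => ?_
  rw [← inducedAct_ι H h𝔟 hH σ]
  exact hS x z hz

theorem projective_induced [Module.Projective A X] :
    Module.Projective A (X ⊗[ℂ] UniversalEnvelopingAlgebra ℂ (nMinus H h𝔟 hH)) := inferInstance

end Induced

/-! ### The object representing a weight space on the truncated category -/

section ProjectiveObject

variable {𝔤 : Type u} [LieRing 𝔤] [LieAlgebra ℂ 𝔤] (A : Type u) [CommRing A] [Algebra ℂ A]
  (H : LieSubalgebra ℂ 𝔤) [Algebra (SymmetricAlgebra ℂ H) A]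
  [IsScalarTower ℂ (SymmetricAlgebra ℂ H) A]
  [FiniteDimensional ℂ 𝔤] [LieAlgebra.IsSimple ℂ 𝔤] [H.IsCartanSubalgebra]
  {𝔟 : LieSubalgebra ℂ 𝔤} (h𝔟 : IsBorel 𝔟) (hH : H ≤ 𝔟)

attribute [local instance] BorelMod.addCommGroup BorelMod.module BorelMod.moduleC
  BorelMod.isScalarTower

/-- The module representing the functor of vectors of weight `lam` on the truncated category. -/
theorem exists_representing {J : Set (Weight H)} (hJ : IsOpenWeights H 𝔟 J) (lam : Weight H) :
    ∃ (Q : AffineMod 𝔤 A) (v : Q.carrier), Module.Projective A Q.carrier ∧ WeightsIn H J Q ∧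
      v ∈ weightSpace H Q lam ∧ Q.gen (Submodule.span A {v}) = ⊤ ∧
      (∀ M, WeightsIn H J M → ∀ m ∈ weightSpace H M lam, ∃ f : Q ⟶ M, f.toLin v = m) ∧
      ∃ N₀ : Submodule A Q.carrier, BStable 𝔟 Q N₀ ∧ v ∈ N₀ ∧
        ∀ f : Q.carrier →ₗ[A] Q.carrier, ∃ F : Q.carrier →ₗ[A] Q.carrier, (∀ z ∈ N₀, F z = f z) ∧
          ∀ y ∈ nMinus H h𝔟 hH, ∀ z, F (Q.ρ y z) = Q.ρ y (F z) := by
  obtain ⟨X, ξ₀, hX, hw, hξ, hgen, hlift⟩ := exists_borelMod_trunc A H h𝔟 hH hJ lam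
  let Q : AffineMod 𝔤 A := induced H h𝔟 hH X.σ X.σ_lie
  let i : X.carrier →ₗ[A] Q.carrier :=
    { toFun := fun ξ => (ξ ⊗ₜ[ℂ] (1 : UniversalEnvelopingAlgebra ℂ (nMinus H h𝔟 hH)) :
        X.carrier ⊗[ℂ] UniversalEnvelopingAlgebra ℂ (nMinus H h𝔟 hH))
      map_add' := fun ξ ξ' => TensorProduct.add_tmul _ _ _
      map_smul' := fun a ξ => (TensorProduct.smul_tmul' a ξ
        (1 : UniversalEnvelopingAlgebra ℂ (nMinus H h𝔟 hH))).symm }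
  have hi : ∀ (y : affineBorel 𝔟) ξ, Q.ρ y (i ξ) = i (X.σ y ξ) := fun y ξ =>
    inducedAct_one H h𝔟 hH X.σ ξ y
  have htop : ∀ S : Submodule A Q.carrier, (∀ ξ, i ξ ∈ S) →
      (∀ y ∈ nMinus H h𝔟 hH, ∀ z ∈ S, Q.ρ y z ∈ S) → S = ⊤ := fun S h1 hS =>
    induced_eq_top H h𝔟 hH X.σ S h1 fun y z hz => hS y y.2 z hz
  have hiw : ∀ μ, ∀ ξ ∈ X.weightSpace H h𝔟 hH μ, i ξ ∈ weightSpace H Q μ := fun μ ξ hξ =>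
    map_mem_eigSpace (a' := fun h => Q.ρ (cartanIncl H h))
      (fun t ξ => (hi (cartanBorel h𝔟 hH t) ξ).symm) hξ
  refine ⟨Q, i ξ₀, projective_induced H h𝔟 hH, ?_, hiw _ _ hξ, ?_, ?_, LinearMap.range i, ?_,
    ⟨ξ₀, rfl⟩, ?_⟩
  · refine htop _ (fun ξ => ?_) fun y hy z hz => ?_
    · have h1 : (⊤ : Submodule A X.carrier) ≤ (⨆ μ ∈ J, weightSpace H Q μ).comap i := by
        rw [← hw]
        exact iSup₂_le fun μ hμ ξ hξ =>
          Submodule.mem_iSup_of_mem μ (Submodule.mem_iSup_of_mem hμ (hiw μ ξ hξ))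
      exact h1 trivial
    -- Inducing along `𝔫₋` only lowers weights, and `J` is open, so no second truncation is needed.
    · have h1 : rootPart H {β | -β ∈ posSet H 𝔟} ≤
          Q.transporter z (⨆ μ ∈ J, weightSpace H Q μ) := by
        refine rootPart_induction H fun β hβ x hx => ?_
        have h2 : (⨆ μ ∈ J, weightSpace H Q μ) ≤ (⨆ μ ∈ J, weightSpace H Q μ).comap (Q.ρ x) :=
          iSup₂_le fun μ hμ z hz => Submodule.mem_iSup_of_mem (β + μ) (Submodule.mem_iSup_of_mem
            (hJ μ hμ _ (by
              have h3 : μ - (β + μ) = -β := by abel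
              rw [WeightLE, h3]; exact hβ.1)) (ρ_mem_weightSpace hx hz))
        exact h2 hz
      exact h1 hy
  · refine htop _ (fun ξ => ?_) fun y _ z hz => Q.isStable_gen _ y hz
    have h1 := hgen ((Q.gen (Submodule.span A {i ξ₀})).comap i)
      (Q.le_gen _ (Submodule.mem_span_singleton_self _)) fun x ξ hξ => by
        rw [Submodule.mem_comap, ← hi]
        exact Q.isStable_gen _ _ hξ
    exact h1.ge (Submodule.mem_top (x := ξ))
  · intro M hM m hm
    obtain ⟨f, hf, hf'⟩ := hlift M hM m hm
    obtain ⟨F, hF, hF'⟩ := exists_induced_lift H h𝔟 hH X.σ M f hf'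
    exact ⟨⟨F, hF'⟩, (hF ξ₀).trans hf⟩
  · rintro x hx _ ⟨ξ, rfl⟩
    exact ⟨X.σ ⟨x, hx⟩ ξ, (hi ⟨x, hx⟩ ξ).symm⟩
  · intro f
    obtain ⟨F, hF, hF'⟩ := exists_induced_extension H h𝔟 hH X.σ (f ∘ₗ i)
    refine ⟨F, ?_, fun y hy z => hF' ⟨y, hy⟩ z⟩
    rintro _ ⟨ξ, rfl⟩
    exact hF ξ

end ProjectiveObject
end AffineO
end

noncomputable section
namespace AffineO

/-! ## The simple objects -/

section Simple

variable {𝔤 : Type u} [LieRing 𝔤] [LieAlgebra ℂ 𝔤] (H : LieSubalgebra ℂ 𝔤)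
  {A : Type u} [CommRing A] [Algebra ℂ A] [Algebra (SymmetricAlgebra ℂ H) A]
  [FiniteDimensional ℂ 𝔤] [LieAlgebra.IsSimple ℂ 𝔤] [H.IsCartanSubalgebra]
  {𝔟 : LieSubalgebra ℂ 𝔤} (h𝔟 : IsBorel 𝔟) (hH : H ≤ 𝔟)

open AffineMod

include h𝔟 hH in
theorem weightsIn_of_gen_eq_top {M : AffineMod 𝔤 A} {J : Set (Weight H)}
    (hJ : IsOpenWeights H 𝔟 J) {W : Submodule A M.carrier} (hW : BStable 𝔟 M W)
    (hWJ : W ≤ ⨆ μ ∈ J, weightSpace H M μ) (hgen : M.gen W = ⊤) : WeightsIn H J M := by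
  rw [WeightsIn, eq_top_iff, ← hgen]
  refine gen_le_of_bStable h𝔟 hH hW hWJ fun β hβ x hx m hm => ?_
  have h2 : (⨆ μ ∈ J, weightSpace H M μ) ≤ (⨆ μ ∈ J, weightSpace H M μ).comap (M.ρ x) :=
    iSup₂_le fun μ hμ z hz => Submodule.mem_iSup_of_mem (-β + μ) (Submodule.mem_iSup_of_mem
      (hJ μ hμ _ (by
        have h3 : μ - (-β + μ) = β := by abel
        rw [WeightLE, h3]; exact hβ.1)) (ρ_mem_weightSpace hx hz))
  exact h2 hm

variable (𝔟) in
/-- The weights below a given weight. -/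
def lowerWeights (lam : Weight H) : Set (Weight H) := {μ | WeightLE H 𝔟 μ lam}

theorem isOpenWeights_lowerWeights (lam : Weight H) :
    IsOpenWeights H 𝔟 (lowerWeights H 𝔟 lam) := fun _ hγ _ hμ => hμ.trans hγ

variable (𝔟 A) in
/-- The generator of a Verma module. -/
def vermaGen (lam : Weight H) : (verma H 𝔟 A lam).carrier :=
  Submodule.Quotient.mk (p := (vermaIdeal H 𝔟 A lam).restrictScalars A)
    ((1 : A) ⊗ₜ[ℂ] (1 : UniversalEnvelopingAlgebra ℂ (Affine 𝔤)))

theorem regularMod_eq_top (S : Submodule A (A ⊗[ℂ] UniversalEnvelopingAlgebra ℂ (Affine 𝔤)))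
    (h1 : 1 ⊗ₜ[ℂ] 1 ∈ S) (hS : ∀ x, ∀ z ∈ S, (regularMod 𝔤 A).ρ x z ∈ S) : S = ⊤ := by
  refine ind_eq_top S (fun a => ?_) fun x z hz => ?_
  · have := S.smul_mem a h1
    rwa [TensorProduct.smul_tmul', smul_eq_mul, mul_one] at this
  · have h2 : ∀ z : A ⊗[ℂ] UniversalEnvelopingAlgebra ℂ (Affine 𝔤),
        envMul (A := A) (envι x) z = (1 ⊗ₜ[ℂ] envι x) * z := by
      intro z
      induction z with
      | zero => simp
      | add a b ha hb => rw [map_add, mul_add, ha, hb]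
      | tmul ξ w => simp
    rw [h2]
    exact hS x z hz

theorem gen_vermaGen (lam : Weight H) :
    (verma H 𝔟 A lam).gen (Submodule.span A {vermaGen H A 𝔟 lam}) = ⊤ := by
  have h1 := regularMod_eq_top (((verma H 𝔟 A lam).gen (Submodule.span A {vermaGen H A 𝔟 lam})).comap
    ((vermaIdeal H 𝔟 A lam).restrictScalars A).mkQ)
    ((verma H 𝔟 A lam).le_gen _ (Submodule.mem_span_singleton_self _)) fun x z hz =>
      (verma H 𝔟 A lam).isStable_gen _ x hz
  rw [eq_top_iff]
  intro z _
  obtain ⟨z, rfl⟩ := ((vermaIdeal H 𝔟 A lam).restrictScalars A).mkQ_surjective z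
  exact h1.ge (Submodule.mem_top (x := z))

theorem vermaGen_mem (lam : Weight H) :
    vermaGen H A 𝔟 lam ∈ weightSpace H (verma H 𝔟 A lam) lam := by
  rw [mem_weightSpace]
  intro h
  refine (Submodule.Quotient.eq ((vermaIdeal H 𝔟 A lam).restrictScalars A)).2
    (Submodule.subset_span (Or.inr ⟨h, ?_⟩))
  change (1 ⊗ₜ[ℂ] UniversalEnvelopingAlgebra.ι ℂ (cartanIncl H h) :
    A ⊗[ℂ] UniversalEnvelopingAlgebra ℂ (Affine 𝔤)) * 1 ⊗ₜ[ℂ] 1 -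
    (algebraMap ℂ A (lam h) + tau H A h) •
      ((1 : A) ⊗ₜ[ℂ] (1 : UniversalEnvelopingAlgebra ℂ (Affine 𝔤))) = _
  rw [Algebra.TensorProduct.tmul_mul_tmul, mul_one, mul_one, TensorProduct.smul_tmul',
    smul_eq_mul, mul_one]

theorem ρ_lie_vermaGen (lam : Weight H) {x y : Affine 𝔤} (hx : x ∈ affineBorel 𝔟)
    (hy : y ∈ affineBorel 𝔟) : (verma H 𝔟 A lam).ρ ⁅x, y⁆ (vermaGen H A 𝔟 lam) = 0 := by
  refine (Submodule.Quotient.mk_eq_zero ((vermaIdeal H 𝔟 A lam).restrictScalars A)).2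
    (Submodule.subset_span (Or.inl ⟨x, hx, y, hy, ?_⟩))
  change (1 ⊗ₜ[ℂ] UniversalEnvelopingAlgebra.ι ℂ ⁅x, y⁆ :
    A ⊗[ℂ] UniversalEnvelopingAlgebra ℂ (Affine 𝔤)) * 1 ⊗ₜ[ℂ] 1 = _
  rw [Algebra.TensorProduct.tmul_mul_tmul, mul_one, mul_one]

include h𝔟 hH in
-- A root vector `x` of weight `β ≠ 0` is a multiple of `[h, x]` for some `h` in the Cartan
-- subalgebra with `β(h) ≠ 0`. It therefore lies in `[𝔟^, 𝔟^]`, which kills the generator.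
theorem bStable_vermaGen (lam : Weight H) :
    BStable 𝔟 (verma H 𝔟 A lam) (Submodule.span A {vermaGen H A 𝔟 lam}) := by
  rw [bStable_iff h𝔟 hH]
  intro β hβ x hx m hm
  obtain ⟨a, rfl⟩ := Submodule.mem_span_singleton.1 hm
  rw [map_smul]
  refine Submodule.smul_mem _ a ?_
  by_cases hβ0 : β = 0
  · subst hβ0
    rw [affRootSpace_zero] at hx
    obtain ⟨h, rfl⟩ := hx
    rw [(mem_weightSpace H).1 (vermaGen_mem H lam) h]
    exact Submodule.smul_mem _ _ (Submodule.mem_span_singleton_self _)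
  · obtain ⟨t, ht⟩ : ∃ t, β t ≠ 0 := by
      by_contra! hc; exact hβ0 (LinearMap.ext hc)
    have h1 : x = (β t)⁻¹ • ⁅cartanIncl H t, x⁆ := by
      rw [mem_affRootSpace.1 hx, smul_smul, inv_mul_cancel₀ ht, one_smul]
    have h2 := ρ_lie_vermaGen (A := A) H lam (cartanIncl_mem H h𝔟 hH t)
      ((mem_affineBorel_iff H h𝔟 hH).2 (affRootSpace_le_rootPart H hβ hx))
    rw [h1, smul_ρ, h2, smul_zero]
    exact zero_mem _

include h𝔟 hH in
theorem weightsIn_verma (lam : Weight H) :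
    WeightsIn H (lowerWeights H 𝔟 lam) (verma H 𝔟 A lam) := by
  refine weightsIn_of_gen_eq_top H h𝔟 hH (isOpenWeights_lowerWeights H lam)
    (bStable_vermaGen H h𝔟 hH lam) ?_ (gen_vermaGen H lam)
  rw [Submodule.span_singleton_le_iff_mem]
  exact Submodule.mem_iSup_of_mem lam (Submodule.mem_iSup_of_mem (weightLE_refl H lam)
    (vermaGen_mem H lam))

/-- A proper submodule of the quotient pulls back to a proper submodule of the Verma module, which
is one of those that were divided out. -/
theorem vermaTop_simple (lam : Weight H) (N : Submodule A (vermaTop H 𝔟 A lam).carrier)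
    (hN : (vermaTop H 𝔟 A lam).IsStable N) (hN' : N ≠ ⊤) : N = ⊥ := by
  let K := properSum (verma H 𝔟 A lam)
  have h1 : N.comap K.mkQ ≤ K := by
    refine le_iSup_of_le ⟨N.comap K.mkQ, fun h => hN' ?_, fun x m hm => hN x hm⟩ le_rfl
    rw [eq_top_iff]
    intro z _
    obtain ⟨z, rfl⟩ := K.mkQ_surjective z
    exact h.ge (Submodule.mem_top (x := z))
  rw [eq_bot_iff]
  intro z hz
  obtain ⟨z, rfl⟩ := K.mkQ_surjective z
  exact (Submodule.Quotient.mk_eq_zero K).2 (h1 hz)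

variable [IsLocalRing A]

theorem weightSpace_resScalars (M : AffineMod 𝔤 (IsLocalRing.ResidueField A)) (μ : Weight H)
    (m : M.carrier) : (m : (resScalars M).carrier) ∈ weightSpace H (resScalars M) μ ↔
      m ∈ weightSpace H M μ :=
  (mem_weightSpace H (M := resScalars M)).trans (mem_weightSpace H (M := M)).symm

/-- A stable submodule over the residue field. -/
def resSubmodule (M : AffineMod 𝔤 (IsLocalRing.ResidueField A))
    (N : Submodule A (resScalars M).carrier) :
    Submodule (IsLocalRing.ResidueField A) M.carrier where
  carrier := N.carrier
  add_mem' := N.add_mem'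
  zero_mem' := N.zero_mem'
  smul_mem' := fun c m hm => by
    obtain ⟨a, rfl⟩ := IsLocalRing.residue_surjective c
    exact N.smul_mem a hm

include h𝔟 hH in
-- Collects what is used about the simple object. That it is nonzero is not among these facts.
theorem exists_gen_simpleObj (lam : Weight H) :
    ∃ v ∈ weightSpace H (simpleObj H 𝔟 A lam) lam,
      (simpleObj H 𝔟 A lam).gen (Submodule.span A {v}) = ⊤ ∧
      WeightsIn H (lowerWeights H 𝔟 lam) (simpleObj H 𝔟 A lam) ∧
      (∀ a ∈ IsLocalRing.maximalIdeal A, ∀ z : (simpleObj H 𝔟 A lam).carrier, a • z = 0) ∧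
      ∀ N : Submodule A (simpleObj H 𝔟 A lam).carrier,
        (simpleObj H 𝔟 A lam).IsStable N → N ≠ ⊤ → N = ⊥ := by
  let k := IsLocalRing.ResidueField A
  let V := verma H 𝔟 k lam
  let T := vermaTop H 𝔟 k lam
  let π : V ⟶ T := V.quotMk _ _
  have hπ : Function.Surjective π.toLin := quotMk_surjective V _ _
  have hw : WeightsIn H (lowerWeights H 𝔟 lam) T := (weightsIn_verma H h𝔟 hH lam).of_surjective π hπ
  have hv : π.toLin (vermaGen H k 𝔟 lam) ∈ weightSpace H T lam :=
    hom_mem_weightSpace π (vermaGen_mem H lam)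
  have hg : T.gen (Submodule.span k {π.toLin (vermaGen H k 𝔟 lam)}) = ⊤ := by
    have := map_gen π (Submodule.span k {vermaGen H k 𝔟 lam})
    rw [gen_vermaGen, Submodule.map_top, LinearMap.range_eq_top.2 hπ, Submodule.map_span,
      Set.image_singleton] at this
    exact this.symm
  refine ⟨π.toLin (vermaGen H k 𝔟 lam), (weightSpace_resScalars H T lam _).2 hv, ?_, ?_, ?_, ?_⟩
  · set N := (simpleObj H 𝔟 A lam).gen
      (Submodule.span A {(π.toLin (vermaGen H k 𝔟 lam) : (simpleObj H 𝔟 A lam).carrier)}) with hN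
    have h1 : T.gen (Submodule.span k {π.toLin (vermaGen H k 𝔟 lam)}) ≤ resSubmodule T N := by
      refine gen_le ?_ fun x m hm => (simpleObj H 𝔟 A lam).isStable_gen _ x hm
      rw [Submodule.span_singleton_le_iff_mem]
      exact (simpleObj H 𝔟 A lam).le_gen _ (Submodule.mem_span_singleton_self _)
    rw [eq_top_iff]
    intro z _
    let z' : T.carrier := z
    exact h1 (hg.ge (Submodule.mem_top (x := z')))
  · rw [WeightsIn, eq_top_iff]
    intro z _
    have h1 : (⨆ μ ∈ lowerWeights H 𝔟 lam, weightSpace H T μ) ≤ resSubmodule T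
        (⨆ μ ∈ lowerWeights H 𝔟 lam, weightSpace H (simpleObj H 𝔟 A lam) μ) :=
      iSup₂_le fun μ hμ m hm => Submodule.mem_iSup_of_mem (p := fun μ =>
        ⨆ (_ : μ ∈ lowerWeights H 𝔟 lam), weightSpace H (simpleObj H 𝔟 A lam) μ) μ
        (Submodule.mem_iSup_of_mem hμ ((weightSpace_resScalars H T μ m).2 hm))
    let z' : T.carrier := z
    exact h1 (hw.ge (Submodule.mem_top (x := z')))
  · intro a ha z
    let z' : T.carrier := z
    have h1 : IsLocalRing.residue A a • z' = 0 := by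
      rw [(IsLocalRing.residue_eq_zero_iff a).2 ha, zero_smul]
    exact h1
  · intro N hN hN'
    have h1 := vermaTop_simple (A := k) H lam (resSubmodule T N) (fun x m hm => hN x hm) fun h =>
      hN' (eq_top_iff.2 fun z _ => by
        let z' : T.carrier := z
        exact h.ge (Submodule.mem_top (x := z')))
    rw [eq_bot_iff]
    intro z hz
    exact h1.le hz

end Simple
end AffineO
end

noncomputable section
namespace AffineO

/-! ## Lifting of idempotents -/

/-- For commuting operators `x`, `Θ` and `d` with `d = x² - x`, or more generally whenever `xd =
dx`, the element `b = x - Θd` satisfies `b² - b = F d`, where `F` is the left side with `X`, `θ`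
replaced by `x`, `Θ`. So this identity makes `b` idempotent. -/
theorem quasi_inverse_identity {R : Type*} [Ring R] {X π θ : R} (hπ : π * π = π)
    (hθ : θ * (X - 1 + π) = 1) (hθ' : (X - 1 + π) * θ = 1) :
    1 - X * θ - θ * X + θ * (X * X - X) * θ + θ = 0 := by
  have h1 : θ * X = 1 + θ - θ * π := by
    rw [mul_add, mul_sub, mul_one] at hθ
    rw [← hθ]; abel
  have h2 : X * θ = 1 + θ - π * θ := by
    rw [add_mul, sub_mul, one_mul] at hθ'
    rw [← hθ']; abel
  have h3 : θ * (X * X - X) * θ = (θ * X) * (X * θ) - θ * X * θ := by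
    simp only [mul_sub, sub_mul, mul_assoc]
  have h4 : θ * π * (π * θ) = θ * π * θ := by
    rw [mul_assoc, ← mul_assoc π, hπ, mul_assoc]
  rw [h3, h1, h2]
  simp only [mul_sub, sub_mul, mul_add, add_mul, one_mul, mul_one, h4]
  simp only [mul_assoc]
  abel

/-- Multiplying the hypothesis `h` by `X - 1 + π` leaves `X - 1 + π = πX`. So `π` has a right
inverse, and an idempotent with a right inverse is `1`. -/
theorem mul_inverse_of_quasi_inverse {R : Type*} [Ring R] {X π θ : R} (hπ : π * π = π)
    (hθ' : (X - 1 + π) * θ = 1) (h : X - θ * (X * X - X) = 1) : X * θ = 1 := by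
  have h2 : X - 1 + π = π * X := by
    have h3 : (X - 1 + π) * (X - θ * (X * X - X)) = X - 1 + π := by rw [h, mul_one]
    rw [mul_sub, ← mul_assoc, hθ', one_mul, add_mul, sub_mul, one_mul] at h3
    rw [← h3]
    abel
  have h4 : π * (X * θ) = 1 := by rw [← mul_assoc, ← h2, hθ']
  have h3 : π = 1 := by
    calc π = π * (π * (X * θ)) := by rw [h4, mul_one]
      _ = 1 := by rw [← mul_assoc, hπ, h4]
  rwa [h3, one_mul] at h4

section Lifting

variable {𝔤 : Type u} [LieRing 𝔤] [LieAlgebra ℂ 𝔤] (H : LieSubalgebra ℂ 𝔤)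
  {A : Type u} [CommRing A] [Algebra ℂ A] [Algebra (SymmetricAlgebra ℂ H) A]

open AffineMod

theorem AffineMod.eq_top_of_gen {M : AffineMod 𝔤 A} {W S : Submodule A M.carrier}
    (hgen : M.gen W = ⊤) (hW : W ≤ S) (hS : M.IsStable S) : S = ⊤ :=
  eq_top_iff.2 (hgen ▸ gen_le hW hS)

/-- Homomorphisms are determined by their values on generators. -/
theorem AffineMod.hom_ext_of_gen {M N : AffineMod 𝔤 A} {W : Submodule A M.carrier}
    (hgen : M.gen W = ⊤) {f g : M ⟶ N} (h : ∀ w ∈ W, f.toLin w = g.toLin w) : f = g := by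
  have h1 := eq_top_of_gen hgen (S := LinearMap.eqLocus f.toLin g.toLin) h fun x m hm => by
    rw [Submodule.mem_comap, LinearMap.mem_eqLocus, f.comm, g.comm, LinearMap.mem_eqLocus.1 hm]
  exact hom_ext fun m => h1.ge (Submodule.mem_top (x := m))

theorem AffineMod.surjective_of_gen {M N : AffineMod 𝔤 A} {W : Submodule A N.carrier}
    (hgen : N.gen W = ⊤) (f : M ⟶ N) (h : W ≤ LinearMap.range f.toLin) :
    Function.Surjective f.toLin :=
  LinearMap.range_eq_top.1 (eq_top_of_gen hgen h (isStable_range f))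

/-- The restriction of a homomorphism to a weight space. -/
def weightMap {M N : AffineMod 𝔤 A} (f : M ⟶ N) (μ : Weight H) :
    weightSpace H M μ →ₗ[A] weightSpace H N μ :=
  f.toLin.restrict fun _ hm => hom_mem_weightSpace f hm

/-- Every endomorphism of a weight space extends to the submodule generated by it. -/
def HasExtension (M : AffineMod 𝔤 A) (ν : Weight H) : Prop :=
  ∀ θ : Module.End A (weightSpace H M ν),
    ∃ Θ : M.sub (M.gen (weightSpace H M ν)) (M.isStable_gen _) ⟶ M,
      ∀ w : weightSpace H M ν, Θ.toLin ⟨w, M.le_gen _ w.2⟩ = θ w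

variable {H}

/-- Let `X` be the action of the lift `x` on the weight space and `X - 1 + π` a unit with inverse
`θ`. If `Θ` extends `θ` to the kernel of `g`, then `x - Θ(x² - x)` is an idempotent lift of `e`: as
`e` is idempotent, `x² - x` takes values in that kernel. The last clause serves the minimality
argument in `IsWeightExtension.exists_essential`. -/
theorem exists_idempotent_lift [IsLocalRing A] {P P' : AffineMod 𝔤 A} {ν : Weight H} {g : P ⟶ P'}
    (hker : LinearMap.ker g.toLin = P.gen (weightSpace H P ν))
    [Module.Finite A (weightSpace H P ν)] [Module.Projective A (weightSpace H P ν)]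
    (hext : HasExtension H P ν) (x : P ⟶ P) (e : P' ⟶ P') (he : e ≫ e = e)
    (hx : x ≫ g = g ≫ e) :
    ∃ b : P ⟶ P, b ≫ b = b ∧ b ≫ g = g ≫ e ∧ ((∀ w ∈ weightSpace H P ν, b.toLin w = w) →
      ∀ w ∈ weightSpace H P ν, ∃ w' ∈ weightSpace H P ν, x.toLin w' = w) := by
  set W := weightSpace H P ν with hW
  set N := P.gen W with hN
  have : Module.Free A W := Module.free_of_flat_of_isLocalRing
  let X : Module.End A W := weightMap H x ν
  obtain ⟨π, hπ, hU⟩ := exists_idempotent_isUnit (X - 1)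
  obtain ⟨U, hU'⟩ := hU
  let θ : Module.End A W := ↑U⁻¹
  have hθ : θ * (X - 1 + π) = 1 := by rw [← hU']; exact U.inv_mul
  have hθ' : (X - 1 + π) * θ = 1 := by rw [← hU']; exact U.mul_inv
  obtain ⟨Θ, hΘ⟩ := hext θ
  have hΘN : ∀ n : N, Θ.toLin n ∈ N := by
    have h1 : N ≤ (N.comap Θ.toLin).map N.subtype := by
      refine gen_le (fun w hw => ⟨⟨w, P.le_gen W hw⟩, ?_, rfl⟩) ?_
      · change Θ.toLin ⟨w, _⟩ ∈ N
        rw [hΘ ⟨w, hw⟩]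
        exact P.le_gen W (θ ⟨w, hw⟩).2
      · rintro y _ ⟨n, hn, rfl⟩
        refine ⟨⟨P.ρ y n, P.isStable_gen W y n.2⟩, ?_, rfl⟩
        have h2 : Θ.toLin ⟨P.ρ y n, P.isStable_gen W y n.2⟩ = P.ρ y (Θ.toLin n) := Θ.comm y n
        change Θ.toLin ⟨P.ρ y n, P.isStable_gen W y n.2⟩ ∈ N
        rw [h2]
        exact P.isStable_gen W y hn
    intro n
    obtain ⟨n', hn', e⟩ := h1 n.2
    rwa [← Subtype.ext e]
  let ΘN : Module.End A N := LinearMap.codRestrict N Θ.toLin hΘN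
  have hxN : ∀ n ∈ N, x.toLin n ∈ N := by
    have h1 : N ≤ N.comap x.toLin := gen_le (fun w hw => P.le_gen W (hom_mem_weightSpace x hw))
      (isStable_comap x (P.isStable_gen W))
    exact h1
  let XN : Module.End A N := x.toLin.restrict hxN
  have hd : ∀ p, x.toLin (x.toLin p) - x.toLin p ∈ N := by
    intro p
    rw [← hker, LinearMap.mem_ker, map_sub]
    have h1 : ∀ p, g.toLin (x.toLin p) = e.toLin (g.toLin p) := fun p => Hom.congr_apply hx p
    have h2 : ∀ p, e.toLin (e.toLin p) = e.toLin p := fun p => Hom.congr_apply he p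
    rw [h1, h1, h2, sub_self]
  let d : P.carrier →ₗ[A] N := LinearMap.codRestrict N (x.toLin ∘ₗ x.toLin - x.toLin) hd
  -- The defect of idempotence: `b² - b` is `F` after `x² - x`.
  let F : Module.End A N :=
    1 - XN * ΘN - ΘN * XN + ΘN * (XN * XN - XN) * ΘN + ΘN
  have hF : ∀ n, F n = 0 := by
    -- `F` is built from endomorphisms of modules, so it vanishes on all of `N` as soon as it
    -- vanishes on the generators `W`. There it is the operator of `quasi_inverse_identity`.
    have hcomm : ∀ y, Commute ((P.sub N (P.isStable_gen W)).ρ y) F := by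
      intro y
      have c1 : Commute ((P.sub N (P.isStable_gen W)).ρ y) XN :=
        LinearMap.ext fun (n : N) => Subtype.ext (x.comm y (n : P.carrier)).symm
      have c2 : Commute ((P.sub N (P.isStable_gen W)).ρ y) ΘN :=
        LinearMap.ext fun n => Subtype.ext (Θ.comm y n).symm
      exact ((((Commute.one_right _).sub_right (c1.mul_right c2)).sub_right
        (c2.mul_right c1)).add_right ((c2.mul_right ((c1.mul_right c1).sub_right c1)).mul_right
        c2)).add_right c2
    have h1 : N ≤ (LinearMap.ker F).map N.subtype := by
      refine gen_le (fun w hw => ⟨⟨w, P.le_gen W hw⟩, ?_, rfl⟩) ?_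
      · let j : W →ₗ[A] N := Submodule.inclusion (P.le_gen W)
        have j1 : ∀ w, XN (j w) = j (X w) := fun w => rfl
        have j2 : ∀ w, ΘN (j w) = j (θ w) := fun w => Subtype.ext (hΘ w)
        have j3 : F (j ⟨w, hw⟩) =
            j ((1 - X * θ - θ * X + θ * (X * X - X) * θ + θ) ⟨w, hw⟩) := by
          simp only [F, LinearMap.add_apply, LinearMap.sub_apply, Module.End.mul_apply,
            Module.End.one_apply, j1, j2, map_add, map_sub]
        change F (j ⟨w, hw⟩) = 0
        rw [j3, quasi_inverse_identity hπ hθ hθ', LinearMap.zero_apply, map_zero]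
      · rintro y _ ⟨n, hn, rfl⟩
        refine ⟨(P.sub N (P.isStable_gen W)).ρ y n, ?_, rfl⟩
        have h2 : (P.sub N (P.isStable_gen W)).ρ y (F n) =
          F ((P.sub N (P.isStable_gen W)).ρ y n) := LinearMap.congr_fun (hcomm y) n
        have h3 : F n = 0 := hn
        have h4 : (P.sub N (P.isStable_gen W)).ρ y (F n) = 0 := by
          rw [h3]; exact map_zero ((P.sub N (P.isStable_gen W)).ρ y)
        exact h2.symm.trans h4
    intro n
    obtain ⟨n', hn', e⟩ := h1 n.2
    rw [← Subtype.ext e]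
    exact hn'
  let b : P ⟶ P :=
    { toLin := x.toLin - Θ.toLin ∘ₗ d
      comm := fun y p => by
        have h1 : d (P.ρ y p) = (P.sub N (P.isStable_gen W)).ρ y (d p) := Subtype.ext (by
          change x.toLin (x.toLin (P.ρ y p)) - x.toLin (P.ρ y p) =
            P.ρ y (x.toLin (x.toLin p) - x.toLin p)
          rw [x.comm, x.comm, map_sub])
        change x.toLin (P.ρ y p) - Θ.toLin (d (P.ρ y p)) = P.ρ y (x.toLin p - Θ.toLin (d p))
        rw [h1, x.comm, map_sub]
        exact congrArg _ (Θ.comm y (d p)) }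
  have hb : ∀ p, b.toLin p = x.toLin p - (ΘN (d p) : P.carrier) := fun p => rfl
  refine ⟨b, hom_ext fun p => ?_, hom_ext fun p => ?_, fun h w hw => ?_⟩
  · rw [Hom.comp_apply]
    have h1 : d (x.toLin p) = XN (d p) := Subtype.ext (by
      change x.toLin (x.toLin (x.toLin p)) - x.toLin (x.toLin p) =
        x.toLin (x.toLin (x.toLin p) - x.toLin p)
      rw [map_sub])
    have h2 : ∀ n : N, d n = (XN * XN - XN) n := fun n => rfl
    have h3 : (d p : P.carrier) = x.toLin (x.toLin p) - x.toLin p := rfl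
    have h4 : ∀ n : N, x.toLin n = (XN n : P.carrier) := fun n => rfl
    have h5 := congrArg Subtype.val (hF (d p))
    rw [hb, hb, map_sub, map_sub d, h1, h2, map_sub ΘN, h4 (ΘN (d p))]
    simp only [F, LinearMap.add_apply, LinearMap.sub_apply, Module.End.mul_apply,
      Module.End.one_apply, Submodule.coe_add, Submodule.coe_sub, map_sub, h3,
      ZeroMemClass.coe_zero] at h5 ⊢
    rw [← sub_eq_zero, ← h5]
    abel
  · rw [Hom.comp_apply, hb, map_sub]
    have h1 : g.toLin (ΘN (d p) : P.carrier) = 0 := by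
      rw [← LinearMap.mem_ker, hker]; exact (ΘN (d p)).2
    rw [h1, sub_zero]
    exact Hom.congr_apply hx p
  · have h1 : X - θ * (X * X - X) = 1 := by
      refine LinearMap.ext fun w => Subtype.ext ?_
      have h2 := h w w.2
      rw [hb] at h2
      have h3 : d (w : P.carrier) = Submodule.inclusion (P.le_gen W) ((X * X - X) w) := rfl
      have h4 : (ΘN (d (w : P.carrier)) : P.carrier) = θ ((X * X - X) w) := by
        rw [h3]; exact hΘ ((X * X - X) w)
      rw [h4] at h2
      exact h2
    have h2 := mul_inverse_of_quasi_inverse hπ hθ' h1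
    refine ⟨θ ⟨w, hw⟩, (θ ⟨w, hw⟩).2, ?_⟩
    exact congrArg Subtype.val (LinearMap.congr_fun h2 ⟨w, hw⟩)

end Lifting
end AffineO
end

noncomputable section
namespace AffineO

/-! ## Enlarging a truncation by a maximal weight -/

section Extension

variable {𝔤 : Type u} [LieRing 𝔤] [LieAlgebra ℂ 𝔤] (H : LieSubalgebra ℂ 𝔤)
  {A : Type u} [CommRing A] [Algebra ℂ A] [Algebra (SymmetricAlgebra ℂ H) A]

open AffineMod

/-- A homomorphism induces a homomorphism between submodules. -/
def AffineMod.subMap {M M' : AffineMod 𝔤 A} (f : M ⟶ M') {N : Submodule A M.carrier}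
    (hN : M.IsStable N) {N' : Submodule A M'.carrier} (hN' : M'.IsStable N')
    (h : ∀ n ∈ N, f.toLin n ∈ N') : M.sub N hN ⟶ M'.sub N' hN' where
  toLin := f.toLin.restrict h
  comm x n := Subtype.ext (f.comm x (Subtype.val (p := fun m => m ∈ N) n))

theorem AffineMod.cancel_surjective {M N K : AffineMod 𝔤 A} {g : M ⟶ N}
    (hg : Function.Surjective g.toLin) {f f' : N ⟶ K} (h : g ≫ f = g ≫ f') : f = f' :=
  hom_ext fun n => by
    obtain ⟨m, rfl⟩ := hg n
    exact Hom.congr_apply h m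

theorem AffineMod.surjective_of_comp {M N K : AffineMod 𝔤 A} {f : M ⟶ N} {g : N ⟶ K}
    (h : Function.Surjective (f ≫ g).toLin) : Function.Surjective g.toLin := fun n => by
  obtain ⟨m, hm⟩ := h n
  exact ⟨f.toLin m, hm⟩

theorem AffineMod.surjective_comp {M N K : AffineMod 𝔤 A} {f : M ⟶ N} {g : N ⟶ K}
    (hf : Function.Surjective f.toLin) (hg : Function.Surjective g.toLin) :
    Function.Surjective (f ≫ g).toLin := hg.comp hf

/-- An idempotent endomorphism splits. -/
theorem AffineMod.exists_splitting {P : AffineMod 𝔤 A} {b : P ⟶ P} (hb : b ≫ b = b) :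
    ∃ (R : AffineMod 𝔤 A) (i : R ⟶ P) (r : P ⟶ R), i ≫ r = 𝟙 R ∧ r ≫ i = b := by
  refine ⟨P.sub (LinearMap.range b.toLin) (isStable_range b), P.subι _ _,
    ⟨b.toLin.rangeRestrict, fun x m => Subtype.ext (b.comm x m)⟩, hom_ext fun n => ?_, rfl⟩
  obtain ⟨m, hm⟩ := (n : LinearMap.range b.toLin).2
  refine Subtype.ext ?_
  change b.toLin (n : LinearMap.range b.toLin).1 = (n : LinearMap.range b.toLin).1
  rw [← hm]
  exact Hom.congr_apply hb m

/-- The quotient of a projective object by the submodule generated by the vectors of weight `ν`,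
if this weight space behaves like the generating space of a projective object. -/
structure IsWeightExtension (C : ObjectProperty (AffineMod 𝔤 A)) (ν : Weight H)
    {P P' : AffineMod 𝔤 A} (g : P ⟶ P') : Prop where
  mem : C P
  lift : ∀ (M N : AffineMod 𝔤 A), C M → C N → ∀ f : M ⟶ N, Function.Surjective f.toLin →
    ∀ p : P ⟶ N, ∃ q : P ⟶ M, q ≫ f = p
  surjective : Function.Surjective g.toLin
  ker : LinearMap.ker g.toLin = P.gen (weightSpace H P ν)
  finite : Module.Finite A (weightSpace H P ν)
  projective : Module.Projective A (weightSpace H P ν)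
  ext : HasExtension H P ν

variable {H}

theorem weightMap_surjective_of_splitting {R P : AffineMod 𝔤 A} {i : R ⟶ P} {r : P ⟶ R}
    (hir : i ≫ r = 𝟙 R) (ν : Weight H) : Function.Surjective (weightMap H r ν) := fun w =>
  ⟨⟨i.toLin w, hom_mem_weightSpace i w.2⟩, Subtype.ext (Hom.congr_apply hir w)⟩

/-- Compatible idempotents on source and target cut out a weight extension of the summands: lifting,
finiteness, projectivity and extension of endomorphisms all pass to retracts. -/
theorem IsWeightExtension.retract {C : ObjectProperty (AffineMod 𝔤 A)} (hC : QuotClosed C)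
    {ν : Weight H} {P P' P'' R : AffineMod 𝔤 A} {g : P ⟶ P'} (hg : IsWeightExtension H C ν g)
    {i : R ⟶ P} {r : P ⟶ R} (hir : i ≫ r = 𝟙 R) {j : P'' ⟶ P'} {s : P' ⟶ P''}
    (hjs : j ≫ s = 𝟙 P'') (hri : r ≫ i ≫ g = g ≫ s ≫ j) :
    IsWeightExtension H C ν (i ≫ g ≫ s) := by
  have e1 : ∀ z, r.toLin (i.toLin z) = z := Hom.congr_apply hir
  have e2 : ∀ z, s.toLin (j.toLin z) = z := Hom.congr_apply hjs
  have e3 : ∀ z, g.toLin (i.toLin (r.toLin z)) = j.toLin (s.toLin (g.toLin z)) :=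
    Hom.congr_apply hri
  have hr : Function.Surjective r.toLin := fun z => ⟨_, e1 z⟩
  have := hg.finite
  have := hg.projective
  refine ⟨hC _ _ r hr hg.mem, fun M N hM hN f hf p => ?_, fun z => ?_, le_antisymm ?_ ?_,
    Module.Finite.of_surjective (weightMap H r ν) (weightMap_surjective_of_splitting hir ν),
    Module.Projective.of_split (weightMap H i ν) (weightMap H r ν)
      (LinearMap.ext fun w => Subtype.ext (e1 w)), fun θ => ?_⟩
  · obtain ⟨q, hq⟩ := hg.lift M N hM hN f hf (r ≫ p)
    refine ⟨i ≫ q, ?_⟩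
    rw [Category.assoc, hq, ← Category.assoc, hir, Category.id_comp]
  · obtain ⟨p, hp⟩ := hg.surjective (j.toLin z)
    refine ⟨r.toLin p, ?_⟩
    change s.toLin (g.toLin (i.toLin (r.toLin p))) = z
    rw [e3, e2, hp, e2]
  · intro z hz
    have h0 : s.toLin (g.toLin (i.toLin z)) = 0 := hz
    have h1 : i.toLin z ∈ P.gen (weightSpace H P ν) := by
      rw [← hg.ker, LinearMap.mem_ker, ← e1 z, e3, h0, map_zero]
    have h2 : P.gen (weightSpace H P ν) ≤ (R.gen (weightSpace H R ν)).comap r.toLin :=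
      gen_le (fun w hw => R.le_gen _ (hom_mem_weightSpace r hw))
        (isStable_comap r (R.isStable_gen _))
    rw [← e1 z]
    exact h2 h1
  · refine gen_le (fun w hw => ?_) (isStable_ker _)
    have h1 : i.toLin w ∈ LinearMap.ker g.toLin := by
      rw [hg.ker]; exact P.le_gen _ (hom_mem_weightSpace i hw)
    change s.toLin (g.toLin (i.toLin w)) = 0
    rw [LinearMap.mem_ker.1 h1, map_zero]
  · obtain ⟨Θ, hΘ⟩ := hg.ext (weightMap H i ν ∘ₗ θ ∘ₗ weightMap H r ν)
    have h1 : R.gen (weightSpace H R ν) ≤ (P.gen (weightSpace H P ν)).comap i.toLin :=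
      gen_le (fun w hw => P.le_gen _ (hom_mem_weightSpace i hw))
        (isStable_comap i (P.isStable_gen _))
    refine ⟨subMap i (R.isStable_gen _) (P.isStable_gen _) h1 ≫ Θ ≫ r, fun w => ?_⟩
    have h2 := hΘ ⟨i.toLin w, hom_mem_weightSpace i w.2⟩
    have h3 : weightMap H r ν ⟨i.toLin w, hom_mem_weightSpace i w.2⟩ = w := Subtype.ext (e1 w)
    rw [LinearMap.comp_apply, LinearMap.comp_apply, h3] at h2
    exact (congrArg r.toLin h2).trans (e1 _)

/-- The idempotent of `P'` with image `P''` lifts to an endomorphism of `P` by projectivity, then to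
an idempotent by `exists_idempotent_lift`; its image is the extension. -/
theorem IsWeightExtension.exists_retract {C : ObjectProperty (AffineMod 𝔤 A)} (hC : QuotClosed C)
    [IsLocalRing A] {ν : Weight H} {P P' P'' : AffineMod 𝔤 A} {g : P ⟶ P'}
    (hg : IsWeightExtension H C ν g) {j : P'' ⟶ P'} {s : P' ⟶ P''} (hjs : j ≫ s = 𝟙 P'') :
    ∃ (R : AffineMod 𝔤 A) (g' : R ⟶ P''), IsWeightExtension H C ν g' := by
  have := hg.finite
  have := hg.projective
  obtain ⟨x, hx⟩ := hg.lift P P' hg.mem (hC _ _ g hg.surjective hg.mem) g hg.surjective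
    (g ≫ s ≫ j)
  obtain ⟨b, hb, hbg, -⟩ := exists_idempotent_lift hg.ker hg.ext x (s ≫ j)
    (by rw [Category.assoc, ← Category.assoc j, hjs, Category.id_comp]) hx
  obtain ⟨R, i, r, hir, hri⟩ := exists_splitting hb
  exact ⟨R, _, hg.retract hC hir hjs (by rw [← Category.assoc, hri, hbg])⟩

/-- A minimal weight extension is essential. -/
theorem IsWeightExtension.exists_essential {C : ObjectProperty (AffineMod 𝔤 A)}
    (hC : QuotClosed C) [IsLocalRing A] {ν : Weight H} {P₀ P' : AffineMod 𝔤 A} {g₀ : P₀ ⟶ P'}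
    (hg₀ : IsWeightExtension H C ν g₀) : ∃ (P : AffineMod 𝔤 A) (g : P ⟶ P'),
      IsWeightExtension H C ν g ∧ ∀ y : P ⟶ P, y ≫ g = g → Function.Surjective y.toLin := by
  classical
  have hex : ∃ n, ∃ (P : AffineMod 𝔤 A) (g : P ⟶ P'), IsWeightExtension H C ν g ∧
      Module.finrank A (weightSpace H P ν) = n := ⟨_, P₀, g₀, hg₀, rfl⟩
  -- `P` minimises the rank of the weight space among all weight extensions of `P'`.
  obtain ⟨P, g, hg, hn⟩ := Nat.find_spec hex
  refine ⟨P, g, hg, fun y hy => ?_⟩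
  have := hg.finite
  have := hg.projective
  obtain ⟨b, hb, hbg, hby⟩ := exists_idempotent_lift hg.ker hg.ext y (𝟙 P')
    (Category.id_comp _) (by rw [hy, Category.comp_id])
  obtain ⟨R, i, r, hir, hri⟩ := exists_splitting hb
  have hR : IsWeightExtension H C ν (i ≫ g ≫ 𝟙 P') :=
    hg.retract hC (s := 𝟙 P') (j := 𝟙 P') hir (Category.id_comp _) (by
      rw [← Category.assoc, hri, hbg, Category.id_comp])
  have := hR.finite
  have := hR.projective
  have : Module.Free A (weightSpace H P ν) := Module.free_of_flat_of_isLocalRing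
  have : Module.Free A (weightSpace H R ν) := Module.free_of_flat_of_isLocalRing
  have hr := weightMap_surjective_of_splitting hir ν
  -- The image `R` of the idempotent competes for the minimum, so its weight space cannot be
  -- smaller. The projection between free modules of equal finite rank is then bijective, and the
  -- idempotent is the identity on the weight space.
  have hfin : Module.finrank A (weightSpace H R ν) = Module.finrank A (weightSpace H P ν) :=
    le_antisymm ((weightMap H r ν).finrank_le_finrank_of_surjective hr)
      (hn.trans_le (Nat.find_min' hex ⟨R, _, hR, rfl⟩))
  have hinj : Function.Injective (weightMap H r ν) := by
    let e := LinearEquiv.ofFinrankEq _ _ hfin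
    have h1 : Function.Surjective (e.toLinearMap ∘ₗ weightMap H r ν) := e.surjective.comp hr
    have h2 := OrzechProperty.injective_of_surjective_endomorphism _ h1
    exact Function.Injective.of_comp (f := e) h2
  have hbw : ∀ w ∈ weightSpace H P ν, b.toLin w = w := fun w hw => by
    have h1 : r.toLin (b.toLin w) = r.toLin w := by
      rw [← hri]; exact Hom.congr_apply hir (r.toLin w)
    exact congrArg Subtype.val (hinj (a₁ := ⟨b.toLin w, hom_mem_weightSpace b hw⟩)
      (a₂ := ⟨w, hw⟩) (Subtype.ext h1))
  have hker : LinearMap.ker g.toLin ≤ LinearMap.range y.toLin := by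
    rw [hg.ker]
    exact gen_le (fun w hw => by
      obtain ⟨w', -, h⟩ := hby hbw w hw
      exact ⟨w', h⟩) (isStable_range y)
  -- The range of `y` contains `ker g`, and `y p` differs from `p` by an element of `ker g`.
  intro p
  have h1 : p - y.toLin p ∈ LinearMap.range y.toLin := hker (by
    have := Hom.congr_apply hy p
    rw [LinearMap.mem_ker, map_sub, ← this]
    exact sub_self _)
  have h2 := add_mem h1 (LinearMap.mem_range_self y.toLin p)
  rwa [sub_add_cancel] at h2

variable [FiniteDimensional ℂ 𝔤] [LieAlgebra.IsSimple ℂ 𝔤] [H.IsCartanSubalgebra]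
  {𝔟 : LieSubalgebra ℂ 𝔤} (h𝔟 : IsBorel 𝔟) (hH : H ≤ 𝔟)

/-- Freeness over `U(𝔫₋)` extends `θ` to a map commuting with `𝔫₋`. On the maximal weight space it
also commutes with the Borel subalgebra, which acts there by scalars and zero. Full equivariance
spreads to the generated submodule by `gen_le_of_bStable`. -/
theorem hasExtension_of_isMaxWeight {J : Set (Weight H)} {Q : AffineMod 𝔤 A}
    (hQ : WeightsIn H J Q) {ν : Weight H} (hν : IsMaxWeight 𝔟 J ν) {N₀ : Submodule A Q.carrier}
    (hN₀ : weightSpace H Q ν ≤ N₀)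
    (hF : ∀ f : Q.carrier →ₗ[A] Q.carrier, ∃ F : Q.carrier →ₗ[A] Q.carrier, (∀ z ∈ N₀, F z = f z) ∧
          ∀ y ∈ nMinus H h𝔟 hH, ∀ z, F (Q.ρ y z) = Q.ρ y (F z)) : HasExtension H Q ν := by
  intro θ
  let f : Q.carrier →ₗ[A] Q.carrier := (weightSpace H Q ν).subtype ∘ₗ θ ∘ₗ
    Submodule.projectionOnto _ _ (hQ.isCompl ν)
  have hf : ∀ w : weightSpace H Q ν, f w = θ w := fun w => by
    simp only [f, LinearMap.comp_apply, Submodule.projectionOnto_apply_left, Submodule.subtype_apply]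
  obtain ⟨F, hF₀, hF⟩ := hF f
  have hFw : ∀ w : weightSpace H Q ν, F w = θ w := fun w => (hF₀ _ (hN₀ w.2)).trans (hf w)
  let S : Submodule A Q.carrier :=
    { carrier := {z | ∀ y, F (Q.ρ y z) = Q.ρ y (F z)}
      add_mem' := fun {a b} ha hb y => by rw [map_add, map_add, map_add, map_add, ha, hb]
      zero_mem' := fun y => by simp
      smul_mem' := fun c a ha y => by rw [map_smul, map_smul, map_smul, map_smul, ha] }
  have hB : ∀ w : weightSpace H Q ν, ∀ y ∈ affineBorel 𝔟, F (Q.ρ y w) = Q.ρ y (F w) := by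
    intro w y hy
    let E : Submodule ℂ (Affine 𝔤) :=
      { carrier := {y | F (Q.ρ y w) = Q.ρ y (F w)}
        add_mem' := fun {a b} (ha : _ = _) (hb : _ = _) => by
          change F (Q.ρ (a + b) w) = Q.ρ (a + b) (F w)
          rw [map_add, LinearMap.add_apply, LinearMap.add_apply, map_add, ha, hb]
        zero_mem' := by
          change F (Q.ρ 0 w) = Q.ρ 0 (F w)
          simp
        smul_mem' := fun c a (ha : _ = _) => by
          change F (Q.ρ (c • a) w) = Q.ρ (c • a) (F w)
          rw [smul_ρ, smul_ρ, map_smul, ha] }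
    have h1 : rootPart H (posCone H 𝔟) ≤ E := by
      refine rootPart_induction H fun β hβ x hx => ?_
      change F (Q.ρ x w) = Q.ρ x (F w)
      rw [hFw]
      by_cases hβ0 : β = 0
      · subst hβ0
        rw [affRootSpace_zero] at hx
        obtain ⟨h, rfl⟩ := hx
        rw [(mem_weightSpace H).1 w.2 h, (mem_weightSpace H).1 (θ w).2 h, map_smul, hFw]
      · have h2 : β + ν ∉ J := fun hc => hβ0 (by
          simpa using hν _ hc (by rw [WeightLE, add_sub_cancel_right]; exact hβ))
        rw [hQ.eq_zero h2 (ρ_mem_weightSpace hx w.2),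
          hQ.eq_zero h2 (ρ_mem_weightSpace hx (θ w).2), map_zero]
    exact h1 ((mem_affineBorel_iff H h𝔟 hH).1 hy)
  have hS : Q.gen (weightSpace H Q ν) ≤ S := by
    refine gen_le_of_bStable h𝔟 hH (bStable_of_isMaxWeight h𝔟 hH hQ hν le_rfl) ?_ ?_
    · intro w hw y
      have : y = projMinus H h𝔟 hH y + projBorel H h𝔟 hH y := by
        rw [projBorel_apply]; abel
      rw [this, map_add, LinearMap.add_apply, LinearMap.add_apply, map_add,
        hF _ (projMinus H h𝔟 hH y).2, hB ⟨w, hw⟩ _ (projBorel H h𝔟 hH y).2]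
    · intro β hβ x hx m hm y
      have hx' : x ∈ nMinus H h𝔟 hH := by
        rw [mem_nMinus]
        exact affRootSpace_le_rootPart H (by simpa using hβ) hx
      rw [ρ_ρ, map_add, hm, hF _ hx', hm, hF _ hx']
      exact (ρ_ρ Q y x _).symm
  exact ⟨⟨F ∘ₗ (Q.gen (weightSpace H Q ν)).subtype, fun x n =>
    hS (Subtype.property (p := fun m => m ∈ Q.gen (weightSpace H Q ν)) n) x⟩, hFw⟩

variable [IsScalarTower ℂ (SymmetricAlgebra ℂ H) A] [IsNoetherianRing A]

variable (A) in
include h𝔟 hH in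
-- The representing object lifts against surjections because weight vectors do. Its maximal weight
-- space is a direct summand over `A`, hence projective, and it lies in the Borel module generating
-- `Q`, where endomorphisms extend.
theorem exists_isWeightExtension {J : Set (Weight H)} (hJ : IsOpenWeights H 𝔟 J)
    (hJb : IsLocallyBounded H 𝔟 J) {ν : Weight H} (hν : IsMaxWeight 𝔟 J ν) (lam : Weight H) :
    ∃ (Q : AffineMod 𝔤 A) (v : Q.carrier), v ∈ weightSpace H Q lam ∧
      Q.gen (Submodule.span A {v}) = ⊤ ∧
      (∀ M, WeightsIn H J M → ∀ m ∈ weightSpace H M lam, ∃ f : Q ⟶ M, f.toLin v = m) ∧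
      IsWeightExtension H (truncO H 𝔟 A J) ν (Q.quotMk _ (Q.isStable_gen (weightSpace H Q ν))) := by
  obtain ⟨Q, v, hproj, hQ, hv, hgen, hlift, N₀, hN₀, hvN, hF⟩ :=
    exists_representing A H h𝔟 hH hJ lam
  have hQC := (truncO_iff h𝔟 hH hJb).2 hQ
  refine ⟨Q, v, hv, hgen, hlift, hQC, fun M N hM hN f hf p => ?_, quotMk_surjective _ _ _,
    ker_quotMk _ _ _, ?_, projective_of_isCompl (hQ.isCompl ν), ?_⟩
  · rw [truncO_iff h𝔟 hH hJb] at hM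
    obtain ⟨m, hm, hmv⟩ := hM.exists_lift f hf (hom_mem_weightSpace p hv)
    obtain ⟨q, hq⟩ := hlift M hM m hm
    refine ⟨q, hom_ext_of_gen hgen fun w hw => ?_⟩
    obtain ⟨a, rfl⟩ := Submodule.mem_span_singleton.1 hw
    rw [map_smul, map_smul, Hom.comp_apply, hq, hmv]
  -- Local finiteness puts the generator in a finitely generated Borel-stable subspace, which then
  -- contains the maximal weight space; here `A` has to be Noetherian.
  · obtain ⟨N, hvN, hfg, hst⟩ := hQC.1.2 v
    have h1 : weightSpace H Q ν ≤ N := weightSpace_le_of_gen_eq_top h𝔟 hH hQ hν hst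
      (eq_top_iff.2 (hgen ▸ gen_mono ((Submodule.span_singleton_le_iff_mem _ _).2 hvN)))
    have : IsNoetherian A N := isNoetherian_of_fg_of_noetherian N hfg
    exact Module.Finite.iff_fg.2 (isNoetherian_submodule.1 this _ h1)
  · exact hasExtension_of_isMaxWeight h𝔟 hH hQ hν (weightSpace_le_of_gen_eq_top h𝔟 hH hQ hν hN₀
      (eq_top_iff.2 (hgen ▸ gen_mono ((Submodule.span_singleton_le_iff_mem _ _).2 hvN)))) hF

end Extension
end AffineO
end

noncomputable section
namespace AffineO

/-! ## Existence of projective covers -/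

section Covers

variable {𝔤 : Type u} [LieRing 𝔤] [LieAlgebra ℂ 𝔤] {H : LieSubalgebra ℂ 𝔤}
  {A : Type u} [CommRing A] [Algebra ℂ A] [Algebra (SymmetricAlgebra ℂ H) A]
  [FiniteDimensional ℂ 𝔤] [LieAlgebra.IsSimple ℂ 𝔤] [H.IsCartanSubalgebra]
  {𝔟 : LieSubalgebra ℂ 𝔤} (h𝔟 : IsBorel 𝔟) (hH : H ≤ 𝔟)

open AffineMod

include h𝔟 hH in
theorem exists_isMaxWeight {J : Set (Weight H)} (hJb : IsLocallyBounded H 𝔟 J) {lam : Weight H}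
    (hlam : lam ∈ J) : ∃ ν ∈ J, WeightLE H 𝔟 lam ν ∧ IsMaxWeight 𝔟 J ν := by
  obtain ⟨ν, ⟨hνJ, hν⟩, hmin⟩ := Set.exists_min_image _
    (fun ν => {γ | γ ∈ J ∧ WeightLE H 𝔟 ν γ}.ncard) (hJb lam) ⟨lam, hlam, weightLE_refl H lam⟩
  refine ⟨ν, hνJ, hν, fun γ hγ hνγ => ?_⟩
  by_contra hne
  refine (hmin γ ⟨hγ, hν.trans hνγ⟩).not_gt (Set.ncard_lt_ncard ⟨fun κ hκ =>
    ⟨hκ.1, hνγ.trans hκ.2⟩, fun hc => hne ?_⟩ (hJb ν))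
  exact WeightLE.antisymm H h𝔟 hH (hc ⟨hνJ, weightLE_refl H ν⟩).2 hνγ

variable [IsScalarTower ℂ (SymmetricAlgebra ℂ H) A] [IsNoetherianRing A] [IsLocalRing A]

include h𝔟 hH in
-- The weight space `Q_lam` is the cyclic module `A v`. If `g ≫ c` is onto, a preimage of `v₀` of
-- weight `lam` goes to some `a v` with `a v₀ = v₀`. As the maximal ideal kills `v₀ ≠ 0`, `a` is a
-- unit and `v` is in the range of `g`.
theorem exists_projectiveCover_of_isMaxWeight {L : AffineMod 𝔤 A} {lam : Weight H} {v₀ : L.carrier}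
    (hv₀ : v₀ ∈ weightSpace H L lam) (hgen₀ : L.gen (Submodule.span A {v₀}) = ⊤)
    (hm : ∀ a ∈ IsLocalRing.maximalIdeal A, ∀ z : L.carrier, a • z = 0) (hne : v₀ ≠ 0)
    {J : Set (Weight H)} (hJ : IsOpenWeights H 𝔟 J) (hJb : IsLocallyBounded H 𝔟 J)
    (hLJ : WeightsIn H J L) (hmax : IsMaxWeight 𝔟 J lam) :
    ∃ (P : AffineMod 𝔤 A) (c : P ⟶ L), IsProjectiveCover (truncO H 𝔟 A J) c := by
  obtain ⟨Q, v, hv, hgen, hlift, hQ⟩ := exists_isWeightExtension A h𝔟 hH hJ hJb hmax lam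
  obtain ⟨c, hc⟩ := hlift L hLJ v₀ hv₀
  have hcs : Function.Surjective c.toLin := surjective_of_gen hgen₀ c
    ((Submodule.span_singleton_le_iff_mem _ _).2 ⟨v, hc⟩)
  have hspan : Submodule.span A {v} ≤ weightSpace H Q lam :=
    (Submodule.span_singleton_le_iff_mem _ _).2 hv
  have hQJ := (truncO_iff h𝔟 hH hJb).1 hQ.mem
  refine ⟨Q, c, hQ.mem, (truncO_iff h𝔟 hH hJb).2 hLJ,
    projective_of_lift (quotClosed_truncO h𝔟 hH hJb) hQ.mem hQ.lift, hcs, fun M hM g hg => ?_⟩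
  rw [truncO_iff h𝔟 hH hJb] at hM
  obtain ⟨m, hm1, hm2⟩ := hM.exists_lift (g ≫ c) hg hv₀
  obtain ⟨a, ha⟩ := Submodule.mem_span_singleton.1 (weightSpace_le_of_gen_eq_top h𝔟 hH hQJ hmax
    (bStable_of_isMaxWeight h𝔟 hH hQJ hmax hspan) hgen (hom_mem_weightSpace g hm1))
  have hav : a • v₀ = v₀ := by
    have := hm2
    rwa [Hom.comp_apply, ← ha, map_smul, hc] at this
  have hunit : IsUnit a := by
    by_contra hc
    exact hne (by rw [← hav]; exact hm a hc _)
  obtain ⟨u, rfl⟩ := hunit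
  refine surjective_of_gen hgen g ((Submodule.span_singleton_le_iff_mem _ _).2
    ⟨(↑u⁻¹ : A) • m, ?_⟩)
  rw [map_smul, ← ha, smul_smul, Units.inv_mul, one_smul]

include h𝔟 hH in
-- Each step of the induction restores one maximal weight `ν` above `lam`: the cover for the smaller
-- truncation is extended by a weight space of weight `ν` that is as small as possible.
theorem exists_projectiveCover {L : AffineMod 𝔤 A} {lam : Weight H} {v₀ : L.carrier}
    (hv₀ : v₀ ∈ weightSpace H L lam) (hgen₀ : L.gen (Submodule.span A {v₀}) = ⊤)
    (hL : WeightsIn H (lowerWeights H 𝔟 lam) L)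
    (hm : ∀ a ∈ IsLocalRing.maximalIdeal A, ∀ z : L.carrier, a • z = 0) (hne : v₀ ≠ 0) (n : ℕ) :
    ∀ J : Set (Weight H), IsOpenWeights H 𝔟 J → IsLocallyBounded H 𝔟 J → lam ∈ J →
      {γ | γ ∈ J ∧ WeightLE H 𝔟 lam γ}.ncard ≤ n →
      ∃ (P : AffineMod 𝔤 A) (c : P ⟶ L), IsProjectiveCover (truncO H 𝔟 A J) c := by
  induction n with
  | zero =>
    intro J hJ hJb hlam hn
    rw [nonpos_iff_eq_zero, Set.ncard_eq_zero (hJb lam)] at hn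
    exact (hn.le ⟨hlam, weightLE_refl H lam⟩ : lam ∈ (∅ : Set (Weight H))).elim
  | succ n ih =>
    intro J hJ hJb hlam hn
    have hLJ : WeightsIn H J L := hL.mono fun μ hμ => hJ lam hlam μ hμ
    obtain ⟨ν, hνJ, hlν, hν⟩ := exists_isMaxWeight h𝔟 hH hJb hlam
    by_cases hνl : ν = lam
    · subst hνl
      exact exists_projectiveCover_of_isMaxWeight h𝔟 hH hv₀ hgen₀ hm hne hJ hJb hLJ hν
    have hnle : ¬ WeightLE H 𝔟 ν lam := fun h => hνl (WeightLE.antisymm H h𝔟 hH h hlν)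
    -- By maximality of `ν`, this removes only `ν` itself; written in this form the set is visibly
    -- open.
    set J' : Set (Weight H) := {γ | γ ∈ J ∧ ¬ WeightLE H 𝔟 ν γ} with hJ'
    have hJ'o : IsOpenWeights H 𝔟 J' := fun γ hγ μ hμ =>
      ⟨hJ γ hγ.1 μ hμ, fun h => hγ.2 (h.trans hμ)⟩
    have hJ'b : IsLocallyBounded H 𝔟 J' := fun μ => (hJb μ).subset fun γ hγ => ⟨hγ.1.1, hγ.2⟩
    obtain ⟨P', c', hc'⟩ := ih J' hJ'o hJ'b ⟨hlam, hnle⟩ (by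
      have hlt : {γ | γ ∈ J' ∧ WeightLE H 𝔟 lam γ} ⊂ {γ | γ ∈ J ∧ WeightLE H 𝔟 lam γ} :=
        ⟨fun γ hγ => ⟨hγ.1.1, hγ.2⟩, fun h => (h ⟨hνJ, hlν⟩).1.2 (weightLE_refl H ν)⟩
      have := Set.ncard_lt_ncard hlt (hJb lam)
      omega)
    have hC := quotClosed_truncO (A := A) h𝔟 hH hJb
    obtain ⟨Q, v, hv, hgen, hlift, hQ⟩ := exists_isWeightExtension A h𝔟 hH hJ hJb hν lam
    set g₀ := Q.quotMk _ (Q.isStable_gen (weightSpace H Q ν)) with hg₀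
    have hkill : ∀ {M : AffineMod 𝔤 A}, WeightsIn H J' M → ∀ f : Q ⟶ M,
        LinearMap.ker g₀.toLin ≤ LinearMap.ker f.toLin := fun {M} hM f => by
      rw [hQ.ker]
      exact gen_le (fun w hw => hM.eq_zero (fun h => h.2 (weightLE_refl H ν))
        (hom_mem_weightSpace f hw)) (isStable_ker f)
    have hQJ := (truncO_iff h𝔟 hH hJb).1 hQ.mem
    have hQ' : WeightsIn H J' (Q.quot _ (Q.isStable_gen (weightSpace H Q ν))) := by
      refine (hQJ.of_surjective g₀ hQ.surjective).of_forall fun μ hμ hμ0 => ⟨hμ, fun h => hμ0 ?_⟩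
      have hμν := hν μ hμ h
      subst hμν
      refine eq_bot_iff.2 fun z hz => ?_
      obtain ⟨w, hw, rfl⟩ := hQJ.exists_lift g₀ hQ.surjective hz
      have : w ∈ LinearMap.ker g₀.toLin := by rw [hQ.ker]; exact Q.le_gen _ hw
      exact this
    have hLJ' : WeightsIn H J' L := hL.mono fun μ hμ => hJ'o lam ⟨hlam, hnle⟩ μ hμ
    obtain ⟨c₀, hc₀⟩ := hlift L hLJ v₀ hv₀
    have hc₀s : Function.Surjective c₀.toLin := surjective_of_gen hgen₀ c₀
      ((Submodule.span_singleton_le_iff_mem _ _).2 ⟨v, hc₀⟩)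
    have hP'J' := (truncO_iff h𝔟 hH hJ'b).1 hc'.mem
    have hJJ' : ∀ {M : AffineMod 𝔤 A}, WeightsIn H J' M → truncO H 𝔟 A J M := fun h =>
      (truncO_iff h𝔟 hH hJb).2 (h.mono fun γ hγ => hγ.1)
    obtain ⟨k, hk⟩ := hQ.lift P' L (hJJ' hP'J') (hJJ' hLJ') c' hc'.surjective c₀
    obtain ⟨s, hs⟩ := exists_desc g₀ hQ.surjective k (hkill hP'J' k)
    -- The quotient of `Q` maps onto the cover `P'` because `c'` is essential, and `P'` then splits
    -- off by projectivity.
    have hss : Function.Surjective s.toLin := by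
      refine hc'.essential _ ((truncO_iff h𝔟 hH hJ'b).2 hQ') s (surjective_of_comp (f := g₀) ?_)
      rw [← Category.assoc, hs, hk]
      exact hc₀s
    obtain ⟨j, hj⟩ := exists_lift hc'.projective ((truncO_iff h𝔟 hH hJ'b).2 hQ') hc'.mem s hss (𝟙 P')
    obtain ⟨R, g', hR⟩ := hQ.exists_retract hC hj
    obtain ⟨P, g, hg, hess⟩ := hR.exists_essential hC
    refine ⟨P, g ≫ c', hg.mem, hJJ' hLJ', projective_of_lift hC hg.mem hg.lift,
      surjective_comp hg.surjective hc'.surjective, fun M hM h hh => ?_⟩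
    -- The endomorphism `k ≫ h` of `P` lies over the identity of `L`, but perhaps not over that of
    -- `P'`. It induces some `y'` on `P'`, which is onto as `c'` is essential. A section of `y'`,
    -- lifted to `P`, corrects `k ≫ h` to an endomorphism over the identity of `P'`, to which
    -- essentiality of `g` applies.
    obtain ⟨k, hk⟩ := hg.lift M L hM (hJJ' hLJ') (h ≫ g ≫ c') hh (g ≫ c')
    obtain ⟨y', hy'⟩ := exists_desc g hg.surjective ((k ≫ h) ≫ g) (by
      rw [hg.ker]
      refine gen_le (fun w hw => ?_) (isStable_ker _)
      have : (k ≫ h).toLin w ∈ LinearMap.ker g.toLin := by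
        rw [hg.ker]; exact P.le_gen _ (hom_mem_weightSpace _ hw)
      exact this)
    have hyc : y' ≫ c' = c' := cancel_surjective hg.surjective (by
      rw [← Category.assoc, hy', Category.assoc, Category.assoc]; exact hk)
    have hy's : Function.Surjective y'.toLin :=
      hc'.essential _ hc'.mem y' (by rw [hyc]; exact hc'.surjective)
    obtain ⟨z', hz'⟩ := exists_lift hc'.projective hc'.mem hc'.mem y' hy's (𝟙 P')
    obtain ⟨z, hz⟩ := hg.lift P P' hg.mem (hJJ' hP'J') g hg.surjective (g ≫ z')
    have hsurj := hess (z ≫ k ≫ h) (by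
      rw [Category.assoc, ← hy', ← Category.assoc, hz, Category.assoc, hz', Category.comp_id])
    exact surjective_of_comp (f := z ≫ k) (by rw [Category.assoc]; exact hsurj)

end Covers
end AffineO
end

noncomputable section
namespace AffineO

/-! ## Restricted modules -/

section Restricted

variable {𝔤 : Type u} [LieRing 𝔤] [LieAlgebra ℂ 𝔤] {H 𝔟 : LieSubalgebra ℂ 𝔤}
  {A : Type u} [CommRing A] [Algebra ℂ A] [Algebra (SymmetricAlgebra ℂ H) A]

open AffineMod

/-- The zero module is its own projective cover. -/
theorem isProjectiveCover_id_of_subsingleton {C : ObjectProperty (AffineMod 𝔤 A)}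
    (hC : QuotClosed C) {L : AffineMod 𝔤 A} (hL : C L) (h0 : ∀ z : L.carrier, z = 0) :
    IsProjectiveCover C (𝟙 L) where
  mem := hL
  mem_target := hL
  projective := projective_of_lift hC hL fun M N _ _ f _ p =>
    ⟨⟨0, fun x m => by simp⟩, hom_ext fun m => by
      rw [Hom.comp_apply, h0 m, map_zero, map_zero, map_zero]⟩
  surjective := Function.surjective_id
  essential := fun M _ g _ z => ⟨0, by rw [map_zero, h0 z]⟩

/-- The naturality of a transformation `id → Tⁿ`, on the underlying modules. -/
theorem app_toLin_comp {n : ℤ} (σ : 𝟭 (catO H 𝔟 A).FullSubcategory ⟶ TO H 𝔟 A n)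
    {M N : AffineMod 𝔤 A} (hM : catO H 𝔟 A M) (hN : catO H 𝔟 A N) (f : M ⟶ N) (m : M.carrier) :
    (σ.app ⟨N, hN⟩).hom.toLin (f.toLin m) = f.toLin ((σ.app ⟨M, hM⟩).hom.toLin m) := by
  let f' : (⟨M, hM⟩ : (catO H 𝔟 A).FullSubcategory) ⟶ ⟨N, hN⟩ := ObjectProperty.homMk f
  exact Hom.congr_apply (congrArg (fun k => k.hom) (σ.naturality f')) m

theorem app_mem_restrictionKer {M : AffineMod 𝔤 A} (hM : catO H 𝔟 A M) {n : ℤ} (hn : n ≠ 0)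
    {σ : 𝟭 (catO H 𝔟 A).FullSubcategory ⟶ TO H 𝔟 A n} (hσ : σ ∈ gradedCenter H 𝔟 A n)
    (m : M.carrier) : (σ.app ⟨M, hM⟩).hom.toLin m ∈ restrictionKer H 𝔟 M hM :=
  (le_iSup₂_of_le (f := fun (n : {n : ℤ // n ≠ 0}) (σ : gradedCenter H 𝔟 A n) =>
    LinearMap.range ((AffineMod.T (-(n : ℤ))).map (σ.1.app ⟨M, hM⟩).hom ≫
      AffineMod.twistCancel (n : ℤ) M).toLin) ⟨n, hn⟩ ⟨σ, hσ⟩ le_rfl) ⟨m, rfl⟩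

theorem restrictionKer_le {M : AffineMod 𝔤 A} (hM : catO H 𝔟 A M) {S : Submodule A M.carrier}
    (h : ∀ n : ℤ, n ≠ 0 → ∀ σ ∈ gradedCenter H 𝔟 A n, ∀ m, (σ.app ⟨M, hM⟩).hom.toLin m ∈ S) :
    restrictionKer H 𝔟 M hM ≤ S := by
  refine iSup₂_le fun n σ => ?_
  rintro _ ⟨m, rfl⟩
  exact h n n.2 σ σ.2 m

theorem restrictedO_of_surjective {M N : AffineMod 𝔤 A} (hM : restrictedO H 𝔟 A M)
    (hN : catO H 𝔟 A N) (f : M ⟶ N) (hf : Function.Surjective f.toLin) :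
    restrictedO H 𝔟 A N := by
  obtain ⟨hM, h⟩ := hM
  refine ⟨hN, fun n hn σ hσ => LinearMap.ext fun z => ?_⟩
  obtain ⟨m, rfl⟩ := hf z
  have h1 := app_toLin_comp σ hM hN f m
  rw [h n hn σ hσ] at h1
  exact h1.trans (map_zero f.toLin)

theorem restrictedO_restriction {M : AffineMod 𝔤 A} (hM : catO H 𝔟 A M)
    (hN : catO H 𝔟 A (restriction H 𝔟 M hM)) :
    restrictedO H 𝔟 A (restriction H 𝔟 M hM) := by
  refine ⟨hN, fun n hn σ hσ => LinearMap.ext fun z => ?_⟩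
  obtain ⟨m, rfl⟩ := quotMk_surjective M _ (isStable_restrictionKer H 𝔟 M hM) z
  exact (app_toLin_comp σ hM hN (restrictionMk H 𝔟 M hM) m).trans
    ((Submodule.Quotient.mk_eq_zero _).2 (app_mem_restrictionKer hM hn hσ m))

theorem restrictionMk_surjective (M : AffineMod 𝔤 A) (hM : catO H 𝔟 A M) :
    Function.Surjective (restrictionMk H 𝔟 M hM).toLin := quotMk_surjective _ _ _

theorem existsUnique_restriction_desc {M N : AffineMod 𝔤 A} (hM : catO H 𝔟 A M)
    (hN : restrictedO H 𝔟 A N) (f : M ⟶ N) :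
    ∃! g : restriction H 𝔟 M hM ⟶ N, restrictionMk H 𝔟 M hM ≫ g = f := by
  obtain ⟨hN, h⟩ := hN
  refine ⟨quotLift f _ (isStable_restrictionKer H 𝔟 M hM)
    (restrictionKer_le hM fun n hn σ hσ m => ?_), quotMk_quotLift _ _ _ _, fun g hg =>
    cancel_surjective (restrictionMk_surjective M hM) (hg.trans (quotMk_quotLift _ _ _ _).symm)⟩
  have h1 := app_toLin_comp σ hM hN f m
  rw [h n hn σ hσ] at h1
  exact h1.symm

/-- Lifts from the restriction are obtained by lifting from `P` and factoring through the quotient,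
since the target is restricted. -/
theorem isProjectiveCover_restriction {J : Set (Weight H)} (hC : QuotClosed (truncO H 𝔟 A J))
    {P L : AffineMod 𝔤 A} {c : P ⟶ L} (hc : IsProjectiveCover (truncO H 𝔟 A J) c)
    (hL : restrictedO H 𝔟 A L) {q : restriction H 𝔟 P hc.mem.1 ⟶ L}
    (hq : restrictionMk H 𝔟 P hc.mem.1 ≫ q = c) :
    IsProjectiveCover (restrictedTruncO H 𝔟 A J) q := by
  set π := restrictionMk H 𝔟 P hc.mem.1 with hπ
  have hπs : Function.Surjective π.toLin := restrictionMk_surjective P hc.mem.1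
  have hPb : truncO H 𝔟 A J (restriction H 𝔟 P hc.mem.1) := hC _ _ π hπs hc.mem
  have hmem : restrictedTruncO H 𝔟 A J (restriction H 𝔟 P hc.mem.1) :=
    ⟨restrictedO_restriction hc.mem.1 hPb.1, hPb⟩
  have hC' : QuotClosed (restrictedTruncO H 𝔟 A J) := fun M N f hf hM =>
    ⟨restrictedO_of_surjective hM.1 (hC _ _ f hf hM.2).1 f hf, hC _ _ f hf hM.2⟩
  refine ⟨hmem, ⟨hL, hc.mem_target⟩, projective_of_lift hC' hmem fun M N hM hN f hf p => ?_,
    surjective_of_comp (f := π) (by rw [hq]; exact hc.surjective), fun M hM g hg => ?_⟩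
  · obtain ⟨r, hr⟩ := exists_lift hc.projective hM.2 hN.2 f hf (π ≫ p)
    obtain ⟨r', hr', -⟩ := existsUnique_restriction_desc hc.mem.1 hM.1 r
    refine ⟨r', cancel_surjective hπs ?_⟩
    rw [← Category.assoc, hr', hr]
  -- Lift `c` to `h : P ⟶ M`, then `h ≫ g` to an endomorphism `y` of `P`. Since `y ≫ c = c`,
  -- essentiality of `c` makes `y` onto, and hence `g` too.
  · obtain ⟨h, hh⟩ := exists_lift hc.projective hM.2 hc.mem_target (g ≫ q) hg c
    obtain ⟨y, hy⟩ := exists_lift hc.projective hc.mem hPb π hπs (h ≫ g)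
    have hys : Function.Surjective y.toLin := hc.essential P hc.mem y (by
      rw [← hq, ← Category.assoc, hy, Category.assoc, hh]; exact hc.surjective)
    refine surjective_of_comp (f := h) ?_
    rw [← hy]
    exact surjective_comp hys hπs

variable [FiniteDimensional ℂ 𝔤] [LieAlgebra.IsSimple ℂ 𝔤] [H.IsCartanSubalgebra]
  (h𝔟 : IsBorel 𝔟) (hH : H ≤ 𝔟)

include h𝔟 hH in
theorem add_delta_notMem_lowerWeights (lam : Weight H) {k : ℕ} (hk : 0 < k) :
    lam + (k : ℂ) • delta H ∉ lowerWeights H 𝔟 lam := by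
  intro h
  have h1 : WeightLE H 𝔟 lam (lam + (k : ℂ) • delta H) := by
    rw [WeightLE, add_sub_cancel_left]
    exact AddSubmonoid.subset_closure (Or.inr ⟨k, hk, rfl⟩)
  have h2 := LinearMap.congr_fun (WeightLE.antisymm H h𝔟 hH h h1) (0, 0, 1)
  have h3 : delta H (0, 0, 1) = 1 := rfl
  simp [h3, hk.ne'] at h2

include h𝔟 hH in
-- In negative degree the image of `v` would have a weight `lam + kδ`, which does not occur. In
-- positive degree the range is a submodule of `L`, hence zero or everything. In the latter case a
-- preimage of `v` would again have weight `lam + kδ`.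
theorem restrictedO_of_highestWeight {L : AffineMod 𝔤 A} {lam : Weight H} {v : L.carrier}
    (hv : v ∈ weightSpace H L lam) (hgen : L.gen (Submodule.span A {v}) = ⊤)
    (hL : WeightsIn H (lowerWeights H 𝔟 lam) L)
    (hsimple : ∀ N : Submodule A L.carrier, L.IsStable N → N ≠ ⊤ → N = ⊥)
    (hO : catO H 𝔟 A L) : restrictedO H 𝔟 A L := by
  refine ⟨hO, fun n hn σ _ => ?_⟩
  let f : L ⟶ L.twist n := (σ.app ⟨L, hO⟩).hom
  change f.toLin = 0
  have hzero : f.toLin v = 0 → f.toLin = 0 := fun h => by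
    have h1 := eq_top_of_gen hgen ((Submodule.span_singleton_le_iff_mem _ _).2
      (LinearMap.mem_ker.2 h)) (isStable_ker f)
    exact LinearMap.ker_eq_top.1 h1
  rcases hn.lt_or_gt with hn | hn
  · obtain ⟨k, rfl⟩ := Int.exists_eq_neg_ofNat hn.le
    have h1 := hom_mem_weightSpace f hv
    rw [weightSpace_twist] at h1
    push_cast at h1
    rw [neg_smul, sub_neg_eq_add] at h1
    exact hzero (hL.eq_zero (add_delta_notMem_lowerWeights h𝔟 hH lam (by omega)) h1)
  · obtain ⟨k, rfl⟩ := Int.eq_ofNat_of_zero_le hn.le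
    let R : Submodule A L.carrier := LinearMap.range f.toLin
    -- The twist changes the action only by scalars, so `L` and its twist have the same submodules.
    have hR : L.IsStable R := fun x m hm => by
      have h1 : L.ρ x m + algebraMap ℂ A ((k : ℤ) * x.cD) • m ∈ R := isStable_range f x hm
      exact (Submodule.add_mem_iff_left _ (R.smul_mem _ hm)).1 h1
    by_cases h : R = ⊤
    · have hs : Function.Surjective f.toLin := LinearMap.range_eq_top.1 h
      have h1 : v ∈ weightSpace H (L.twist (k : ℤ)) (lam + (k : ℂ) • delta H) := by
        have h2 : lam + (k : ℂ) • delta H - ((k : ℤ) : ℂ) • delta H = lam := by simp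
        rw [weightSpace_twist, h2]
        exact hv
      obtain ⟨m, hm, hmv⟩ := hL.exists_lift f hs h1
      have hm0 := hL.eq_zero (add_delta_notMem_lowerWeights h𝔟 hH lam (by omega)) hm
      rw [hm0, map_zero] at hmv
      refine hzero ?_
      rw [← hmv]
      exact map_zero f.toLin
    · exact LinearMap.range_eq_bot.1 (hsimple R hR h)

end Restricted
end AffineO
end

/-! ### The theorem on restricted projective covers -/

theorem mainTheorem2 {𝔤 : Type u} [LieRing 𝔤] [LieAlgebra ℂ 𝔤] [FiniteDimensional ℂ 𝔤]
    [LieAlgebra.IsSimple ℂ 𝔤] (H : LieSubalgebra ℂ 𝔤) [H.IsCartanSubalgebra]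
    (𝔟 : LieSubalgebra ℂ 𝔤) (h𝔟 : AffineO.IsBorel 𝔟) (hH : H ≤ 𝔟)
    (A : Type u) [CommRing A] [Algebra ℂ A] [Algebra (SymmetricAlgebra ℂ H) A]
    [IsScalarTower ℂ (SymmetricAlgebra ℂ H) A] [IsNoetherianRing A] [IsLocalRing A]
    (J : Set (AffineO.Weight H)) (hJo : AffineO.IsOpenWeights H 𝔟 J)
    (hJb : AffineO.IsLocallyBounded H 𝔟 J) (lam : AffineO.Weight H) (hlam : lam ∈ J) :
    (∃ (Q : AffineO.AffineMod 𝔤 A) (q : Q ⟶ AffineO.simpleObj H 𝔟 A lam),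
      AffineO.IsProjectiveCover (AffineO.restrictedTruncO H 𝔟 A J) q) ∧
    (∃ (P : AffineO.AffineMod 𝔤 A) (c : P ⟶ AffineO.simpleObj H 𝔟 A lam),
      AffineO.IsProjectiveCover (AffineO.truncO H 𝔟 A J) c) ∧
    ∀ (P : AffineO.AffineMod 𝔤 A) (c : P ⟶ AffineO.simpleObj H 𝔟 A lam)
      (hc : AffineO.IsProjectiveCover (AffineO.truncO H 𝔟 A J) c),
      AffineO.restrictedO H 𝔟 A (AffineO.restriction H 𝔟 P hc.mem.1) ∧
      (∀ N : AffineO.AffineMod 𝔤 A, AffineO.restrictedO H 𝔟 A N → ∀ f : P ⟶ N,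
        ∃! g : AffineO.restriction H 𝔟 P hc.mem.1 ⟶ N,
          AffineO.restrictionMk H 𝔟 P hc.mem.1 ≫ g = f) ∧
      ∃ q : AffineO.restriction H 𝔟 P hc.mem.1 ⟶ AffineO.simpleObj H 𝔟 A lam,
        AffineO.restrictionMk H 𝔟 P hc.mem.1 ≫ q = c ∧
        AffineO.IsProjectiveCover (AffineO.restrictedTruncO H 𝔟 A J) q := by
  obtain ⟨v, hv, hgen, hL, hm, hsimple⟩ := AffineO.exists_gen_simpleObj H h𝔟 hH (A := A) lam
  have hC := AffineO.quotClosed_truncO (A := A) h𝔟 hH hJb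
  have hLJ : AffineO.truncO H 𝔟 A J (AffineO.simpleObj H 𝔟 A lam) :=
    (AffineO.truncO_iff h𝔟 hH hJb).2 (hL.mono fun μ hμ => hJo lam hlam μ hμ)
  have hLr := AffineO.restrictedO_of_highestWeight h𝔟 hH hv hgen hL hsimple hLJ.1
  have hcover : ∃ (P : AffineO.AffineMod 𝔤 A) (c : P ⟶ AffineO.simpleObj H 𝔟 A lam),
      AffineO.IsProjectiveCover (AffineO.truncO H 𝔟 A J) c := by
    -- The case `v = 0` is disposed of formally, since a zero object is its own projective cover; so
    -- the Verma module need not be shown to be nonzero.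
    by_cases hv0 : v = 0
    · have h0 := AffineO.AffineMod.eq_top_of_gen hgen (S := ⊥) (by simp [hv0])
        (AffineO.AffineMod.isStable_bot _)
      exact ⟨_, _, AffineO.isProjectiveCover_id_of_subsingleton hC hLJ fun z =>
        h0.ge (Submodule.mem_top (x := z))⟩
    · exact AffineO.exists_projectiveCover h𝔟 hH hv hgen hL hm hv0 _ J hJo hJb hlam le_rfl
  have hrestr : ∀ (P : AffineO.AffineMod 𝔤 A) (c : P ⟶ AffineO.simpleObj H 𝔟 A lam)
      (hc : AffineO.IsProjectiveCover (AffineO.truncO H 𝔟 A J) c),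
      ∃ q : AffineO.restriction H 𝔟 P hc.mem.1 ⟶ AffineO.simpleObj H 𝔟 A lam,
        AffineO.restrictionMk H 𝔟 P hc.mem.1 ≫ q = c ∧
        AffineO.IsProjectiveCover (AffineO.restrictedTruncO H 𝔟 A J) q := fun P c hc => by
    obtain ⟨q, hq, -⟩ := AffineO.existsUnique_restriction_desc hc.mem.1 hLr c
    exact ⟨q, hq, AffineO.isProjectiveCover_restriction hC hc hLr hq⟩
  refine ⟨?_, hcover, fun P c hc => ⟨?_, fun N hN f =>
    AffineO.existsUnique_restriction_desc hc.mem.1 hN f, hrestr P c hc⟩⟩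
  · obtain ⟨P, c, hc⟩ := hcover
    obtain ⟨q, -, hq⟩ := hrestr P c hc
    exact ⟨_, q, hq⟩
  · exact AffineO.restrictedO_restriction hc.mem.1
      (hC _ _ _ (AffineO.restrictionMk_surjective P hc.mem.1) hc.mem).1
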